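/- **Conventions.** $\theta$ is an uncountable (strongly) compact cardinal: it is regular and every proper $\theta$-complete filter on a set extends to a $\theta$-complete ultrafilter. A vocabulary $\tau$ consists of predicates and function symbols with finitely many places; models are non-empty, and $\|M\|$ is the cardinality of $M$. An equivalence relation $E$ refines $E'$ when $E\subseteq E'$. *$\mathbb L^1_\theta$-equivalence.* For a vocabulary $\tau_1$, a cardinal $\mu$, an ordinal $\alpha$ and $\tau_1$-models $N_1,N_2$, the game $\Game_{\mu,\alpha}[N_1,N_2]$ is as follows. A state consists of sets $A^\ell\subseteq N_\ell$ with $|A^\ell|\le\mu$ and functions $h^\ell:A^\ell\to\omega$ ($\ell=1,2$), a partial one-to-one function $g$ from $N_1$ to $N_2$, an ordinal $\beta\le\alpha$ and some $n<\omega$, such that, with $g^1=g$ and $g^2=g^{-1}$, $\mathrm{Dom}(g^\ell)\subseteq A^\ell$, $h^\ell(a)<n$ for $a\in\mathrm{Dom}(g^\ell)$, and $g$ preserves all quantifier-free first-order $\tau_1$-formulas and their negations. The play starts with $n=0$, $\beta=\alpha$ and all sets and functions empty. In a move at a state with number $n$, the player AIS chooses $\iota\in\{1,2\}$, $\beta'<\beta$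 and $A'\supseteq A^\iota$, $A'\subseteq N_\iota$, $|A'|\le\mu$; the player ISO chooses a state with number $n+1$ and ordinal $\beta'$ whose $A^\ell,h^\ell,g$ extend the old ones, whose new $A^\iota$ is $A'$ and whose new $A^{3-\iota}$ is the old one together with the new $\mathrm{Dom}(g^{3-\iota})$, such that the new $h^\iota$ is $\ge n+1$ on $A'$ minus the old $A^\iota$, and the new $\mathrm{Dom}(g^\iota)$ is the set of $a$ in the old $A^\iota$ with $h^\iota(a)<n+1$. A player without a legal move loses; ISO also loses if the initial position is not a state. $M_1,M_2$ are $\mathbb L^1_\theta$-equivalent if for all $\mu<\theta$, $\alpha<\mu^+$ and $\tau_1\subseteq\tau$ with $|\tau_1|\le\mu$, the reducts $M_1{\restriction}\tau_1,M_2{\restriction}\tau_1$ are related by the equivalence relation on $\tau_1$-models generated by "ISO has a winning strategy in $\Game_{\mu,\alpha}[N_1,N_2]$". *Limit ultrapowers.* $(I,D,\mathscr E)$ is a $(\kappa,\sigma)$-l.u.f.t. if $D$ is a filter on $I$; $\mathscr E$ is a family of equivalence relations on $I$ such that any fewer than $\sigma$ members of $\mathscr E$ have a common refinement in $\mathscr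 E$; and for each $E\in\mathscr E$ the family $D/E$ of all $X/E$, with $X\in D$ a union of $E$-classes, is a $\kappa$-complete ultrafilter on $I/E$. "l.u.f.t." means $(\theta,\aleph_0)$-l.u.f.t. $M^I_D|\mathscr E$, also written $\mathrm{l.u.p.}_{\mathbf x}(M)$ for $\mathbf x=(I,D,\mathscr E)$, is the submodel of the reduced power $M^I/D$ with elements the $f/D$ such that some $E\in\mathscr E$ refines $\{(s,t):f(s)=f(t)\}$. *Ultrafilters.* $\mathrm{uf}_\theta(I)$ is the set of non-principal $\theta$-complete ultrafilters on $I$. A filter $D$ on $I$ is $(\lambda,\theta)$-regular if there are $w_t\subseteq\lambda$, $|w_t|<\theta$ ($t\in I$), with $\{t:\alpha\in w_t\}\in D$ for every $\alpha<\lambda$; $\mathrm{ruf}_{\lambda,\theta}(I)$ is the set of $(\lambda,\theta)$-regular $D\in\mathrm{uf}_\theta(I)$. For $D_n\in\mathrm{uf}_\theta(I_n)$ ($n<\omega$) put $M^\ell_0=M_\ell$, $M^\ell_{n+1}=(M^\ell_n)^{I_n}/D_n$, and let $M^\ell_\omega=\bigcup_n M^\ell_n$, where $M^\ell_n$ is identified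 with its image in $M^\ell_{n+1}$ under the diagonal embedding. *Niceness.* Given cardinals $\lambda_n$, a niceness witness for $(I,D,\langle E_n:n<\omega\rangle)$ is $\langle w_{s,n},\gamma_{s,n}:s\in I,n<\omega\rangle$ such that for all $s,t\in I$ and $n<\omega$: $w_{s,n}\subseteq\lambda_n$, $|w_{s,n}|<\theta$, $|w_{s,n+1}|\le|w_{s,n}|$; $\gamma_{s,n}$ is an ordinal $<\theta$, and $\gamma_{s,n+1}<\gamma_{s,n}$ or $\gamma_{s,n+1}=0$; $\gamma_{s,n}=0$ implies $w_{s,n}=\emptyset$; $w_{s,0}$ is infinite; $\{r\in I:u\subseteq w_{r,n}\}\in D$ for all $u\subseteq\lambda_n$ with $|u|<\theta$; and $s\,E_n\,t$ implies $w_{s,n}=w_{t,n}$ and $\gamma_{s,n}=\gamma_{t,n}$. **Theorem.** Let $\theta$ be a compact uncountable cardinal and let $M_1,M_2$ be $\tau$-models. The following are equivalent: (a) $M_1,M_2$ are $\mathbb L^1_\theta$-equivalent; (b) there are $(\theta,\theta)$-l.u.f.t.'s $(I,D,\mathscr E_n)$, $n<\omega$ (with the same $I,D$), with $\mathscr E_n\subseteq\mathscr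 E_{n+1}$, such that, for $\mathscr E=\bigcup_n\mathscr E_n$, $(M_1)^I_D|\mathscr E\cong(M_2)^I_D|\mathscr E$; (c) $(M_1,M_2)$ have isomorphic $\theta$-complete $\omega$-iterated ultrapowers: there are $I_n$ and $D_n\in\mathrm{uf}_\theta(I_n)$, $n<\omega$, with $M^1_\omega\cong M^2_\omega$; (d) whenever $D_n\in\mathrm{ruf}_{\lambda_n,\theta}(I_n)$ (hence $|I_n|\ge\lambda_n$) and $\lambda_{n+1}\ge 2^{|I_n|}\cdot\lambda_n>\|M_1\|+\|M_2\|+|\tau|$ for every $n<\omega$, the sequence $\langle(I_n,D_n):n<\omega\rangle$ is as in (c), that is, $M^1_\omega\cong M^2_\omega$; (e) whenever $\mathbf x=(I,D,\mathscr E)$ is a l.u.f.t. with $\mathscr E=\{E_n:n<\omega\}$, and, for every $n$, $E_{n+1}$ refines $E_n$, $2^{|I/E_n|}\le\lambda_{n+1}$ and $D/E_n$ is a $(\lambda_n,\theta)$-regular $\theta$-complete ultrafilter, $\lambda_0\ge\|M_1\|+\|M_2\|+|\tau|$, and there is a niceness witness for $(I,D,\langle E_n:n<\omega\rangle)$ with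 respect to $\langle\lambda_n:n<\omega\rangle$, then $\mathrm{l.u.p.}_{\mathbf x}(M_1)\cong\mathrm{l.u.p.}_{\mathbf x}(M_2)$. -/

import Mathlib

open FirstOrder Cardinal

universe u

namespace LimUlt

open FirstOrder.Language FirstOrder.Language.Structure

/-! ### Complete and regular filters, compact cardinals -/

/-- `θ` is a compact (that is, strongly compact) cardinal: it is uncountable and regular, and every
proper `θ`-complete filter on a set extends to a `θ`-complete ultrafilter on that set.
`CardinalInterFilter F θ` says that `F` is closed under intersections of fewer than `θ` members. -/
def IsCompactCardinal (θ : Cardinal.{u}) : Prop :=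
  ℵ₀ < θ ∧ θ.IsRegular ∧
    ∀ (X : Type u) (F : Filter X), F.NeBot → CardinalInterFilter F θ →
      ∃ U : Ultrafilter X, (U : Filter X) ≤ F ∧ CardinalInterFilter (U : Filter X) θ

/-- `D` is a `(lam, θ)`-regular filter: there are sets `w t ⊆ lam` of cardinality `< θ` such that
every `a < lam` lies in `w t` for `D`-almost all `t`. (`lam.ord.ToType` is the set of ordinals
below the cardinal `lam`.) -/
def IsRegularFilter {X : Type u} (lam θ : Cardinal.{u}) (D : Filter X) : Prop :=
  ∃ w : X → Set lam.ord.ToType, (∀ t, #(w t) < θ) ∧ ∀ a, {t | a ∈ w t} ∈ D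

/-- `uf θ X`: the non-principal `θ`-complete ultrafilters on `X`. -/
def uf (θ : Cardinal.{u}) (X : Type u) : Set (Ultrafilter X) :=
  {D | CardinalInterFilter (D : Filter X) θ ∧ ∀ x : X, D ≠ pure x}

/-- `ruf lam θ X`: the `(lam, θ)`-regular members of `uf θ X`. -/
def ruf (lam θ : Cardinal.{u}) (X : Type u) : Set (Ultrafilter X) :=
  {D | D ∈ uf θ X ∧ IsRegularFilter lam θ (D : Filter X)}

/-! ### The logic `𝕃¹_θ`: the delayed Ehrenfeucht-Fraïssé game -/

section Game

variable (L : FirstOrder.Language.{u, u}) (M N : Type u)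

/-- The data of a position of the game on `(M, N)`. The functions `h₁`, `h₂` are only meaningful on
`A₁`, `A₂`; `g` is a partial one-to-one function from `M` to `N`. -/
structure GameState where
  A₁ : Set M
  A₂ : Set N
  h₁ : M → ℕ
  h₂ : N → ℕ
  g : M ≃. N
  β : Ordinal.{u}
  n : ℕ

variable {M N}

/-- The same position with the two models interchanged. -/
def GameState.swap (s : GameState M N) : GameState N M :=
  ⟨s.A₂, s.A₁, s.h₂, s.h₁, s.g.symm, s.β, s.n⟩

variable (M N) in
/-- The initial position: all sets and functions are empty. -/
def GameState.init (α : Ordinal.{u}) : GameState M N :=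
  ⟨∅, ∅, fun _ => 0, fun _ => 0, ⊥, α, 0⟩

/-- `s` is a state of the game with parameters `μ` and `α`: the sets have cardinality at most `μ`,
`g` goes from a subset of `A₁` to a subset of `A₂`, it preserves the quantifier-free first-order
formulas, in both directions, and only elements of delay `< n` occur in its domain and range. -/
def IsState [L.Structure M] [L.Structure N] (μ : Cardinal.{u}) (α : Ordinal.{u})
    (s : GameState M N) : Prop :=
  #s.A₁ ≤ μ ∧ #s.A₂ ≤ μ ∧ s.β ≤ α ∧
    (∀ a b, b ∈ s.g a → a ∈ s.A₁ ∧ b ∈ s.A₂ ∧ s.h₁ a < s.n ∧ s.h₂ b < s.n) ∧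
    ∀ (k : ℕ) (φ : L.Formula (Fin k)), BoundedFormula.IsQF φ →
      ∀ (a : Fin k → M) (b : Fin k → N), (∀ i, b i ∈ s.g (a i)) →
        (φ.Realize a ↔ φ.Realize b)

/-- `t` is a successor of `s`. -/
def IsSuccessor (s t : GameState M N) : Prop :=
  s.A₁ ⊆ t.A₁ ∧ s.A₂ ⊆ t.A₂ ∧ (∀ a ∈ s.A₁, t.h₁ a = s.h₁ a) ∧ (∀ b ∈ s.A₂, t.h₂ b = s.h₂ b) ∧
    s.g ≤ t.g ∧ t.β < s.β ∧ t.n = s.n + 1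

/-- The anti-isomorphism player may, at the position `s`, choose the ordinal `β` and the set `A` of
elements of the first model. -/
def LegalMove (μ : Cardinal.{u}) (s : GameState M N) (β : Ordinal.{u}) (A : Set M) : Prop :=
  β < s.β ∧ s.A₁ ⊆ A ∧ #A ≤ μ

/-- The isomorphism player may answer the move `(β, A)`, with `A` in the first model, made at the
position `s`, by the position `t`. -/
def LegalAnswer (s : GameState M N) (β : Ordinal.{u}) (A : Set M) (t : GameState M N) : Prop :=
  IsSuccessor s t ∧
    t.A₁ = A ∧
    t.A₂ = s.A₂ ∪ {b | ∃ a, b ∈ t.g a} ∧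
    (∀ a ∈ A, a ∉ s.A₁ → s.n + 1 ≤ t.h₁ a) ∧
    (∀ a, (∃ b, b ∈ t.g a) ↔ a ∈ s.A₁ ∧ s.h₁ a < s.n + 1) ∧
    t.β = β

variable (M N) in
/-- The isomorphism player has a winning strategy in the game of parameters `μ`, `α` on `(M, N)`.
The strategy is given by the set `W` of positions in which it keeps the play: the initial position
is in `W`, all members of `W` are states, and every legal move of the anti-isomorphism player at a
position in `W`, in either model, has a legal answer in `W`. As the ordinals `β` decrease, every
play is finite, so it is the anti-isomorphism player who runs out of legal moves. -/
def ISOWins [L.Structure M] [L.Structure N] (μ : Cardinal.{u}) (α : Ordinal.{u}) : Prop :=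
  ∃ W : Set (GameState M N), GameState.init M N α ∈ W ∧
    ∀ s ∈ W, IsState L μ α s ∧
      (∀ β A, LegalMove μ s β A → ∃ t ∈ W, LegalAnswer s β A t) ∧
      (∀ β A, LegalMove μ s.swap β A → ∃ t ∈ W, LegalAnswer s.swap β A t.swap)

end Game

/-- The vocabulary whose symbols are those in the set `S` of symbols of `L`. -/
def subLanguage (L : FirstOrder.Language.{u, u}) (S : Set L.Symbols) : FirstOrder.Language.{u, u} where
  Functions k := {f : L.Functions k // Sum.inl ⟨k, f⟩ ∈ S}
  Relations k := {r : L.Relations k // Sum.inr ⟨k, r⟩ ∈ S}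

/-- The inclusion of a sub-vocabulary. -/
def subLanguageIncl (L : FirstOrder.Language.{u, u}) (S : Set L.Symbols) : subLanguage L S →ᴸ L where
  onFunction _ f := f.1
  onRelation _ r := r.1

/-- The reduct of `M` to a sub-vocabulary, as a bundled (non-empty) model. -/
def reductModel (L : FirstOrder.Language.{u, u}) (S : Set L.Symbols) (M : Type u) [L.Structure M]
    [Nonempty M] : Theory.ModelType.{u, u, u} (∅ : (subLanguage L S).Theory) :=
  letI := (subLanguageIncl L S).reduct M
  ⟨M⟩

/-- `M₁` and `M₂` are `𝕃¹_θ`-equivalent: for all `μ < θ`, `α < μ⁺` and sub-vocabularies `S` of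
cardinality at most `μ`, the reducts of `M₁`, `M₂` to `S` are equivalent for the equivalence
relation, on the class of models of vocabulary `S`, generated by the relation "the isomorphism
player has a winning strategy". -/
def L1Equiv (θ : Cardinal.{u}) (L : FirstOrder.Language.{u, u}) (M₁ M₂ : Type u)
    [L.Structure M₁] [L.Structure M₂] [Nonempty M₁] [Nonempty M₂] : Prop :=
  ∀ μ < θ, ∀ α < (Order.succ μ).ord, ∀ S : Set L.Symbols, #S ≤ μ →
    Relation.EqvGen
      (fun A B : Theory.ModelType.{u, u, u} (∅ : (subLanguage L S).Theory) =>
        ISOWins (subLanguage L S) A B μ α)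
      (reductModel L S M₁) (reductModel L S M₂)

/-! ### Limit ultrapowers -/

/-- `(I, D, ℰ)` is a `(κ, σ)`-l.u.f.t. For equivalence relations, `E ≤ E'` says that `E` refines
`E'`. The image filter of `D` on the quotient `I/E` consists of the sets `X/E` for `X ∈ D`
respecting `E`. -/
structure IsLUFT (κ σ : Cardinal.{u}) {I : Type u} (D : Filter I) (ℰ : Set (Setoid I)) :
    Prop where
  directed : ∀ S ⊆ ℰ, #S < σ → ∃ E ∈ ℰ, ∀ E' ∈ S, E ≤ E'
  ultra : ∀ E ∈ ℰ,
    (∃ U : Ultrafilter (Quotient E), (U : Filter (Quotient E)) = D.map (Quotient.mk E)) ∧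
      CardinalInterFilter (D.map (Quotient.mk E)) κ

theorem IsLUFT.iUnion {κ σ : Cardinal.{u}} (hσ : ℵ₀ ≤ σ) {I : Type u} {D : Filter I}
    {ℰ : ℕ → Set (Setoid I)} (h : ∀ n, IsLUFT κ σ D (ℰ n)) (hmono : ∀ n, ℰ n ⊆ ℰ (n + 1)) :
    IsLUFT κ ℵ₀ D (⋃ n, ℰ n) where
  directed S hS hfin := by
    have hm : Monotone ℰ := monotone_nat_of_le_succ hmono
    have hfin' : S.Finite := Cardinal.lt_aleph0_iff_set_finite.1 hfin
    choose! k hk using fun E (hE : E ∈ S) => Set.mem_iUnion.1 (hS hE)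
    obtain ⟨n, hn⟩ := (hfin'.image k).bddAbove
    have hn : S ⊆ ℰ n := fun E hE => hm (hn ⟨E, hE, rfl⟩) (hk E hE)
    obtain ⟨E, hE, h'⟩ := (h n).directed S hn (hfin.trans_le hσ)
    exact ⟨E, Set.mem_iUnion.2 ⟨n, hE⟩, h'⟩
  ultra E hE := by
    obtain ⟨n, hn⟩ := Set.mem_iUnion.1 hE
    exact (h n).ultra E hn

section Power

variable {L : FirstOrder.Language.{u, u}} {I : Type u}

instance reducedPrestructure (D : Filter I) (M : Type u) [L.Structure M] :
    L.Prestructure (D.productSetoid fun _ => M) where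
  toStructure :=
    { funMap := fun {_} f x a => funMap f fun i => x i a
      RelMap := fun {_} r x => ∀ᶠ a in D, RelMap r fun i => x i a }
  fun_equiv := fun {n} f x y xy => by
    have h : ∀ᶠ a in D, ∀ i, x i a = y i a := Filter.eventually_all.2 xy
    exact h.mono fun a ha => congrArg (funMap f) (funext ha)
  rel_equiv := fun {n} r x y xy => by
    have h : ∀ᶠ a in D, ∀ i, x i a = y i a := Filter.eventually_all.2 xy
    refine propext (Filter.eventually_congr (h.mono fun a ha => ?_))
    rw [show (fun i => x i a) = fun i => y i a from funext ha]

/-- The reduced power `M^I/D`, for an arbitrary filter `D`. -/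
def ReducedPower (D : Filter I) (M : Type u) : Type u :=
  Quotient (D.productSetoid fun _ => M)

instance (D : Filter I) (M : Type u) [L.Structure M] : L.Structure (ReducedPower D M) :=
  inferInstanceAs (L.Structure (Quotient _))

/-- The class `f/D` in the reduced power. -/
def ReducedPower.mk (D : Filter I) {M : Type u} (f : I → M) : ReducedPower D M :=
  Quotient.mk (D.productSetoid fun _ => M) f

/-- The limit reduced power `M^I_D|ℰ`: the submodel of `M^I/D` whose elements are the `f/D` such
that `eq(f)` is refined by some `E ∈ ℰ`. -/
def limitPower (M : Type u) [L.Structure M] {κ : Cardinal.{u}} {D : Filter I}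
    {ℰ : Set (Setoid I)} (hx : IsLUFT κ ℵ₀ D ℰ) : L.Substructure (ReducedPower D M) where
  carrier := {x | ∃ f : I → M, (∃ E ∈ ℰ, E ≤ Setoid.ker f) ∧ ReducedPower.mk D f = x}
  fun_mem := by
    intro n F x h
    choose f hf hfx using h
    choose E hE hEf using hf
    obtain ⟨E', hE', hle⟩ := hx.directed (Set.range E) (by rintro _ ⟨i, rfl⟩; exact hE i)
      (Cardinal.lt_aleph0_iff_set_finite.2 (Set.finite_range E))
    refine ⟨fun s => funMap F fun i => f i s, ⟨E', hE', fun s t hst => ?_⟩, ?_⟩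
    · refine congrArg (funMap F) (funext fun i => ?_)
      exact hEf i (hle (E i) ⟨i, rfl⟩ hst)
    · obtain rfl : (fun i => ReducedPower.mk D (f i)) = x := funext hfx
      exact (funMap_quotient_mk' (L := L) (D.productSetoid fun _ => M) F f).symm

end Power

/-! ### Iterated ultrapowers -/

section Iterated

variable {L : FirstOrder.Language.{u, u}}

/-- The diagonal embedding of a model into its ultrapower. -/
def diag (M : Type u) [L.Structure M] {I : Type u} (D : Ultrafilter I) :
    M ↪[L] (D : Filter I).Product fun _ => M where
  toFun a := ((fun _ => a : I → M) : (D : Filter I).Product fun _ => M)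
  inj' a b h := by
    have h' : ∀ᶠ _ in (D : Filter I), a = b := Quotient.exact h
    exact Filter.eventually_const.1 h'
  map_fun' {n} F x :=
    (Ultraproduct.funMap_cast (M := fun _ : I => M) (u := D) F fun i _ => x i).symm
  map_rel' {n} R x := by
    refine (relMap_quotient_mk' (L := L) ((D : Filter I).productSetoid fun _ => M) R
      (fun i _ => x i)).trans ?_
    exact Filter.eventually_const (f := (D : Filter I)) (p := RelMap R x)

/-- The `n`-th iterated ultrapower: `M_0 = M` and `M_{n+1} = (M_n)^{I_n}/D_n`. -/
def iterUltrapower (I : ℕ → Type u) (D : ∀ n, Ultrafilter (I n)) (M : Type u) [inst : L.Structure M] :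
    ℕ → CategoryTheory.Bundled.{u} L.Structure
  | 0 => ⟨M, inst⟩
  | n + 1 =>
    letI := (iterUltrapower I D M n).str
    ⟨(D n : Filter (I n)).Product fun _ => (iterUltrapower I D M n).α, Ultraproduct.structure⟩

variable (L)

instance (I : ℕ → Type u) (D : ∀ n, Ultrafilter (I n)) (M : Type u) [L.Structure M] (n : ℕ) :
    L.Structure (iterUltrapower (L := L) I D M n).α :=
  (iterUltrapower I D M n).str

/-- The diagonal embedding of `M_n` into `M_{n+1}`. -/
def iterEmb (I : ℕ → Type u) (D : ∀ n, Ultrafilter (I n)) (M : Type u) [L.Structure M] (n : ℕ) :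
    (iterUltrapower (L := L) I D M n).α ↪[L] (iterUltrapower (L := L) I D M (n + 1)).α :=
  diag (iterUltrapower (L := L) I D M n).α (D n)

/-- The `ω`-iterated ultrapower `M_ω`: the union of the `M_n`, where `M_n` is identified with its
image in `M_{n+1}` under the diagonal embedding (that is, the direct limit). -/
abbrev OmegaUltrapower (I : ℕ → Type u) (D : ∀ n, Ultrafilter (I n)) (M : Type u)
    [L.Structure M] : Type u :=
  DirectLimit (L := L) (fun n => (iterUltrapower (L := L) I D M n).α)
    (DirectedSystem.natLERec (iterEmb L I D M))

/-- The sequence `(I_n, D_n)` makes the `ω`-iterated ultrapowers of `M₁` and `M₂` isomorphic. -/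
def IsoOmegaUltrapowers (M₁ M₂ : Type u) [L.Structure M₁] [L.Structure M₂] (I : ℕ → Type u)
    (D : ∀ n, Ultrafilter (I n)) : Prop :=
  Nonempty (OmegaUltrapower L I D M₁ ≃[L] OmegaUltrapower L I D M₂)

end Iterated

/-! ### Niceness -/

/-- `(w, γ)` is a niceness witness for `(I, D, ⟨E_n⟩)` with respect to the cardinals `lam n`.
(`(lam n).ord.ToType` is the set of ordinals below the cardinal `lam n`.) -/
structure IsNicenessWitness (θ : Cardinal.{u}) (lam : ℕ → Cardinal.{u}) {I : Type u}
    (D : Filter I) (E : ℕ → Setoid I) (w : I → ∀ n, Set (lam n).ord.ToType)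
    (γ : I → ℕ → Ordinal.{u}) : Prop where
  card_lt : ∀ s n, #(w s n) < θ
  card_anti : ∀ s n, #(w s (n + 1)) ≤ #(w s n)
  ord_lt : ∀ s n, γ s n < θ.ord
  ord_anti : ∀ s n, γ s (n + 1) < γ s n ∨ γ s (n + 1) = 0
  empty_of_zero : ∀ s n, γ s n = 0 → w s n = ∅
  infinite : ∀ s, (w s 0).Infinite
  covers : ∀ n (v : Set (lam n).ord.ToType), #v < θ → {s | v ⊆ w s n} ∈ D
  invariant : ∀ n s t, E n s t → w s n = w t n ∧ γ s n = γ t n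

end LimUlt

/-! The conditions are tied in the cycle (a) → (e) → (d) → (c) → (b) → (a).

(a) → (e). A win of ISO is turned into a strategy that answers whole finite histories of demands by
increasing partial isomorphisms, a demanded element being reached after `k` successive finite
delays. Such strategies invert and compose, the numbers of delays adding up, so a chain of games
yields one strategy with finite `k` (`exists_isStrategy_of_eqvGen`). Given a nice limit ultrapower,
a play between $M_1$ and $M_2$ is run in every coordinate $s$: vocabulary and bounds are read off
$w_{s,0}$ and $\gamma_{s,0}$, the ordinals are the $\gamma_{s,n}$, and the demands are the values at
$s$ of the invariant functions whose codes lie in $w_{s,n}$. The delay of a given function is a map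
$I\to\omega$ invariant under some $E_m$, hence constant modulo $D$ since $\theta>\aleph_0$. So each
element is reached at one stage common to almost all coordinates (`IsLUFT.exists_stage`), and the
partial isomorphisms glue (`nonempty_limitPower_equiv`).

(e) → (d) → (c). $M_\omega$ is a limit ultrapower over $\prod_n I_n$, for the equivalences "equal in
the first $n$ coordinates" (`nonempty_omegaUltrapower_equiv`). A niceness witness is cut out of the
regularity witnesses by discarding every set that is not smaller than its predecessor. Nothing is
lost modulo the filter, because the highest coordinate is chosen first and the lower sets can then
be made larger (`niceSets_covers`). Compactness provides the regular ultrafilters.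

(c) → (b). The first $n$ coordinates give a finite chain of equivalences, which has a finest member,
so $\theta$-directedness of each stage is free.

(b) → (a). ISO wins between $M$ and its limit power $N$ (`IsRepresentation.isoWins`), so $M_1$ and
$M_2$ are linked through $N$. A position is kept by a tuple $x$ in $M$ and a tuple of functions $f$,
all invariant under one $E\in\mathscr E_n$, with $x$ back-and-forth equivalent to $f(s)$ for almost
all $s$. Elements of $N$ are delayed until the stage $n$ has reached the index of a family $\mathscr
E_m$ in which they appear; $\theta$-directedness then allows $\mu$ of them to be treated at once. As
$\theta$ is a strong limit there are fewer than $\theta$ back-and-forth classes, so the class of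
$f(s)$ is constant almost everywhere and is realized by a tuple of $M$. -/

namespace LimUlt

open FirstOrder.Language FirstOrder.Language.Structure

/-! ### Strategies on histories -/

section Strategy

/-- The partial map `g` preserves quantifier-free formulas in both directions. -/
def PreservesQF (L : FirstOrder.Language.{u, u}) {M N : Type u} [L.Structure M] [L.Structure N]
    (g : M ≃. N) : Prop :=
  ∀ (k : ℕ) (φ : L.Formula (Fin k)), BoundedFormula.IsQF φ →
    ∀ (a : Fin k → M) (b : Fin k → N), (∀ i, b i ∈ g (a i)) → (φ.Realize a ↔ φ.Realize b)

/-- A finite sequence of demands, the latest one at the head. -/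
abbrev History (M N : Type u) := List (Ordinal.{u} × Set M × Set N)

/-- The last ordinal chosen, `α` at the start. -/
def History.rank {M N : Type u} (α : Ordinal.{u}) : History M N → Ordinal.{u}
  | [] => α
  | m :: _ => m.1

/-- The ordinals decrease, starting below `α`, and the sets have cardinality at most `μ`. -/
def History.Legal {M N : Type u} (μ : Cardinal.{u}) (α : Ordinal.{u}) : History M N → Prop
  | [] => True
  | m :: u => History.Legal μ α u ∧ m.1 < History.rank α u ∧ #m.2.1 ≤ μ ∧ #m.2.2 ≤ μ

/-- `P` is guaranteed to hold after at most `k` successive finite delays. -/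
def Caught {M N : Type u} (Leg P : History M N → Prop) : ℕ → History M N → Prop
  | 0, u => P u
  | k + 1, u => ∃ c : ℕ, ∀ v, Leg v → u <:+ v → c ≤ v.length → Caught Leg P k v

/-- `Γ` answers histories of demands by increasing partial isomorphisms which, after `k` finite
delays, are defined on the demanded elements. -/
structure IsStrategy (L : FirstOrder.Language.{u, u}) {M N : Type u} [L.Structure M]
    [L.Structure N] (μ : Cardinal.{u}) (α : Ordinal.{u}) (k : ℕ) (Γ : History M N → M ≃. N) :
    Prop where
  preserves : ∀ u, History.Legal μ α u → PreservesQF L (Γ u)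
  card_dom : ∀ u, History.Legal μ α u → #{a | ∃ b, b ∈ Γ u a} ≤ μ
  card_ran : ∀ u, History.Legal μ α u → #{b | ∃ a, b ∈ Γ u a} ≤ μ
  mono : ∀ m u, History.Legal μ α (m :: u) → Γ u ≤ Γ (m :: u)
  left : ∀ m u, History.Legal μ α (m :: u) → ∀ a ∈ m.2.1,
    Caught (History.Legal μ α) (fun v => ∃ b, b ∈ Γ v a) k (m :: u)
  right : ∀ m u, History.Legal μ α (m :: u) → ∀ b ∈ m.2.2,
    Caught (History.Legal μ α) (fun v => ∃ a, b ∈ Γ v a) k (m :: u)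

variable {L : FirstOrder.Language.{u, u}} {M N P : Type u}
  {μ : Cardinal.{u}} {α : Ordinal.{u}}

theorem Caught.comap {M' N' : Type u} {Leg Q : History M N → Prop} {Leg' : History M' N' → Prop}
    (f : History M' N' → History M N) (hL : ∀ u, Leg' u → Leg (f u))
    (hs : ∀ u v, u <:+ v → f u <:+ f v) (hl : ∀ u, (f u).length = u.length) :
    ∀ {k : ℕ} {u : History M' N'}, Caught Leg Q k (f u) → Caught Leg' (fun v => Q (f v)) k u
  | 0, _, h => h
  | k + 1, u, h => by
    obtain ⟨c, hc⟩ := h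
    exact ⟨c, fun v hv huv hcv => Caught.comap f hL hs hl
      (hc (f v) (hL v hv) (hs u v huv) (by rwa [hl]))⟩

/-- Delays add up: wait for `Q` through `k` delays, then for `R` through `j` further ones. -/
theorem Caught.bind {Leg Q R : History M N → Prop} {j : ℕ} :
    ∀ {k : ℕ} {u : History M N}, Leg u →
      (∀ v, Leg v → u <:+ v → Q v → Caught Leg R j v) → Caught Leg Q k u → Caught Leg R (j + k) u
  | 0, u, hu, h, hq => h u hu (List.suffix_refl u) hq
  | _ + 1, _, _, h, ⟨c, hc⟩ =>
    ⟨c, fun v hv huv hcv => Caught.bind hv (fun v' hv' hvv' => h v' hv' (huv.trans hvv'))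
      (hc v hv huv hcv)⟩

theorem IsStrategy.mono_suffix [L.Structure M] [L.Structure N] {k : ℕ} {Γ : History M N → M ≃. N}
    (h : IsStrategy L μ α k Γ) {u v : History M N} (hv : History.Legal μ α v) (huv : u <:+ v) :
    Γ u ≤ Γ v := by
  induction v with
  | nil => rw [List.suffix_nil.1 huv]
  | cons m v ih =>
    rcases List.suffix_cons_iff.1 huv with rfl | h'
    · exact le_rfl
    · exact (ih hv.1 h').trans (h.mono m v hv)

theorem PreservesQF.symm [L.Structure M] [L.Structure N] {g : M ≃. N} (h : PreservesQF L g) :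
    PreservesQF L g.symm := fun k φ hφ a b hab =>
  (h k φ hφ b a fun i => (PEquiv.mem_iff_mem g).1 (hab i)).symm

theorem PreservesQF.trans [L.Structure M] [L.Structure N] [L.Structure P] {g : M ≃. N} {g' : N ≃. P}
    (h : PreservesQF L g) (h' : PreservesQF L g') : PreservesQF L (g.trans g') := by
  intro k φ hφ a b hab
  have : ∀ i, ∃ c, c ∈ g (a i) ∧ b i ∈ g' c := fun i => (PEquiv.mem_trans g g' _ _).1 (hab i)
  choose c hc hc' using this
  exact (h k φ hφ a c hc).trans (h' k φ hφ c b hc')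

/-- The same history with the two models interchanged. -/
def History.swap (u : History M N) : History N M := u.map fun m => (m.1, m.2.2, m.2.1)

theorem History.rank_swap (u : History M N) : History.rank α (History.swap u) = History.rank α u := by
  cases u <;> rfl

theorem History.Legal.swap {u : History M N} (h : History.Legal μ α u) :
    History.Legal μ α (History.swap u) := by
  induction u with
  | nil => trivial
  | cons m u ih =>
    refine ⟨ih h.1, ?_, h.2.2.2, h.2.2.1⟩
    rw [show List.map _ u = History.swap u from rfl, History.rank_swap]
    exact h.2.1

theorem History.swap_suffix {u v : History M N} (h : u <:+ v) : History.swap u <:+ History.swap v := h.map _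

theorem IsStrategy.swap [L.Structure M] [L.Structure N] {k : ℕ} {Γ : History M N → M ≃. N}
    (h : IsStrategy L μ α k Γ) : IsStrategy L μ α k fun u : History N M => (Γ (History.swap u)).symm where
  preserves u hu := (h.preserves _ hu.swap).symm
  card_dom u hu := by
    simpa only [PEquiv.mem_iff_mem] using h.card_ran _ hu.swap
  card_ran u hu := by
    simpa only [PEquiv.mem_iff_mem] using h.card_dom _ hu.swap
  mono m u hu := by
    have := h.mono _ _ hu.swap
    intro a b hab
    rw [PEquiv.mem_iff_mem] at hab ⊢
    exact this _ _ hab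
  left m u hu a ha := by
    simp only [PEquiv.mem_iff_mem]
    exact Caught.comap History.swap (u := m :: u) (Leg := History.Legal μ α) (Leg' := History.Legal μ α)
      (fun u hu => History.Legal.swap hu) (fun u v => History.swap_suffix)
      (fun u => List.length_map _) (h.right _ _ hu.swap a ha)
  right m u hu b hb := by
    simp only [PEquiv.mem_iff_mem]
    exact Caught.comap History.swap (u := m :: u) (Leg := History.Legal μ α) (Leg' := History.Legal μ α)
      (fun u hu => History.Legal.swap hu) (fun u v => History.swap_suffix)
      (fun u => List.length_map _) (h.left _ _ hu.swap b hb)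

/-- Two histories on `(M, N)` and `(N, P)` obtained from a history on `(M, P)`: in `N` one demands
all the elements reached so far. -/
def History.split (Γ : History M N → M ≃. N) (Γ' : History N P → N ≃. P) :
    History M P → History M N × History N P
  | [] => ([], [])
  | m :: u =>
    let p := History.split Γ Γ' u
    let Y : Set N := {b | ∃ a, b ∈ Γ p.1 a} ∪ {b | ∃ c, c ∈ Γ' p.2 b}
    ((m.1, m.2.1, Y) :: p.1, (m.1, Y, m.2.2) :: p.2)

section Split

variable [L.Structure M] [L.Structure N] [L.Structure P] {k k' : ℕ}
  {Γ : History M N → M ≃. N} {Γ' : History N P → N ≃. P}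

/-- The intermediate demand consists of the elements of `N` already reached from either side, so the
cardinality bounds in `IsStrategy` make it a legal demand when `μ` is infinite. -/
theorem History.split_legal (hμ : ℵ₀ ≤ μ) (h : IsStrategy L μ α k Γ) (h' : IsStrategy L μ α k' Γ')
    {u : History M P} (hu : History.Legal μ α u) :
    History.Legal μ α (History.split Γ Γ' u).1 ∧ History.Legal μ α (History.split Γ Γ' u).2 := by
  induction u with
  | nil => exact ⟨trivial, trivial⟩
  | cons m u ih =>
    obtain ⟨h1, h2⟩ := ih hu.1
    have hr1 : History.rank α (History.split Γ Γ' u).1 = History.rank α u := by cases u <;> rfl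
    have hr2 : History.rank α (History.split Γ Γ' u).2 = History.rank α u := by cases u <;> rfl
    have hY := (mk_union_le _ _).trans
      (add_le_of_le hμ (h.card_ran _ h1) (h'.card_dom _ h2))
    exact ⟨⟨h1, hr1 ▸ hu.2.1, hu.2.2.1, hY⟩, ⟨h2, hr2 ▸ hu.2.1, hY, hu.2.2.2⟩⟩

theorem History.split_suffix {u v : History M P} (h : u <:+ v) :
    (History.split Γ Γ' u).1 <:+ (History.split Γ Γ' v).1 ∧
      (History.split Γ Γ' u).2 <:+ (History.split Γ Γ' v).2 := by
  induction v with
  | nil => rw [List.suffix_nil.1 h]; exact ⟨List.suffix_refl _, List.suffix_refl _⟩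
  | cons m v ih =>
    rcases List.suffix_cons_iff.1 h with rfl | h'
    · exact ⟨List.suffix_refl _, List.suffix_refl _⟩
    · exact ⟨(ih h').1.trans (List.suffix_cons _ _), (ih h').2.trans (List.suffix_cons _ _)⟩

theorem History.split_length (u : History M P) :
    (History.split Γ Γ' u).1.length = u.length ∧ (History.split Γ Γ' u).2.length = u.length := by
  induction u with
  | nil => exact ⟨rfl, rfl⟩
  | cons m u ih => exact ⟨congrArg (· + 1) ih.1, congrArg (· + 1) ih.2⟩

/-- An element of `M` first waits for its image in `N`, then this image waits for its own image in
`P`. The extra delay is there because an element of `N` enters the intermediate demands only at the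
move after it has been reached. -/
theorem IsStrategy.comp (hμ : ℵ₀ ≤ μ) (h : IsStrategy L μ α k Γ) (h' : IsStrategy L μ α k' Γ') :
    IsStrategy L μ α (k + k' + 1) fun u : History M P =>
      (Γ (History.split Γ Γ' u).1).trans (Γ' (History.split Γ Γ' u).2) where
  preserves u hu := (h.preserves _ (History.split_legal hμ h h' hu).1).trans
    (h'.preserves _ (History.split_legal hμ h h' hu).2)
  card_dom u hu := by
    refine (mk_le_mk_of_subset ?_).trans (h.card_dom _ (History.split_legal hμ h h' hu).1)
    rintro a ⟨c, hc⟩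
    obtain ⟨b, hb, -⟩ := (PEquiv.mem_trans _ _ _ _).1 hc
    exact ⟨b, hb⟩
  card_ran u hu := by
    refine (mk_le_mk_of_subset ?_).trans (h'.card_ran _ (History.split_legal hμ h h' hu).2)
    rintro c ⟨a, hc⟩
    obtain ⟨b, -, hb⟩ := (PEquiv.mem_trans _ _ _ _).1 hc
    exact ⟨b, hb⟩
  mono m u hu := by
    intro a c hc
    rw [PEquiv.mem_trans] at hc ⊢
    obtain ⟨b, hb, hb'⟩ := hc
    exact ⟨b, h.mono _ _ (History.split_legal hμ h h' hu).1 _ _ hb,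
      h'.mono _ _ (History.split_legal hμ h h' hu).2 _ _ hb'⟩
  left m u hu a ha := by
    have h1 := Caught.comap (Leg' := History.Legal μ α) (fun v => (History.split Γ Γ' v).1)
      (fun v hv => (History.split_legal hμ h h' hv).1) (fun _ _ hv => (History.split_suffix hv).1)
      (fun v => (History.split_length v).1) (u := m :: u)
      (h.left _ _ (History.split_legal hμ h h' hu).1 a ha)
    rw [show k + k' + 1 = (k' + 1) + k by omega]
    refine Caught.bind hu (fun v hv huv hav => ?_) h1
    obtain ⟨b, hb⟩ := hav
    -- One more move is needed: the demand at the head of `w` is formed from the history before it,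
    -- which must already extend `v` for `b` to be in it.
    refine ⟨v.length + 1, fun w hw hvw hlen => ?_⟩
    have h2 : Caught (History.Legal μ α)
        (fun w : History M P => ∃ c, c ∈ Γ' (History.split Γ Γ' w).2 b) k' w := by
      refine Caught.comap (Leg' := History.Legal μ α) (Leg := History.Legal μ α)
        (Q := fun w => ∃ c, c ∈ Γ' w b) (fun v => (History.split Γ Γ' v).2)
        (fun v hv => (History.split_legal hμ h h' hv).2) (fun _ _ hv => (History.split_suffix hv).2)
        (fun v => (History.split_length v).2) ?_
      cases w with
      | nil => simp at hlen
      | cons m' w =>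
        refine h'.left _ _ (History.split_legal hμ h h' hw).2 b (Or.inl ⟨a, ?_⟩)
        have hvw' : v <:+ w := by
          rcases List.suffix_cons_iff.1 hvw with rfl | h'
          · simp at hlen
          · exact h'
        exact h.mono_suffix (History.split_legal hμ h h' hw.1).1 (History.split_suffix hvw').1 _ _ hb
    have h3 := Caught.bind (R := fun w : History M P => ∃ c, c ∈
      ((Γ (History.split Γ Γ' w).1).trans (Γ' (History.split Γ Γ' w).2)) a) (j := 0) hw
      (fun w' hw' hww' ⟨c, hc⟩ => ⟨c, (PEquiv.mem_trans _ _ _ _).2 ⟨b, h.mono_suffix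
        (History.split_legal hμ h h' hw').1 (History.split_suffix (hvw.trans hww')).1 _ _ hb, hc⟩⟩)
      h2
    simpa using h3
  right m u hu c hc := by
    have h1 := Caught.comap (Leg' := History.Legal μ α) (fun v => (History.split Γ Γ' v).2)
      (fun v hv => (History.split_legal hμ h h' hv).2) (fun _ _ hv => (History.split_suffix hv).2)
      (fun v => (History.split_length v).2) (u := m :: u)
      (h'.right _ _ (History.split_legal hμ h h' hu).2 c hc)
    rw [show k + k' + 1 = (k + 1) + k' by omega]
    refine Caught.bind hu (fun v hv huv hav => ?_) h1
    obtain ⟨b, hb⟩ := hav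
    refine ⟨v.length + 1, fun w hw hvw hlen => ?_⟩
    have h2 : Caught (History.Legal μ α)
        (fun w : History M P => ∃ a, b ∈ Γ (History.split Γ Γ' w).1 a) k w := by
      refine Caught.comap (Leg' := History.Legal μ α) (Leg := History.Legal μ α)
        (Q := fun w => ∃ a, b ∈ Γ w a) (fun v => (History.split Γ Γ' v).1)
        (fun v hv => (History.split_legal hμ h h' hv).1) (fun _ _ hv => (History.split_suffix hv).1)
        (fun v => (History.split_length v).1) ?_
      cases w with
      | nil => simp at hlen
      | cons m' w =>
        refine h.right _ _ (History.split_legal hμ h h' hw).1 b (Or.inr ⟨c, ?_⟩)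
        have hvw' : v <:+ w := by
          rcases List.suffix_cons_iff.1 hvw with rfl | h'
          · simp at hlen
          · exact h'
        exact h'.mono_suffix (History.split_legal hμ h h' hw.1).2 (History.split_suffix hvw').2 _ _ hb
    have h3 := Caught.bind (R := fun w : History M P => ∃ a, c ∈
      ((Γ (History.split Γ Γ' w).1).trans (Γ' (History.split Γ Γ' w).2)) a) (j := 0) hw
      (fun w' hw' hww' ⟨a, ha⟩ => ⟨a, (PEquiv.mem_trans _ _ _ _).2 ⟨b, ha, h'.mono_suffix
        (History.split_legal hμ h h' hw').2 (History.split_suffix (hvw.trans hww')).2 _ _ hb⟩⟩)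
      h2
    simpa using h3

end Split

/-- All elements demanded in a history on `(M, M)`. -/
def History.support : History M M → Set M
  | [] => ∅
  | m :: u => History.support u ∪ (m.2.1 ∪ m.2.2)

theorem History.support_card (hμ : ℵ₀ ≤ μ) {u : History M M} (hu : History.Legal μ α u) :
    #(History.support u) ≤ μ := by
  induction u with
  | nil => simp [History.support]
  | cons m u ih =>
    exact (mk_union_le _ _).trans (add_le_of_le hμ (ih hu.1)
      ((mk_union_le _ _).trans (add_le_of_le hμ hu.2.2.1 hu.2.2.2)))

/-- The identity on the set of all elements demanded so far answers at once, without any delay. -/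
theorem exists_isStrategy_refl [L.Structure M] (hμ : ℵ₀ ≤ μ) :
    ∃ Γ : History M M → M ≃. M, IsStrategy L μ α 0 Γ := by
  classical
  have key : ∀ (S : Set M) (a b : M), b ∈ PEquiv.ofSet S a ↔ b = a ∧ a ∈ S := by
    intro S a b
    rw [PEquiv.mem_ofSet_iff]
    exact ⟨fun ⟨h, h'⟩ => ⟨h, h ▸ h'⟩, fun ⟨h, h'⟩ => ⟨h, h.symm ▸ h'⟩⟩
  refine ⟨fun u => PEquiv.ofSet (History.support u), ⟨?_, ?_, ?_, ?_, ?_, ?_⟩⟩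
  · intro u _ k φ _ a b hab
    rw [show b = a from funext fun i => ((key _ _ _).1 (hab i)).1]
  · intro u hu
    refine (mk_le_mk_of_subset ?_).trans (History.support_card hμ hu)
    rintro a ⟨b, hb⟩
    exact ((key _ _ _).1 hb).2
  · intro u hu
    refine (mk_le_mk_of_subset ?_).trans (History.support_card hμ hu)
    rintro b ⟨a, hb⟩
    obtain ⟨rfl, h⟩ := (key _ _ _).1 hb
    exact h
  · intro m u hu a b hab
    obtain ⟨rfl, h⟩ := (key _ _ _).1 hab
    exact (key _ _ _).2 ⟨rfl, Or.inl h⟩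
  · intro m u hu a ha
    exact ⟨a, (key _ _ _).2 ⟨rfl, Or.inr (Or.inl ha)⟩⟩
  · intro m u hu a ha
    exact ⟨a, (key _ _ _).2 ⟨rfl, Or.inr (Or.inr ha)⟩⟩

end Strategy

/-! ### Strategies from the game -/

section FromGame

variable {L : FirstOrder.Language.{u, u}} {M N P : Type u}
  {μ : Cardinal.{u}} {α : Ordinal.{u}}

/-- The position reached when the demands of a history are put to the isomorphism player, with
answers `r₁` and `r₂`, first in the first model and then in the second one. -/
noncomputable def playHistory (α : Ordinal.{u})
    (r₁ r₂ : GameState M N → Ordinal.{u} → Set M → Set N → GameState M N) :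
    History M N → GameState M N
  | [] => GameState.init M N α
  | m :: u =>
    r₂ (r₁ (playHistory α r₁ r₂ u) (2 * m.1 + 1) m.2.1 m.2.2) (2 * m.1) m.2.1 m.2.2

theorem two_mul_add_one_lt {β γ : Ordinal.{u}} (h : β < γ) : 2 * β + 1 < 2 * γ := by
  have h1 : 2 * (β + 1) ≤ 2 * γ := mul_le_mul_right (Order.add_one_le_of_lt h) 2
  refine lt_of_lt_of_le ?_ h1
  rw [mul_add, mul_one]
  gcongr
  exact one_lt_two

/-- One two-sided demand costs two moves of the game, with ordinals `2 * β + 1` and `2 * β`; hence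
the length `2 * α`. The single delay of an element is the value of `h₁` or `h₂` at it. -/
theorem ISOWins.exists_isStrategy [L.Structure M] [L.Structure N] (hμ : ℵ₀ ≤ μ)
    (h : ISOWins L M N μ (2 * α)) : ∃ Γ : History M N → M ≃. N, IsStrategy L μ α 1 Γ := by
  obtain ⟨W, h0, hW⟩ := h
  have : Nonempty (GameState M N) := ⟨GameState.init M N α⟩
  -- The idle argument here and in `e2` gives the two answer functions the common type expected by
  -- `playHistory`.
  have e1 : ∀ (s : GameState M N) (β : Ordinal.{u}) (X : Set M) (Y : Set N),
      s ∈ W → LegalMove μ s β (s.A₁ ∪ X) → ∃ t ∈ W, LegalAnswer s β (s.A₁ ∪ X) t :=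
    fun s β X _ hs hl => (hW s hs).2.1 β _ hl
  have e2 : ∀ (s : GameState M N) (β : Ordinal.{u}) (X : Set M) (Y : Set N),
      s ∈ W → LegalMove μ s.swap β (s.A₂ ∪ Y) →
        ∃ t ∈ W, LegalAnswer s.swap β (s.A₂ ∪ Y) t.swap :=
    fun s β _ Y hs hl => (hW s hs).2.2 β _ hl
  choose! r₁ hr₁W hr₁ using e1
  choose! r₂ hr₂W hr₂ using e2
  let run := playHistory (2 * α) r₁ r₂
  have inv : ∀ u : History M N, History.Legal μ α u →
      run u ∈ W ∧ (run u).β = 2 * History.rank α u ∧ (run u).n = 2 * u.length ∧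
      ∀ m, History.Legal μ α (m :: u) →
        r₁ (run u) (2 * m.1 + 1) m.2.1 m.2.2 ∈ W ∧
        LegalAnswer (run u) (2 * m.1 + 1) ((run u).A₁ ∪ m.2.1)
          (r₁ (run u) (2 * m.1 + 1) m.2.1 m.2.2) ∧
        run (m :: u) ∈ W ∧
        LegalAnswer (r₁ (run u) (2 * m.1 + 1) m.2.1 m.2.2).swap (2 * m.1)
          ((r₁ (run u) (2 * m.1 + 1) m.2.1 m.2.2).A₂ ∪ m.2.2) (run (m :: u)).swap := by
    intro u hu
    have step : ∀ u : History M N, run u ∈ W → (run u).β = 2 * History.rank α u →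
        ∀ m, History.Legal μ α (m :: u) →
        r₁ (run u) (2 * m.1 + 1) m.2.1 m.2.2 ∈ W ∧
        LegalAnswer (run u) (2 * m.1 + 1) ((run u).A₁ ∪ m.2.1)
          (r₁ (run u) (2 * m.1 + 1) m.2.1 m.2.2) ∧
        run (m :: u) ∈ W ∧
        LegalAnswer (r₁ (run u) (2 * m.1 + 1) m.2.1 m.2.2).swap (2 * m.1)
          ((r₁ (run u) (2 * m.1 + 1) m.2.1 m.2.2).A₂ ∪ m.2.2) (run (m :: u)).swap := by
      intro u huW huβ m hm
      have l1 : LegalMove μ (run u) (2 * m.1 + 1) ((run u).A₁ ∪ m.2.1) :=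
        ⟨huβ ▸ two_mul_add_one_lt hm.2.1, Set.subset_union_left,
          (mk_union_le _ _).trans (add_le_of_le hμ (hW _ huW).1.1 hm.2.2.1)⟩
      have t1 := hr₁W (run u) (2 * m.1 + 1) m.2.1 m.2.2 huW l1
      have a1 := hr₁ (run u) (2 * m.1 + 1) m.2.1 m.2.2 huW l1
      have l2 : LegalMove μ (r₁ (run u) (2 * m.1 + 1) m.2.1 m.2.2).swap (2 * m.1)
          ((r₁ (run u) (2 * m.1 + 1) m.2.1 m.2.2).A₂ ∪ m.2.2) :=
        ⟨by
          change 2 * m.1 < (r₁ (run u) (2 * m.1 + 1) m.2.1 m.2.2).β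
          rw [a1.2.2.2.2.2]; exact Order.lt_add_one_iff.2 le_rfl, Set.subset_union_left,
          (mk_union_le _ _).trans (add_le_of_le hμ (hW _ t1).1.2.1 hm.2.2.2)⟩
      exact ⟨t1, a1, hr₂W _ _ m.2.1 m.2.2 t1 l2, hr₂ _ _ m.2.1 m.2.2 t1 l2⟩
    have base : run u ∈ W ∧ (run u).β = 2 * History.rank α u ∧ (run u).n = 2 * u.length := by
      induction u with
      | nil => exact ⟨h0, rfl, rfl⟩
      | cons m u ih =>
        obtain ⟨i1, i2, i3⟩ := ih hu.1
        obtain ⟨-, s2, s3, s4⟩ := step u i1 i2 m hu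
        refine ⟨s3, s4.2.2.2.2.2, ?_⟩
        have n1 := s2.1.2.2.2.2.2.2
        have n2 : (run (m :: u)).n = _ + 1 := s4.1.2.2.2.2.2.2
        rw [n2]
        change (r₁ (run u) (2 * m.1 + 1) m.2.1 m.2.2).n + 1 = _
        rw [n1, i3, List.length_cons]
        ring
    exact ⟨base.1, base.2.1, base.2.2, step u base.1 base.2.1⟩
  have mono1 : ∀ m u, History.Legal μ α (m :: u) →
      (run u).g ≤ (r₁ (run u) (2 * m.1 + 1) m.2.1 m.2.2).g := fun m u hu =>
    ((inv u hu.1).2.2.2 m hu).2.1.1.2.2.2.2.1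
  have mono2 : ∀ m u, History.Legal μ α (m :: u) →
      (r₁ (run u) (2 * m.1 + 1) m.2.1 m.2.2).g ≤ (run (m :: u)).g := by
    intro m u hu a b hab
    have := ((inv u hu.1).2.2.2 m hu).2.2.2.1.2.2.2.2.1
    exact (PEquiv.mem_iff_mem _).1 (this b a ((PEquiv.mem_iff_mem _).2 hab))
  have left1 : ∀ m u, History.Legal μ α (m :: u) → ∀ a ∈ (run u).A₁ ∪ m.2.1,
      a ∈ (run (m :: u)).A₁ ∧ (run (m :: u)).h₁ a =
        (r₁ (run u) (2 * m.1 + 1) m.2.1 m.2.2).h₁ a := by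
    intro m u hu a ha
    obtain ⟨-, s2, -, s4⟩ := (inv u hu.1).2.2.2 m hu
    have ha' : a ∈ (r₁ (run u) (2 * m.1 + 1) m.2.1 m.2.2).A₁ := by rw [s2.2.1]; exact ha
    exact ⟨s4.1.2.1 ha', s4.1.2.2.2.1 a ha'⟩
  have left2 : ∀ u v, History.Legal μ α v → u <:+ v → ∀ a ∈ (run u).A₁,
      a ∈ (run v).A₁ ∧ (run v).h₁ a = (run u).h₁ a := by
    intro u v hv huv a ha
    induction v with
    | nil => rw [List.suffix_nil.1 huv] at ha ⊢; exact ⟨ha, rfl⟩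
    | cons m v ih =>
      rcases List.suffix_cons_iff.1 huv with rfl | h'
      · exact ⟨ha, rfl⟩
      · obtain ⟨i1, i2⟩ := ih hv.1 h'
        obtain ⟨j1, j2⟩ := left1 m v hv a (Or.inl i1)
        obtain ⟨-, s2, -, -⟩ := (inv v hv.1).2.2.2 m hv
        exact ⟨j1, j2.trans ((s2.1.2.2.1 a i1).trans i2)⟩
  have right2 : ∀ u v, History.Legal μ α v → u <:+ v → ∀ b ∈ (run u).A₂,
      b ∈ (run v).A₂ ∧ (run v).h₂ b = (run u).h₂ b := by
    intro u v hv huv b hb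
    induction v with
    | nil => rw [List.suffix_nil.1 huv] at hb ⊢; exact ⟨hb, rfl⟩
    | cons m v ih =>
      rcases List.suffix_cons_iff.1 huv with rfl | h'
      · exact ⟨hb, rfl⟩
      · obtain ⟨i1, i2⟩ := ih hv.1 h'
        obtain ⟨-, s2, -, s4⟩ := (inv v hv.1).2.2.2 m hv
        have hb1 := s2.1.2.1 i1
        exact ⟨s4.1.1 hb1, (s4.1.2.2.1 b hb1).trans ((s2.1.2.2.2.1 b i1).trans i2)⟩
  refine ⟨fun u => (run u).g, ⟨?_, ?_, ?_, ?_, ?_, ?_⟩⟩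
  · intro u hu
    exact (hW _ (inv u hu).1).1.2.2.2.2
  · intro u hu
    have := (hW _ (inv u hu).1).1
    refine (mk_le_mk_of_subset ?_).trans this.1
    rintro a ⟨b, hb⟩
    exact (this.2.2.2.1 a b hb).1
  · intro u hu
    have := (hW _ (inv u hu).1).1
    refine (mk_le_mk_of_subset ?_).trans this.2.1
    rintro b ⟨a, hb⟩
    exact (this.2.2.2.1 a b hb).2.1
  · exact fun m u hu => (mono1 m u hu).trans (mono2 m u hu)
  · intro m u hu a ha
    -- The first bound makes the history strictly longer than `m :: u`, so `a` lies in the old set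
    -- at its last demand; the second makes the number of the position at least the delay of `a`, so
    -- the answer must be defined at `a`.
    refine ⟨max ((m :: u).length + 1) ((run (m :: u)).h₁ a + 1), fun v hv huv hlen => ?_⟩
    cases v with
    | nil => simp at hlen
    | cons m' v =>
      have huv' : m :: u <:+ v := by
        rcases List.suffix_cons_iff.1 huv with h | h
        · rw [h] at hlen; simp at hlen
        · exact h
      obtain ⟨i1, i2⟩ := left2 _ v hv.1 huv' a (left1 m u hu a (Or.inr ha)).1
      obtain ⟨-, -, i3, i4⟩ := inv v hv.1
      obtain ⟨-, s2, -, -⟩ := i4 m' hv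
      have hn := (le_max_right _ _).trans hlen
      rw [List.length_cons] at hn
      obtain ⟨b, hb⟩ := (s2.2.2.2.2.1 a).2 ⟨i1, by rw [i2, i3]; omega⟩
      exact ⟨b, mono2 m' v hv _ _ hb⟩
  · intro m u hu b hb
    refine ⟨max ((m :: u).length + 1) ((run (m :: u)).h₂ b + 1), fun v hv huv hlen => ?_⟩
    cases v with
    | nil => simp at hlen
    | cons m' v =>
      have huv' : m :: u <:+ v := by
        rcases List.suffix_cons_iff.1 huv with h | h
        · rw [h] at hlen; simp at hlen
        · exact h
      obtain ⟨-, -, -, s4⟩ := (inv u hu.1).2.2.2 m hu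
      have hb0 : b ∈ (run (m :: u)).A₂ := by
        rw [show (run (m :: u)).A₂ = _ from s4.2.1]; exact Or.inr hb
      obtain ⟨i1, i2⟩ := right2 _ v hv.1 huv' b hb0
      obtain ⟨-, -, i3, i4⟩ := inv v hv.1
      obtain ⟨-, s2, -, s4'⟩ := i4 m' hv
      have hn := (le_max_right _ _).trans hlen
      rw [List.length_cons] at hn
      obtain ⟨a, ha⟩ := (s4'.2.2.2.2.1 b).2 ⟨s2.1.2.1 i1, by
        change (r₁ (run v) (2 * m'.1 + 1) m'.2.1 m'.2.2).h₂ b <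
          (r₁ (run v) (2 * m'.1 + 1) m'.2.1 m'.2.2).n + 1
        rw [s2.1.2.2.2.1 b i1, i2, s2.1.2.2.2.2.2.2, i3]; omega⟩
      exact ⟨a, (PEquiv.mem_iff_mem _).1 ha⟩

/-- Strategies on histories, unlike positions of the game, can be composed directly, so induction
along a chain of games keeps a finite number of delays. -/
theorem exists_isStrategy_of_eqvGen (hμ : ℵ₀ ≤ μ)
    {A B : Theory.ModelType.{u, u, u} (∅ : L.Theory)}
    (h : Relation.EqvGen (fun A B : Theory.ModelType.{u, u, u} (∅ : L.Theory) =>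
      ISOWins L A B μ (2 * α)) A B) :
    ∃ k, ∃ Γ : History A B → A ≃. B, IsStrategy L μ α k Γ := by
  induction h with
  | rel A B h => exact ⟨1, h.exists_isStrategy hμ⟩
  | refl A => exact ⟨0, exists_isStrategy_refl hμ⟩
  | symm A B _ ih =>
    obtain ⟨k, Γ, h⟩ := ih
    exact ⟨k, _, h.swap⟩
  | trans A B C _ _ ih ih' =>
    obtain ⟨k, Γ, h⟩ := ih
    obtain ⟨k', Γ', h'⟩ := ih'
    exact ⟨_, _, h.comp hμ h'⟩

end FromGame

/-! ### Invariant sets and functions -/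

section Invariant

variable {I : Type u} {D : Filter I} {κ σ : Cardinal.{u}} {ℰ : Set (Setoid I)} {E : Setoid I}

theorem IsLUFT.neBot (hx : IsLUFT κ σ D ℰ) (hE : E ∈ ℰ) : D.NeBot := by
  obtain ⟨⟨U, hU⟩, -⟩ := hx.ultra E hE
  have : (D.map (Quotient.mk E)).NeBot := hU ▸ U.neBot
  exact Filter.map_neBot_iff _ |>.1 this

/-- `D` need not be an ultrafilter, but an `E`-invariant property lives on the quotient by `E`,
where the image of `D` is one. The same passage gives completeness for invariant properties below.
-/
theorem IsLUFT.eventually_or (hx : IsLUFT κ σ D ℰ) (hE : E ∈ ℰ) {p : I → Prop}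
    (hp : ∀ s t, E s t → (p s ↔ p t)) : (∀ᶠ s in D, p s) ∨ ∀ᶠ s in D, ¬ p s := by
  obtain ⟨⟨U, hU⟩, -⟩ := hx.ultra E hE
  let p' : Quotient E → Prop := Quotient.lift p fun s t h => propext (hp s t h)
  have key : ∀ q : Quotient E → Prop, (∀ᶠ x in D.map (Quotient.mk E), q x) ↔
      ∀ᶠ x in (U : Filter (Quotient E)), q x := fun q => by rw [hU]
  rcases Ultrafilter.em U p' with h | h
  · exact Or.inl (Filter.eventually_map.1 ((key _).2 h))
  · exact Or.inr (Filter.eventually_map.1 ((key _).2 h))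

theorem IsLUFT.eventually_not (hx : IsLUFT κ σ D ℰ) (hE : E ∈ ℰ) {p : I → Prop}
    (hp : ∀ s t, E s t → (p s ↔ p t)) : (∀ᶠ s in D, ¬ p s) ↔ ¬ ∀ᶠ s in D, p s := by
  have := hx.neBot hE
  constructor
  · intro h h'
    obtain ⟨s, hs, hs'⟩ := (h.and h').exists
    exact hs hs'
  · exact (hx.eventually_or hE hp).resolve_left

theorem IsLUFT.eventually_forall (hx : IsLUFT κ σ D ℰ) (hE : E ∈ ℰ) {ι : Type u} (hι : #ι < κ)
    {p : ι → I → Prop} (hp : ∀ i s t, E s t → (p i s ↔ p i t)) (h : ∀ i, ∀ᶠ s in D, p i s) :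
    ∀ᶠ s in D, ∀ i, p i s := by
  have := (hx.ultra E hE).2
  let p' : Quotient E → ι → Prop := fun q i =>
    Quotient.lift (p i) (fun s t h => propext (hp i s t h)) q
  have : ∀ᶠ q in D.map (Quotient.mk E), ∀ i, p' q i :=
    (Filter.eventually_cardinal_forall hι).2 fun i => Filter.eventually_map.2 (h i)
  exact Filter.eventually_map.1 this

/-- If every value were avoided almost everywhere, completeness would allow fewer than `κ` values to
be avoided simultaneously. -/
theorem IsLUFT.exists_eventually_eq (hx : IsLUFT κ σ D ℰ) (hE : E ∈ ℰ) {T : Type u} (hT : #T < κ)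
    {c : I → T} (hc : ∀ s t, E s t → c s = c t) : ∃ t, ∀ᶠ s in D, c s = t := by
  have := hx.neBot hE
  by_contra hcon
  have h : ∀ t, ∀ᶠ s in D, ¬ c s = t := fun t =>
    (hx.eventually_not hE fun s s' hs => by rw [hc s s' hs]).2 fun h => hcon ⟨t, h⟩
  obtain ⟨s, hs⟩ := (hx.eventually_forall hE hT
    (fun t s s' hs => by rw [hc s s' hs]) h).exists
  exact hs _ rfl

theorem IsLUFT.exists_eventually_eq_nat (hκ : ℵ₀ < κ) (hx : IsLUFT κ σ D ℰ) (hE : E ∈ ℰ)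
    {c : I → ℕ} (hc : ∀ s t, E s t → c s = c t) : ∃ t, ∀ᶠ s in D, c s = t := by
  obtain ⟨t, ht⟩ := hx.exists_eventually_eq hE (T := ULift ℕ) (by simpa using hκ)
    (c := fun s => ⟨c s⟩) (fun s t h => congrArg _ (hc s t h))
  exact ⟨t.down, ht.mono fun s hs => congrArg ULift.down hs⟩

theorem IsLUFT.eventually_forall_lt (hx : IsLUFT κ σ D ℰ) (hE : E ∈ ℰ) {δ : Ordinal.{u}}
    (hδ : δ < κ.ord) {p : Ordinal.{u} → I → Prop} (hp : ∀ ε s t, E s t → (p ε s ↔ p ε t))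
    (h : ∀ ε < δ, ∀ᶠ s in D, p ε s) : ∀ᶠ s in D, ∀ ε < δ, p ε s := by
  have h1 := hx.eventually_forall hE (ι := δ.ToType) (by rwa [mk_toType, ← lt_ord])
    (p := fun i s => p (Ordinal.ToType.mk.symm i).1 s) (fun i => hp _) (fun i => h _ (Ordinal.ToType.mk.symm i).2)
  filter_upwards [h1] with s hs ε hε
  simpa using hs (Ordinal.ToType.mk ⟨ε, hε⟩)

/-- In a decreasing sequence of equivalence relations, an element which is almost everywhere caught
after finitely many delays is almost everywhere reached at a fixed stage. -/
theorem IsLUFT.exists_stage {M N : Type u} (hκ : ℵ₀ < κ) {E : ℕ → Setoid I}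
    (hx : IsLUFT κ σ D (Set.range E)) (hE : ∀ m n, m ≤ n → E n ≤ E m)
    {Leg P : I → History M N → Prop} {m₀ : ℕ}
    (hP : ∀ s t, E m₀ s t → Leg s = Leg t ∧ P s = P t) {hist : I → ℕ → History M N}
    (hinv : ∀ n s t, E n s t → hist s n = hist t n)
    (hsuf : ∀ s m n, m ≤ n → hist s m <:+ hist s n) (hlen : ∀ s n, (hist s n).length = n)
    (hleg : ∀ n, ∀ᶠ s in D, Leg s (hist s n)) :
    ∀ k n, (∀ᶠ s in D, Caught (Leg s) (P s) k (hist s n)) → ∃ m, ∀ᶠ s in D, P s (hist s m)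
  | 0, n, h => ⟨n, h⟩
  | k + 1, n, h => by
    -- The least possible delay is determined by `Leg s`, `P s` and `hist s n`, all invariant under
    -- `E (max m₀ n)`; therefore it is constant almost everywhere.
    let c : I → ℕ := fun s => sInf {c | ∀ v, Leg s v → hist s n <:+ v → c ≤ v.length →
      Caught (Leg s) (P s) k v}
    obtain ⟨c₀, hc₀⟩ := hx.exists_eventually_eq_nat hκ ⟨max m₀ n, rfl⟩ (c := c) (fun s t hst => by
      have h1 := hP s t (hE _ _ (le_max_left m₀ n) hst)
      have h2 := hinv n s t (hE _ _ (le_max_right m₀ n) hst)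
      simp only [c, h1.1, h1.2, h2])
    refine exists_stage hκ hx hE hP hinv hsuf hlen hleg k (max n c₀) ?_
    filter_upwards [h, hc₀, hleg (max n c₀)] with s hs hcs hl
    have hmem : c s ∈ {c | ∀ v, Leg s v → hist s n <:+ v → c ≤ v.length →
      Caught (Leg s) (P s) k v} := Nat.sInf_mem hs
    exact hmem _ hl (hsuf _ _ _ (le_max_left _ _)) (by rw [hcs, hlen]; exact le_max_right _ _)

end Invariant

/-! ### Gluing coordinatewise partial isomorphisms -/

section Rel

variable {L : FirstOrder.Language.{u, u}}

/-- A bi-total relation compatible with the symbols gives an isomorphism. -/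
theorem nonempty_equiv_of_rel {A B : Type u} [L.Structure A] [L.Structure B] (R : A → B → Prop)
    (hleft : ∀ a, ∃ b, R a b) (hright : ∀ b, ∃ a, R a b)
    (heq : ∀ a b a' b', R a b → R a' b' → (a = a' ↔ b = b'))
    (hrel : ∀ (n : ℕ) (r : L.Relations n) (a : Fin n → A) (b : Fin n → B), (∀ i, R (a i) (b i)) →
      (RelMap r a ↔ RelMap r b))
    (hfun : ∀ (n : ℕ) (f : L.Functions n) (a : Fin n → A) (b : Fin n → B) (c : A) (d : B),
      (∀ i, R (a i) (b i)) → R c d → (funMap f a = c ↔ funMap f b = d)) :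
    Nonempty (A ≃[L] B) := by
  choose F hF using hleft
  choose G hG using hright
  exact ⟨{
    toFun := F
    invFun := G
    left_inv := fun a => (heq _ _ _ _ (hG _) (hF a)).2 rfl
    right_inv := fun b => (heq _ _ _ _ (hF _) (hG b)).1 rfl
    map_fun' := fun f x => ((hfun _ f x (F ∘ x) _ _ (fun i => hF _) (hF _)).1 rfl).symm
    map_rel' := fun r x => (hrel _ r x (F ∘ x) fun i => hF _).symm }⟩

theorem PreservesQF.relMap_iff {M N : Type u} [L.Structure M] [L.Structure N] {g : M ≃. N}
    (hg : PreservesQF L g) {n : ℕ} (r : L.Relations n) {a : Fin n → M} {b : Fin n → N}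
    (h : ∀ i, b i ∈ g (a i)) : RelMap r a ↔ RelMap r b := by
  have := hg n (r.formula fun i => Term.var i) (BoundedFormula.IsAtomic.rel _ _).isQF a b h
  simpa only [Formula.realize_rel, Term.realize_var] using this

theorem PreservesQF.funMap_iff {M N : Type u} [L.Structure M] [L.Structure N] {g : M ≃. N}
    (hg : PreservesQF L g) {n : ℕ} (f : L.Functions n) {a : Fin n → M} {b : Fin n → N} {c : M}
    {d : N} (h : ∀ i, b i ∈ g (a i)) (hcd : d ∈ g c) : funMap f a = c ↔ funMap f b = d := by
  have := hg (n + 1) (Term.equal (Term.func f fun i => Term.var (Fin.castSucc i))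
    (Term.var (Fin.last n))) (BoundedFormula.IsAtomic.equal _ _).isQF (Fin.snoc a c) (Fin.snoc b d)
    (fun i => by refine Fin.lastCases ?_ (fun i => ?_) i <;> simp [h, hcd])
  simpa only [Formula.realize_equal, Term.realize_var, Term.realize_func, Fin.snoc_castSucc,
    Fin.snoc_last] using this

theorem reducedPower_mk_eq_iff {I M : Type u} {D : Filter I} {f f' : I → M} :
    ReducedPower.mk D f = ReducedPower.mk D f' ↔ ∀ᶠ s in D, f s = f' s :=
  Quotient.eq''

theorem reducedPower_relMap_iff {I M : Type u} [L.Structure M] {D : Filter I} {n : ℕ}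
    (r : L.Relations n) (f : Fin n → I → M) :
    RelMap r (fun i => ReducedPower.mk D (f i)) ↔ ∀ᶠ s in D, RelMap r fun i => f i s :=
  relMap_quotient_mk' (L := L) (D.productSetoid fun _ => M) r f

theorem reducedPower_funMap {I M : Type u} [L.Structure M] {D : Filter I} {n : ℕ}
    (F : L.Functions n) (f : Fin n → I → M) :
    funMap F (fun i => ReducedPower.mk D (f i)) =
      ReducedPower.mk D fun s => funMap F fun i => f i s :=
  funMap_quotient_mk' (L := L) (D.productSetoid fun _ => M) F f

/-- Coherent partial isomorphisms in the coordinates glue to an isomorphism of limit powers. -/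
theorem nonempty_limitPower_equiv {I : Type u} {D : Filter I} {κ : Cardinal.{u}} {E : ℕ → Setoid I}
    (hx : IsLUFT κ ℵ₀ D (Set.range E)) (hE : ∀ m n, m ≤ n → E n ≤ E m) {M₁ M₂ : Type u}
    [L.Structure M₁] [L.Structure M₂] [Nonempty M₁] [Nonempty M₂] (G : I → ℕ → M₁ ≃. M₂)
    (hinv : ∀ n s t, E n s t → G s n = G t n)
    (hmono : ∀ m n, m ≤ n → ∀ᶠ s in D, G s m ≤ G s n)
    (hrel : ∀ m n (r : L.Relations n), ∀ᶠ s in D, ∀ a b, (∀ i, b i ∈ G s m (a i)) →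
      (RelMap r a ↔ RelMap r b))
    (hfun : ∀ m n (F : L.Functions n), ∀ᶠ s in D, ∀ a b c d, (∀ i, b i ∈ G s m (a i)) →
      d ∈ G s m c → (funMap F a = c ↔ funMap F b = d))
    (hleft : ∀ n (f : I → M₁), E n ≤ Setoid.ker f → ∃ m, ∀ᶠ s in D, ∃ b, b ∈ G s m (f s))
    (hright : ∀ n (f : I → M₂), E n ≤ Setoid.ker f → ∃ m, ∀ᶠ s in D, ∃ a, f s ∈ G s m a) :
    Nonempty (limitPower (L := L) M₁ hx ≃[L] limitPower (L := L) M₂ hx) := by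
  have := hx.neBot ⟨0, rfl⟩
  let R : limitPower (L := L) M₁ hx → limitPower (L := L) M₂ hx → Prop := fun x y =>
    ∃ f f' m, ReducedPower.mk D f = x.1 ∧ ReducedPower.mk D f' = y.1 ∧
      ∀ᶠ s in D, f' s ∈ G s m (f s)
  -- Finitely many related pairs can be moved to one common stage, since the partial maps increase
  -- almost everywhere.
  have common : ∀ (n : ℕ) (a : Fin n → limitPower (L := L) M₁ hx)
      (b : Fin n → limitPower (L := L) M₂ hx), (∀ i, R (a i) (b i)) →
      ∃ (f : Fin n → I → M₁) (f' : Fin n → I → M₂), (∀ i, ReducedPower.mk D (f i) = (a i).1) ∧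
        (∀ i, ReducedPower.mk D (f' i) = (b i).1) ∧
        ∃ m₀, ∀ m, m₀ ≤ m → ∀ᶠ s in D, ∀ i, f' i s ∈ G s m (f i s) := by
    intro n a b hab
    choose f f' m h1 h2 h3 using hab
    refine ⟨f, f', h1, h2, Finset.univ.sup m, fun m' hm' => Filter.eventually_all.2 fun i => ?_⟩
    filter_upwards [h3 i, hmono (m i) m' ((Finset.le_sup (Finset.mem_univ i)).trans hm')]
      with s hs hs'
    exact hs' _ _ hs
  refine nonempty_equiv_of_rel R ?_ ?_ ?_ ?_ ?_
  · rintro ⟨x, f, ⟨_, ⟨n, rfl⟩, hf⟩, rfl⟩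
    obtain ⟨m, hm⟩ := hleft n f hf
    let b₀ : M₂ := Classical.arbitrary M₂
    -- The default `b₀` is used only on a null set; the resulting function is invariant under `E
    -- (max m n)` because both `G · m` and `f` are.
    refine ⟨⟨ReducedPower.mk D fun s => (G s m (f s)).getD b₀, _,
      ⟨_, ⟨max m n, rfl⟩, fun {s t} hst => ?_⟩, rfl⟩, f, _, m, rfl, rfl, ?_⟩
    · change (G s m (f s)).getD b₀ = (G t m (f t)).getD b₀
      rw [hinv m s t (hE _ _ (le_max_left m n) hst),
        show f s = f t from hf (hE _ _ (le_max_right m n) hst)]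
    · filter_upwards [hm] with s ⟨b, hb⟩
      rw [Option.mem_def] at hb ⊢
      rw [hb]; rfl
  · rintro ⟨x, f, ⟨_, ⟨n, rfl⟩, hf⟩, rfl⟩
    obtain ⟨m, hm⟩ := hright n f hf
    let b₀ : M₁ := Classical.arbitrary M₁
    refine ⟨⟨ReducedPower.mk D fun s => ((G s m).symm (f s)).getD b₀, _,
      ⟨_, ⟨max m n, rfl⟩, fun {s t} hst => ?_⟩, rfl⟩, _, f, m, rfl, rfl, ?_⟩
    · change ((G s m).symm (f s)).getD b₀ = ((G t m).symm (f t)).getD b₀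
      rw [hinv m s t (hE _ _ (le_max_left m n) hst),
        show f s = f t from hf (hE _ _ (le_max_right m n) hst)]
    · filter_upwards [hm] with s ⟨b, hb⟩
      rw [← PEquiv.mem_iff_mem] at hb ⊢
      rw [Option.mem_def] at hb ⊢
      rw [hb]; rfl
  · intro a b a' b' h h'
    obtain ⟨f, f', h1, h2, m, hm⟩ := common 2 ![a, a'] ![b, b'] (by
      intro i; fin_cases i <;> assumption)
    rw [Subtype.ext_iff, Subtype.ext_iff, show a.1 = _ from (h1 0).symm,
      show a'.1 = _ from (h1 1).symm, show b.1 = _ from (h2 0).symm,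
      show b'.1 = _ from (h2 1).symm, reducedPower_mk_eq_iff, reducedPower_mk_eq_iff]
    refine Filter.eventually_congr ?_
    filter_upwards [hm m le_rfl] with s hs
    constructor
    · intro e
      have h0 := hs 0
      rw [e] at h0
      exact Option.some_injective _ (h0.symm.trans (hs 1))
    · intro e
      have h0 := hs 0
      rw [e] at h0
      exact PEquiv.inj _ h0 (hs 1)
  · intro n r a b hab
    obtain ⟨f, f', h1, h2, m, hm⟩ := common n a b hab
    change RelMap r (fun i => (a i).1) ↔ RelMap r (fun i => (b i).1)
    simp only [← h1, ← h2]
    rw [reducedPower_relMap_iff, reducedPower_relMap_iff]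
    refine Filter.eventually_congr ?_
    filter_upwards [hm m le_rfl, hrel m n r] with s hs hs'
    exact hs' _ _ hs
  · intro n F a b c d hab hcd
    obtain ⟨f, f', h1, h2, m, hm⟩ := common n a b hab
    obtain ⟨f₁, f₁', h1', h2', m', hm'⟩ := common 1 (fun _ => c) (fun _ => d) (fun _ => hcd)
    rw [Subtype.ext_iff, Subtype.ext_iff]
    change funMap F (fun i => (a i).1) = c.1 ↔ funMap F (fun i => (b i).1) = d.1
    rw [← h1' 0, ← h2' 0]
    simp only [← h1, ← h2]
    rw [reducedPower_funMap, reducedPower_funMap, reducedPower_mk_eq_iff, reducedPower_mk_eq_iff]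
    refine Filter.eventually_congr ?_
    filter_upwards [hm (max m m') (le_max_left _ _), hm' (max m m') (le_max_right _ _),
      hfun (max m m') n F] with s hs hs' hs''
    exact hs'' _ _ _ _ hs (hs' 0)

end Rel

/-! ### Equivalent models have isomorphic nice limit ultrapowers -/

section Nice

variable {τ : FirstOrder.Language.{u, u}} {θ : Cardinal.{u}}

/-- Doubling `α` keeps it below the successor of the infinite cardinal `μ`, so the equivalence
supplies games of the length needed for two-sided demands. -/
theorem L1Equiv.exists_isStrategy {M₁ M₂ : Type u} [τ.Structure M₁] [τ.Structure M₂] [Nonempty M₁]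
    [Nonempty M₂] (h : L1Equiv θ τ M₁ M₂) {μ : Cardinal.{u}} (hμ : ℵ₀ ≤ μ) (hμθ : μ < θ)
    {α : Ordinal.{u}} (hα : α < (Order.succ μ).ord) {S : Set τ.Symbols} (hS : #S ≤ μ) :
    ∃ k, ∃ Γ : History M₁ M₂ → M₁ ≃. M₂, @IsStrategy (subLanguage τ S) M₁ M₂
      ((subLanguageIncl τ S).reduct M₁) ((subLanguageIncl τ S).reduct M₂) μ α k Γ := by
  refine exists_isStrategy_of_eqvGen hμ (h μ hμθ (2 * α) ?_ S hS)
  rw [lt_ord, Order.lt_succ_iff] at hα ⊢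
  rw [Ordinal.card_mul]
  refine (mul_le_mul' (b := ℵ₀) ?_ hα).trans (aleph0_mul_eq hμ).le
  exact (Ordinal.card_nat 2).le.trans (natCast_lt_aleph0 (n := 2)).le

/-- The elements which are demanded in a coordinate at stage `n`. -/
def demand {I M : Type u} {lam : ℕ → Cardinal.{u}} {E : ℕ → Setoid I}
    (w : I → ∀ n, Set (lam n).ord.ToType)
    (e : ∀ n, {f : I → M // E n ≤ Setoid.ker f} ↪ (lam (n + 1)).ord.ToType) (s : I) : ℕ → Set M
  | 0 => ∅
  | n + 1 => {a | ∃ f, e n f ∈ w s (n + 1) ∧ f.1 s = a}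

/-- The history in a coordinate up to stage `n`. -/
def demandHistory {I M N : Type u} (γ : I → ℕ → Ordinal.{u}) (X : I → ℕ → Set M)
    (Y : I → ℕ → Set N) (s : I) : ℕ → History M N
  | 0 => []
  | n + 1 => (γ s n, X s n, Y s n) :: demandHistory γ X Y s n

section

variable {I : Type u} {D : Filter I} {E : ℕ → Setoid I} {lam : ℕ → Cardinal.{u}}
  {w : I → ∀ n, Set (lam n).ord.ToType} {γ : I → ℕ → Ordinal.{u}}

theorem demand_card_le {M : Type u}
    (e : ∀ n, {f : I → M // E n ≤ Setoid.ker f} ↪ (lam (n + 1)).ord.ToType) (s : I) (n : ℕ) :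
    #(demand w e s n) ≤ #(w s n) := by
  cases n with
  | zero => simp [demand]
  | succ n =>
    have : demand w e s (n + 1) = (fun f : {f : I → M // E n ≤ Setoid.ker f} => f.1 s) ''
        (e n ⁻¹' w s (n + 1)) := rfl
    rw [this]
    exact mk_image_le.trans (mk_preimage_of_injective _ _ (e n).injective)

/-- The functions demanded at stage `n + 1` are `E n`-invariant and their codes are selected by an
`E (n + 1)`-invariant set. -/
theorem demand_congr (hE : ∀ m n, m ≤ n → E n ≤ E m)
    (hw : ∀ n s t, E n s t → w s n = w t n) {M : Type u}
    (e : ∀ n, {f : I → M // E n ≤ Setoid.ker f} ↪ (lam (n + 1)).ord.ToType) {n : ℕ} {s t : I}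
    (h : E n s t) : demand w e s n = demand w e t n := by
  cases n with
  | zero => rfl
  | succ n =>
    ext a
    have : ∀ f : {f : I → M // E n ≤ Setoid.ker f}, f.1 s = f.1 t := fun f =>
      f.2 (hE n (n + 1) (Nat.le_succ n) h)
    simp only [demand, hw (n + 1) s t h, this]

/-- Invariant functions are functions on the quotient. As its cardinality is infinite and at least
that of `M`, there are at most $2^{|I/E_n|}$ of them, so they can be coded by ordinals below `lam (n
+ 1)`. -/
theorem card_invariant_le {M : Type u} (hlam : ∀ n, 2 ^ #(Quotient (E n)) ≤ lam (n + 1))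
    (hE : ∀ m n, m ≤ n → E n ≤ E m) (hM : #M ≤ #(Quotient (E 0))) (hinf : ℵ₀ ≤ #(Quotient (E 0)))
    (n : ℕ) : Nonempty ({f : I → M // E n ≤ Setoid.ker f} ↪ (lam (n + 1)).ord.ToType) := by
  have h1 : #(Quotient (E 0)) ≤ #(Quotient (E n)) :=
    mk_le_of_surjective (f := Quotient.map' (s₁ := E n) (s₂ := E 0) id
      fun _ _ h => hE 0 n (Nat.zero_le n) h) (by
        rintro ⟨s⟩; exact ⟨Quotient.mk _ s, rfl⟩)
  have h2 : #({f : I → M // E n ≤ Setoid.ker f}) ≤ lam (n + 1) := by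
    rw [mk_congr (Setoid.liftEquiv (E n)), ← power_def]
    refine (power_le_power_right ((hM.trans h1).trans (cantor _).le)).trans ?_
    rw [← power_mul, mul_eq_self (hinf.trans h1)]
    exact hlam n
  rw [← mk_ord_toType (lam (n + 1))] at h2
  exact h2

namespace IsNicenessWitness

variable (hw : IsNicenessWitness θ lam D E w γ)

include hw in
theorem eventually_nonempty (hθ : ℵ₀ < θ) {n : ℕ} (hn : lam n ≠ 0) :
    ∀ᶠ s in D, (w s n).Nonempty ∧ γ s n ≠ 0 := by
  have : Nonempty (lam n).ord.ToType := by rw [← mk_ne_zero_iff, mk_ord_toType]; exact hn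
  obtain ⟨i⟩ := this
  filter_upwards [hw.covers n {i} (by simpa using one_lt_aleph0.trans hθ)] with s hs
  have h : (w s n).Nonempty := ⟨i, hs rfl⟩
  exact ⟨h, fun h0 => h.ne_empty (hw.empty_of_zero s n h0)⟩

include hw in
-- Suppose `δ` is a bound at stage `n`. The strict descent gives values below `δ` at stage `n + 1`,
-- while by induction no `ε < δ` bounds them almost everywhere; completeness makes them exceed all
-- `ε < δ` at once, a contradiction.
theorem not_eventually_le (hx : IsLUFT θ ℵ₀ D (Set.range E))
    (hne : ∀ n, ∀ᶠ s in D, γ s n ≠ 0) (δ : Ordinal.{u}) (hδ : δ < θ.ord) (n : ℕ) :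
    ¬ ∀ᶠ s in D, γ s n ≤ δ := by
  have := hx.neBot ⟨0, rfl⟩
  induction δ using WellFoundedLT.induction generalizing n with
  | ind δ ih =>
    intro h
    have h1 : ∀ᶠ s in D, γ s (n + 1) < δ := by
      filter_upwards [h, hne (n + 1)] with s hs hs'
      exact ((hw.ord_anti s n).resolve_right hs').trans_le hs
    have h2 : ∀ᶠ s in D, ∀ ε < δ, ¬ γ s (n + 1) ≤ ε := by
      have hinv : ∀ (ε : Ordinal.{u}) s t, E (n + 1) s t → (γ s (n + 1) ≤ ε ↔ γ t (n + 1) ≤ ε) :=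
        fun ε s t hst => by rw [(hw.invariant _ s t hst).2]
      refine hx.eventually_forall_lt ⟨n + 1, rfl⟩ hδ (fun ε s t hst => not_congr (hinv ε s t hst))
        fun ε hε => ?_
      exact (hx.eventually_not ⟨n + 1, rfl⟩ (hinv ε)).2 (ih ε hε (hε.trans hδ) _)
    obtain ⟨s, hs, hs'⟩ := (h1.and h2).exists
    exact hs' _ hs le_rfl

include hw in
theorem le_card_quotient (hx : IsLUFT θ ℵ₀ D (Set.range E))
    (hne : ∀ n, ∀ᶠ s in D, γ s n ≠ 0) : θ ≤ #(Quotient (E 0)) := by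
  by_contra! hcon
  obtain ⟨q, hq⟩ := hx.exists_eventually_eq (E := E 0) ⟨0, rfl⟩ hcon (c := Quotient.mk _)
    (fun s t h => Quotient.sound h)
  obtain ⟨s₀, rfl⟩ := Quotient.exists_rep q
  refine hw.not_eventually_le hx hne (γ s₀ 0) (hw.ord_lt s₀ 0) 0 ?_
  filter_upwards [hq] with s hs
  rw [(hw.invariant 0 s s₀ (Quotient.exact hs)).2]

include hw in
theorem lam_zero_le (hθ : ℵ₀ < θ) (hx : IsLUFT θ ℵ₀ D (Set.range E))
    (hle : θ ≤ #(Quotient (E 0))) : lam 0 ≤ #(Quotient (E 0)) := by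
  have := hx.neBot ⟨0, rfl⟩
  have hU : (⋃ q : Quotient (E 0), w q.out 0) = Set.univ := by
    rw [Set.eq_univ_iff_forall]
    intro i
    obtain ⟨s, hs⟩ := Filter.Eventually.exists
      (hw.covers 0 {i} (by simpa using one_lt_aleph0.trans hθ))
    rw [Set.mem_iUnion]
    refine ⟨Quotient.mk _ s, ?_⟩
    rw [(hw.invariant 0 _ _ (Quotient.mk_out s)).1]
    exact hs rfl
  rw [← mk_ord_toType (lam 0), ← mk_univ, ← hU]
  refine mk_iUnion_le_sum_mk.trans ((sum_le_sum _ (fun _ => θ) fun q => (hw.card_lt _ _).le).trans ?_)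
  rw [sum_const']
  exact (mul_le_mul' le_rfl hle).trans (mul_eq_self (hθ.le.trans hle)).le

end IsNicenessWitness

/-- Models equivalent for the game logic have isomorphic nice limit ultrapowers. -/
theorem L1Equiv.nonempty_limitPower_equiv {M₁ M₂ : Type u} [τ.Structure M₁] [τ.Structure M₂]
    [Nonempty M₁] [Nonempty M₂] (h : L1Equiv θ τ M₁ M₂) (hθ : ℵ₀ < θ)
    (hx : IsLUFT θ ℵ₀ D (Set.range E)) (hE' : ∀ n, E (n + 1) ≤ E n)
    (hlam : ∀ n, 2 ^ #(Quotient (E n)) ≤ lam (n + 1)) (h0 : #M₁ + #M₂ + τ.card ≤ lam 0)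
    (hw : IsNicenessWitness θ lam D E w γ) :
    Nonempty (limitPower (L := τ) M₁ hx ≃[τ] limitPower (L := τ) M₂ hx) := by
  have hE : ∀ m n, m ≤ n → E n ≤ E m := fun m n hmn => antitone_nat_of_succ_le hE' hmn
  have hne0 := hx.neBot ⟨0, rfl⟩
  have hlam0 : ∀ n, lam n ≠ 0 := by
    intro n
    cases n with
    | zero =>
      obtain ⟨s⟩ := hne0.nonempty
      obtain ⟨i, -⟩ := (hw.infinite s).nonempty
      rw [← mk_ord_toType (lam 0), mk_ne_zero_iff]
      exact ⟨i⟩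
    | succ n => exact fun h0 => (power_ne_zero _ two_ne_zero) (le_zero_iff.1 (h0 ▸ hlam n))
  have hne : ∀ n, ∀ᶠ s in D, γ s n ≠ 0 := fun n =>
    (hw.eventually_nonempty hθ (hlam0 n)).mono fun s hs => hs.2
  have hle := hw.le_card_quotient hx hne
  have hlamle := hw.lam_zero_le hθ hx hle
  have hM₁ : #M₁ ≤ #(Quotient (E 0)) :=
    (le_self_add.trans (le_self_add.trans h0)).trans hlamle
  have hM₂ : #M₂ ≤ #(Quotient (E 0)) :=
    ((self_le_add_left _ _).trans (le_self_add.trans h0)).trans hlamle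
  have e₁ := fun n => Classical.choice
    (card_invariant_le (M := M₁) hlam hE hM₁ (hθ.le.trans hle) n)
  have e₂ := fun n => Classical.choice
    (card_invariant_le (M := M₂) hlam hE hM₂ (hθ.le.trans hle) n)
  have hS : #τ.Symbols ≤ #(lam 0).ord.ToType := by
    rw [mk_ord_toType]; exact (self_le_add_left _ _).trans h0
  obtain ⟨eS⟩ := hS
  -- The first summand bounds the vocabulary and all demands in a coordinate; the second puts `g +
  -- 1` below the successor of the sum.
  let μ : Set (lam 0).ord.ToType → Ordinal.{u} → Cardinal.{u} := fun W g => #W + g.card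
  have hstrat : ∀ (W : Set (lam 0).ord.ToType) (g : Ordinal.{u}), W.Infinite → #W < θ →
      g < θ.ord → ∃ (k : ℕ) (Γ : History M₁ M₂ → M₁ ≃. M₂),
        @IsStrategy (subLanguage τ (eS ⁻¹' W)) M₁ M₂ ((subLanguageIncl τ (eS ⁻¹' W)).reduct M₁)
          ((subLanguageIncl τ (eS ⁻¹' W)).reduct M₂) (μ W g) (g + 1) k Γ := by
    intro W g hWinf hWθ hg
    have hW : ℵ₀ ≤ #W := by
      have := hWinf.to_subtype
      exact aleph0_le_mk W
    refine h.exists_isStrategy (hW.trans le_self_add) (add_lt_of_lt hθ.le hWθ (lt_ord.1 hg)) ?_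
      ((mk_preimage_of_injective _ _ eS.injective).trans le_self_add)
    rw [lt_ord, Order.lt_succ_iff, Ordinal.card_add, Ordinal.card_one]
    rw [add_comm]
    exact add_le_add_left (one_le_aleph0.trans hW) _
  -- The choice is made for each pair `(W, g)` and not for each coordinate, so the strategy used at
  -- `s` depends only on the class of `s` under `E 0`.
  choose! k Γ hΓ using hstrat
  have hΓs := fun s => hΓ (w s 0) (γ s 0) (hw.infinite s) (hw.card_lt s 0) (hw.ord_lt s 0)
  let hist : I → ℕ → History M₁ M₂ := demandHistory γ (demand w e₁) (demand w e₂)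
  let Leg : I → History M₁ M₂ → Prop := fun s => History.Legal (μ (w s 0) (γ s 0)) (γ s 0 + 1)
  have hhist : ∀ n s t, E n s t → hist s n = hist t n := by
    intro n
    induction n with
    | zero => intro s t _; rfl
    | succ n ih =>
      intro s t hst
      have hst' : E n s t := hE n (n + 1) (Nat.le_succ n) hst
      change (γ s n, demand w e₁ s n, demand w e₂ s n) :: hist s n =
        (γ t n, demand w e₁ t n, demand w e₂ t n) :: hist t n
      rw [ih s t hst', (hw.invariant n s t hst').2,
        demand_congr hE (fun n s t h => (hw.invariant n s t h).1) e₁ hst',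
        demand_congr hE (fun n s t h => (hw.invariant n s t h).1) e₂ hst']
  have hsuf : ∀ s m n, m ≤ n → hist s m <:+ hist s n := by
    intro s m n hmn
    induction n, hmn using Nat.le_induction with
    | base => exact List.suffix_refl _
    | succ n _ ih => exact ih.trans (List.suffix_cons _ _)
  have hlen : ∀ s n, (hist s n).length = n := by
    intro s n
    induction n with
    | zero => rfl
    | succ n ih => exact congrArg (· + 1) ih
  have hwle : ∀ s n, #(w s n) ≤ μ (w s 0) (γ s 0) := by
    intro s n
    refine le_trans ?_ (le_self_add (a := #(w s 0)))
    induction n with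
    | zero => exact le_rfl
    | succ n ih => exact (hw.card_anti s n).trans ih
  -- The ordinals reach `0` in each coordinate, so no coordinate supports an infinite legal play;
  -- but each fixed stage is legal almost everywhere. The starting ordinal `γ s 0 + 1` leaves room
  -- for the first move `γ s 0`.
  have hleg : ∀ n, ∀ᶠ s in D, Leg s (hist s n) := by
    intro n
    induction n with
    | zero => exact Filter.Eventually.of_forall fun s => trivial
    | succ n ih =>
      filter_upwards [ih, hne n] with s hs hs'
      refine ⟨hs, ?_, (demand_card_le e₁ s n).trans (hwle s n),
        (demand_card_le e₂ s n).trans (hwle s n)⟩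
      cases n with
      | zero => exact Order.lt_add_one_iff.2 le_rfl
      | succ n => exact (hw.ord_anti s n).resolve_right hs'
  have hparam : ∀ n s t, E n s t → w s 0 = w t 0 ∧ γ s 0 = γ t 0 := fun n s t hst =>
    hw.invariant 0 s t (hE 0 n (Nat.zero_le n) hst)
  -- The number of delays may vary with the coordinate, but as an `E 0`-invariant natural number it
  -- has one value almost everywhere.
  obtain ⟨K, hK⟩ := hx.exists_eventually_eq_nat hθ (E := E 0) ⟨0, rfl⟩
    (c := fun s => k (w s 0) (γ s 0)) (fun s t hst => by
      rw [(hparam 0 s t hst).1, (hparam 0 s t hst).2])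
  let G : I → ℕ → M₁ ≃. M₂ := fun s n => Γ (w s 0) (γ s 0) (hist s n)
  have hsymb : ∀ σ : τ.Symbols, ∀ᶠ s in D, eS σ ∈ w s 0 := fun σ => by
    filter_upwards [hw.covers 0 {eS σ} (by simpa using one_lt_aleph0.trans hθ)] with s hs
    exact hs rfl
  have hcode : ∀ n (i : (lam n).ord.ToType), ∀ᶠ s in D, i ∈ w s n := fun n i => by
    filter_upwards [hw.covers n {i} (by simpa using one_lt_aleph0.trans hθ)] with s hs
    exact hs rfl
  refine LimUlt.nonempty_limitPower_equiv hx hE G ?_ ?_ ?_ ?_ ?_ ?_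
  · intro n s t hst
    change Γ (w s 0) (γ s 0) (hist s n) = Γ (w t 0) (γ t 0) (hist t n)
    rw [(hparam n s t hst).1, (hparam n s t hst).2, hhist n s t hst]
  · intro m n hmn
    filter_upwards [hleg n] with s hs
    let _ := (subLanguageIncl τ (eS ⁻¹' (w s 0))).reduct M₁
    let _ := (subLanguageIncl τ (eS ⁻¹' (w s 0))).reduct M₂
    exact (hΓs s).mono_suffix hs (hsuf s m n hmn)
  · intro m n r
    filter_upwards [hleg m, hsymb (Sum.inr ⟨n, r⟩)] with s hs hr a b hab
    let _ := (subLanguageIncl τ (eS ⁻¹' (w s 0))).reduct M₁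
    let _ := (subLanguageIncl τ (eS ⁻¹' (w s 0))).reduct M₂
    exact ((hΓs s).preserves _ hs).relMap_iff
      (⟨r, hr⟩ : (subLanguage τ (eS ⁻¹' (w s 0))).Relations n) hab
  · intro m n F
    filter_upwards [hleg m, hsymb (Sum.inl ⟨n, F⟩)] with s hs hr a b c d hab hcd
    let _ := (subLanguageIncl τ (eS ⁻¹' (w s 0))).reduct M₁
    let _ := (subLanguageIncl τ (eS ⁻¹' (w s 0))).reduct M₂
    exact ((hΓs s).preserves _ hs).funMap_iff
      (⟨F, hr⟩ : (subLanguage τ (eS ⁻¹' (w s 0))).Functions n) hab hcd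
  · intro n f hf
    -- An `E n`-invariant function has its code below `lam (n + 1)`, so it is demanded at stage `n +
    -- 1`, which is the head of the history of length `n + 2`.
    refine hx.exists_stage hθ hE (Leg := Leg) (m₀ := n)
      (P := fun s v => ∃ b, b ∈ Γ (w s 0) (γ s 0) v (f s)) ?_ hhist hsuf hlen hleg K (n + 2) ?_
    · intro s t hst
      simp only [Leg, (hparam n s t hst).1, (hparam n s t hst).2, show f s = f t from hf hst,
        and_self]
    · filter_upwards [hK, hleg (n + 2), hcode (n + 1) (e₁ n ⟨f, hf⟩)] with s hs hl hc
      let _ := (subLanguageIncl τ (eS ⁻¹' (w s 0))).reduct M₁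
      let _ := (subLanguageIncl τ (eS ⁻¹' (w s 0))).reduct M₂
      rw [← hs]
      exact (hΓs s).left _ _ hl (f s) ⟨⟨f, hf⟩, hc, rfl⟩
  · intro n f hf
    refine hx.exists_stage hθ hE (Leg := Leg) (m₀ := n)
      (P := fun s v => ∃ a, f s ∈ Γ (w s 0) (γ s 0) v a) ?_ hhist hsuf hlen hleg K (n + 2) ?_
    · intro s t hst
      simp only [Leg, (hparam n s t hst).1, (hparam n s t hst).2, show f s = f t from hf hst,
        and_self]
    · filter_upwards [hK, hleg (n + 2), hcode (n + 1) (e₂ n ⟨f, hf⟩)] with s hs hl hc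
      let _ := (subLanguageIncl τ (eS ⁻¹' (w s 0))).reduct M₁
      let _ := (subLanguageIncl τ (eS ⁻¹' (w s 0))).reduct M₂
      rw [← hs]
      exact (hΓs s).right _ _ hl (f s) ⟨⟨f, hf⟩, hc, rfl⟩

end

end Nice

/-! ### Iterated ultrapowers as limit ultrapowers -/

section Product

variable {I : ℕ → Type u}

/-- Two sequences are equivalent when they agree in the first `n` coordinates. -/
def agree (I : ℕ → Type u) (n : ℕ) : Setoid (∀ n, I n) where
  r s t := ∀ i < n, s i = t i
  iseqv := ⟨fun _ _ _ => rfl, fun h i hi => (h i hi).symm,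
    fun h h' i hi => (h i hi).trans (h' i hi)⟩

theorem agree_le {m n : ℕ} (h : m ≤ n) : agree I n ≤ agree I m :=
  fun {_ _} hst i hi => hst i (hi.trans_le h)

/-- The ultrafilter on sequences obtained by choosing the coordinates below `n` according to the
ultrafilters `D i`, the highest one first, and the other coordinates as in `s`. -/
def iterProd (D : ∀ n, Ultrafilter (I n)) : ℕ → (∀ n, I n) → Ultrafilter (∀ n, I n)
  | 0, s => pure s
  | n + 1, s => (D n).bind fun j => iterProd D n (Function.update s n j)

/-- The limit of the ultrafilters `iterProd D n`. -/
def limProd (D : ∀ n, Ultrafilter (I n)) : Filter (∀ n, I n) :=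
  (Filter.atTop : Filter ℕ).bind fun n => ⨆ s, (iterProd D n s : Filter (∀ n, I n))

variable (D : ∀ n, Ultrafilter (I n))

theorem eventually_iterProd_zero {s : ∀ n, I n} {p : (∀ n, I n) → Prop} :
    (∀ᶠ t in (iterProd D 0 s : Filter (∀ n, I n)), p t) ↔ p s :=
  Iff.rfl

theorem eventually_iterProd_succ {n : ℕ} {s : ∀ n, I n} {p : (∀ n, I n) → Prop} :
    (∀ᶠ t in (iterProd D (n + 1) s : Filter (∀ n, I n)), p t) ↔
      ∀ᶠ j in (D n : Filter (I n)),
        ∀ᶠ t in (iterProd D n (Function.update s n j) : Filter (∀ n, I n)), p t :=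
  Iff.rfl

theorem eventually_limProd {p : (∀ n, I n) → Prop} : (∀ᶠ t in limProd D, p t) ↔
    ∀ᶠ n in Filter.atTop, ∀ s, ∀ᶠ t in (iterProd D n s : Filter (∀ n, I n)), p t := by
  rw [limProd, Filter.eventually_bind]
  simp only [Filter.eventually_iSup]

theorem iterProd_fixed (n : ℕ) (s : ∀ n, I n) :
    ∀ᶠ t in (iterProd D n s : Filter (∀ n, I n)), ∀ m, n ≤ m → t m = s m := by
  induction n generalizing s with
  | zero => rw [eventually_iterProd_zero]; exact fun _ _ => rfl
  | succ n ih =>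
    rw [eventually_iterProd_succ]
    refine Filter.Eventually.of_forall fun j => (ih (Function.update s n j)).mono fun t ht m hm => ?_
    rw [ht m (by omega), Function.update_of_ne (by omega)]

theorem iterProd_eq (n : ℕ) (s : ∀ n, I n) (j : I n) :
    ∀ᶠ t in (iterProd D n (Function.update s n j) : Filter (∀ n, I n)), t n = j :=
  (iterProd_fixed D n _).mono fun t ht => by rw [ht n le_rfl, Function.update_self]

/-- `p` depends only on the first `n` coordinates. -/
def DependsBelow (n : ℕ) (p : (∀ n, I n) → Prop) : Prop := ∀ s t, agree I n s t → (p s ↔ p t)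

variable {D}

theorem agree_update {n : ℕ} {s t : ∀ n, I n} (h : agree I n s t) (j : I n) :
    agree I (n + 1) (Function.update s n j) (Function.update t n j) := by
  intro i hi
  by_cases hin : i = n
  · subst hin; rw [Function.update_self, Function.update_self]
  · rw [Function.update_of_ne hin, Function.update_of_ne hin]
    exact h i (by omega)

/-- Once the highest relevant coordinate `n` is fixed to `j`, what remains is a property of the
first `n` coordinates, and induction shows that the starting sequence does not matter. -/
theorem DependsBelow.congr {n : ℕ} {p : (∀ n, I n) → Prop} (hp : DependsBelow n p)
    (s s' : ∀ n, I n) : (∀ᶠ t in (iterProd D n s : Filter (∀ n, I n)), p t) ↔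
      ∀ᶠ t in (iterProd D n s' : Filter (∀ n, I n)), p t := by
  induction n generalizing p s s' with
  | zero => exact hp _ _ fun i hi => absurd hi (Nat.not_lt_zero i)
  | succ n ih =>
    rw [eventually_iterProd_succ, eventually_iterProd_succ]
    refine Filter.eventually_congr (Filter.Eventually.of_forall fun j => ?_)
    have key : ∀ s : ∀ n, I n,
        (∀ᶠ t in (iterProd D n (Function.update s n j) : Filter (∀ n, I n)), p t) ↔
        ∀ᶠ t in (iterProd D n (Function.update s n j) : Filter (∀ n, I n)),
          p (Function.update t n j) := fun s => by
      refine Filter.eventually_congr ((iterProd_eq D n s j).mono fun t ht => ?_)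
      rw [← ht, Function.update_eq_self]
    rw [key s, key s']
    exact ih (fun t t' h => hp _ _ (agree_update h j)) _ _

theorem DependsBelow.eventually_iff_of_le {m n : ℕ} (h : m ≤ n) {p : (∀ n, I n) → Prop}
    (hp : DependsBelow m p) (s : ∀ n, I n) :
    (∀ᶠ t in (iterProd D n s : Filter (∀ n, I n)), p t) ↔
      ∀ᶠ t in (iterProd D m s : Filter (∀ n, I n)), p t := by
  induction n, h using Nat.le_induction generalizing s with
  | base => rfl
  | succ n hmn ih =>
    rw [eventually_iterProd_succ]
    have : ∀ j, (∀ᶠ t in (iterProd D n (Function.update s n j) : Filter (∀ n, I n)), p t) ↔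
        ∀ᶠ t in (iterProd D m s : Filter (∀ n, I n)), p t := fun j =>
      (ih _).trans (hp.congr _ _)
    simp only [this, Filter.eventually_const]

/-- On properties of finitely many coordinates `limProd` agrees with a single ultrafilter `iterProd
D n s`; this is why its images on the quotients are complete ultrafilters. -/
theorem DependsBelow.eventually_limProd_iff {n : ℕ} {p : (∀ n, I n) → Prop}
    (hp : DependsBelow n p) (s : ∀ n, I n) : (∀ᶠ t in limProd D, p t) ↔
      ∀ᶠ t in (iterProd D n s : Filter (∀ n, I n)), p t := by
  rw [eventually_limProd]
  constructor
  · intro h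
    obtain ⟨m, hm, hnm⟩ := (h.and (Filter.eventually_ge_atTop n)).exists
    exact (hp.eventually_iff_of_le hnm s).1 (hm s)
  · intro h
    filter_upwards [Filter.eventually_ge_atTop n] with m hm s'
    exact (hp.eventually_iff_of_le hm s').2 ((hp.congr _ _).1 h)

variable {θ : Cardinal.{u}}

/-- Completeness passes through the iterated quantifier "for almost all `j`, for almost all `t`" one
quantifier at a time. -/
theorem cardinalInterFilter_iterProd (hD : ∀ n, CardinalInterFilter (D n : Filter (I n)) θ) (n : ℕ)
    (s : ∀ n, I n) : CardinalInterFilter (iterProd D n s : Filter (∀ n, I n)) θ := by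
  induction n generalizing s with
  | zero => exact ⟨fun S _ h X hX => h X hX⟩
  | succ n ih =>
    refine ⟨fun S hS h => ?_⟩
    have := hD n
    change ∀ᶠ j in (D n : Filter (I n)), ∀ᶠ t in (iterProd D n (Function.update s n j) :
      Filter (∀ n, I n)), ∀ X ∈ S, t ∈ X
    have h' := (Filter.eventually_cardinal_ball (l := (D n : Filter (I n))) hS
      (p := fun j X _ => ∀ᶠ t in (iterProd D n (Function.update s n j) : Filter (∀ n, I n)),
        t ∈ X)).2 h
    filter_upwards [h'] with j hj
    have := ih (Function.update s n j)
    exact (Filter.eventually_cardinal_ball (p := fun t X _ => t ∈ X) hS).2 hj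

theorem map_limProd (n : ℕ) (s : ∀ n, I n) : (limProd D).map (Quotient.mk (agree I n)) =
    (iterProd D n s : Filter (∀ n, I n)).map (Quotient.mk (agree I n)) := by
  ext X
  exact DependsBelow.eventually_limProd_iff (p := fun t => Quotient.mk (agree I n) t ∈ X)
    (fun s t h => by beta_reduce; rw [Quotient.sound h]) s

theorem isLUFT_limProd {σ : Cardinal.{u}} (hD : ∀ n, CardinalInterFilter (D n : Filter (I n)) θ)
    {ℰ : Set (Setoid (∀ n, I n))}
    (hdir : ∀ S ⊆ ℰ, #S < σ → ∃ E ∈ ℰ, ∀ E' ∈ S, E ≤ E') (hℰ : ∀ E ∈ ℰ, ∃ n, E = agree I n) :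
    IsLUFT θ σ (limProd D) ℰ where
  directed := hdir
  ultra E hE := by
    obtain ⟨n, rfl⟩ := hℰ E hE
    have hne : ∀ n, Nonempty (I n) := fun n => (D n).neBot.nonempty
    let s : ∀ n, I n := fun n => Classical.arbitrary (I n)
    rw [map_limProd n s]
    have := cardinalInterFilter_iterProd hD n s
    exact ⟨⟨(iterProd D n s).map (Quotient.mk _), Ultrafilter.coe_map _ _⟩, inferInstance⟩

end Product

section Rep

variable {L : FirstOrder.Language.{u, u}} {I : ℕ → Type u} (D : ∀ n, Ultrafilter (I n)) (M : Type u)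
  [L.Structure M]

/-- A function on sequences representing an element of the `n`-th iterated ultrapower. -/
noncomputable def iterRep : ∀ n, (iterUltrapower (L := L) I D M n).α → (∀ n, I n) → M
  | 0, x, _ => x
  | n + 1, x, s => iterRep n (Quotient.out (s := (D n : Filter (I n)).productSetoid
      fun _ => (iterUltrapower (L := L) I D M n).α) x (s n)) s

theorem iterRep_agree (n : ℕ) (x : (iterUltrapower (L := L) I D M n).α) :
    agree I n ≤ Setoid.ker (iterRep D M n x) := by
  induction n with
  | zero => exact fun {_ _} _ => rfl
  | succ n ih =>
    intro s t hst
    change iterRep D M n _ s = iterRep D M n _ t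
    rw [hst n (Nat.lt_succ_self n)]
    exact ih _ (agree_le (Nat.le_succ n) hst)

instance nonempty_iterUltrapower [Nonempty M] (n : ℕ) :
    Nonempty (iterUltrapower (L := L) I D M n).α := by
  induction n with
  | zero => exact ‹Nonempty M›
  | succ n ih => exact ⟨Quotient.mk _ fun _ => Classical.choice ih⟩

/-- Łoś's theorem applied once for each ultrapower in the iteration, the outermost index being the
highest coordinate. -/
theorem realize_iterRep [Nonempty M] (n : ℕ) {β : Type} (φ : L.Formula β)
    (v : β → (iterUltrapower (L := L) I D M n).α) (s : ∀ n, I n) :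
    φ.Realize v ↔ ∀ᶠ t in (iterProd D n s : Filter (∀ n, I n)),
      φ.Realize fun i => iterRep D M n (v i) t := by
  induction n generalizing s with
  | zero => rfl
  | succ n ih =>
    rw [eventually_iterProd_succ]
    have h := Ultraproduct.realize_formula_cast (u := D n)
      (M := fun _ => (iterUltrapower (L := L) I D M n).α) φ (fun i => Quotient.out (v i))
    have hv : (fun i => ((Quotient.out (v i) : I n → (iterUltrapower (L := L) I D M n).α) :
        (D n : Filter (I n)).Product fun _ => (iterUltrapower (L := L) I D M n).α)) = v :=
      funext fun i => Quotient.out_eq (v i)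
    rw [hv] at h
    refine h.trans (Filter.eventually_congr (Filter.Eventually.of_forall fun j => ?_))
    refine (ih _ (Function.update s n j)).trans (Filter.eventually_congr ?_)
    filter_upwards [iterProd_eq D n s j] with t ht
    simp only [iterRep, ht]

theorem iterRep_iterEmb (n : ℕ) (x : (iterUltrapower (L := L) I D M n).α) (s : ∀ n, I n) :
    ∀ᶠ t in (iterProd D (n + 1) s : Filter (∀ n, I n)),
      iterRep D M (n + 1) (iterEmb L I D M n x) t = iterRep D M n x t := by
  rw [eventually_iterProd_succ]
  have h : ∀ᶠ j in (D n : Filter (I n)), Quotient.out (s := (D n : Filter (I n)).productSetoid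
      fun _ => (iterUltrapower (L := L) I D M n).α) (iterEmb L I D M n x) j = x :=
    Quotient.mk_out (s := (D n : Filter (I n)).productSetoid
      fun _ => (iterUltrapower (L := L) I D M n).α) (fun _ => x)
  filter_upwards [h] with j hj
  filter_upwards [iterProd_eq D n s j] with t ht
  simp only [iterRep, ht, hj]

/-- Fixing the highest coordinate to `j` leaves a function of the lower ones, represented by some `x
j` by induction; the class of `x` represents the whole function. -/
theorem exists_iterRep (n : ℕ) (f : (∀ n, I n) → M) (hf : agree I n ≤ Setoid.ker f) :
    ∃ x : (iterUltrapower (L := L) I D M n).α, ∀ s,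
      ∀ᶠ t in (iterProd D n s : Filter (∀ n, I n)), iterRep D M n x t = f t := by
  induction n generalizing f with
  | zero =>
    have hne : ∀ n, Nonempty (I n) := fun n => (D n).neBot.nonempty
    refine ⟨f fun n => Classical.arbitrary (I n), fun s => ?_⟩
    rw [eventually_iterProd_zero]
    exact hf fun i hi => absurd hi (Nat.not_lt_zero i)
  | succ n ih =>
    have h : ∀ j : I n, ∃ x : (iterUltrapower (L := L) I D M n).α, ∀ s,
        ∀ᶠ t in (iterProd D n s : Filter (∀ n, I n)),
          iterRep D M n x t = f (Function.update t n j) := fun j =>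
      ih (fun t => f (Function.update t n j)) fun {_ _} hst => hf (agree_update hst j)
    choose x hx using h
    refine ⟨Quotient.mk _ x, fun s => ?_⟩
    rw [eventually_iterProd_succ]
    have h : ∀ᶠ j in (D n : Filter (I n)), Quotient.out (s := (D n : Filter (I n)).productSetoid
        fun _ => (iterUltrapower (L := L) I D M n).α) (Quotient.mk _ x) j = x j :=
      Quotient.mk_out (s := (D n : Filter (I n)).productSetoid
        fun _ => (iterUltrapower (L := L) I D M n).α) x
    filter_upwards [h] with j hj
    filter_upwards [iterProd_eq D n s j, hx j (Function.update s n j)] with t ht hxt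
    rw [← ht, Function.update_eq_self] at hxt
    simp only [iterRep, ht, hj]
    rwa [ht] at hxt

/-- The `ω`-iterated ultrapower is the limit ultrapower of the product. -/
theorem nonempty_omegaUltrapower_equiv [Nonempty M] {κ : Cardinal.{u}}
    {ℰ : Set (Setoid (∀ n, I n))} (hx : IsLUFT κ ℵ₀ (limProd D) ℰ)
    (hlow : ∀ E ∈ ℰ, ∃ n, agree I n ≤ E) (hhigh : ∀ n, ∃ E ∈ ℰ, E ≤ agree I n) :
    Nonempty (OmegaUltrapower L I D M ≃[L] limitPower (L := L) M hx) := by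
  have hne : ∀ n, Nonempty (I n) := fun n => (D n).neBot.nonempty
  let s₀ : ∀ n, I n := fun n => Classical.arbitrary (I n)
  -- Łoś's theorem for `limProd`. Applied to equalities and atomic relations, it gives injectivity
  -- and compatibility with the symbols for the maps `F n`.
  have key : ∀ n {β : Type} (φ : L.Formula β) (v : β → (iterUltrapower (L := L) I D M n).α),
      φ.Realize v ↔ ∀ᶠ t in limProd D, φ.Realize fun i => iterRep D M n (v i) t := by
    intro n β φ v
    refine (realize_iterRep D M n φ v s₀).trans (DependsBelow.eventually_limProd_iff ?_ s₀).symm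
    intro s t hst
    beta_reduce
    rw [show (fun i => iterRep D M n (v i) s) = fun i => iterRep D M n (v i) t from
      funext fun i => iterRep_agree D M n (v i) hst]
  let F : ∀ n, (iterUltrapower (L := L) I D M n).α → limitPower (L := L) M hx := fun n x =>
    ⟨ReducedPower.mk (limProd D) (iterRep D M n x), iterRep D M n x, by
      obtain ⟨E, hE, hle⟩ := hhigh n
      exact ⟨E, hE, hle.trans (iterRep_agree D M n x)⟩, rfl⟩
  let G : ∀ n, (iterUltrapower (L := L) I D M n).α ↪[L] limitPower (L := L) M hx := fun n =>
    { toFun := F n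
      inj' := fun x y hxy => by
        have h1 : ∀ᶠ t in limProd D, iterRep D M n x t = iterRep D M n y t :=
          reducedPower_mk_eq_iff.1 (congrArg Subtype.val hxy)
        have h2 := (key n (Term.equal (Term.var (0 : Fin 2)) (Term.var 1)) ![x, y]).2
          (by simpa using h1)
        simpa using h2
      map_fun' := fun {k} f x => by
        refine Subtype.ext ?_
        change ReducedPower.mk _ _ = funMap f fun i => ReducedPower.mk _ (iterRep D M n (x i))
        rw [reducedPower_funMap, reducedPower_mk_eq_iff]
        have h2 := (key n (Term.equal (Term.func f fun i => Term.var (Fin.castSucc i))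
          (Term.var (Fin.last k))) (Fin.snoc x (funMap f x))).1 (by simp)
        filter_upwards [h2] with t ht
        simpa using ht.symm
      map_rel' := fun {k} r x => by
        change RelMap r (fun i => ReducedPower.mk _ (iterRep D M n (x i))) ↔ _
        rw [reducedPower_relMap_iff]
        have h2 := key n (r.formula fun i => Term.var i) x
        simpa using h2.symm }
  have hG : ∀ i j hij x, G j (DirectedSystem.natLERec (iterEmb L I D M) i j hij x) = G i x := by
    intro i j hij x
    induction j, hij using Nat.le_induction with
    | base => rw [DirectedSystem.coe_natLERec]; beta_reduce; rw [Nat.leRecOn_self]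
    | succ j hij ih =>
      rw [← ih]
      rw [DirectedSystem.coe_natLERec, DirectedSystem.coe_natLERec]
      beta_reduce
      rw [Nat.leRecOn_succ hij]
      refine Subtype.ext (reducedPower_mk_eq_iff.2 ?_)
      rw [DependsBelow.eventually_limProd_iff (n := j + 1) _ s₀]
      · exact iterRep_iterEmb D M j _ s₀
      · intro s t hst
        beta_reduce
        rw [show iterRep D M (j + 1) _ s = _ from iterRep_agree D M (j + 1) _ hst,
          show iterRep D M j _ s = _ from iterRep_agree D M j _ (agree_le (Nat.le_succ j) hst)]
  let H := FirstOrder.Language.DirectLimit.lift L ℕ (fun n => (iterUltrapower (L := L) I D M n).α)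
    (DirectedSystem.natLERec (iterEmb L I D M)) G hG
  have hsurj : Function.Surjective H := by
    rintro ⟨y, f, ⟨E, hE, hEf⟩, rfl⟩
    obtain ⟨n, hn⟩ := hlow E hE
    obtain ⟨x, hx'⟩ := exists_iterRep (L := L) D M n f (hn.trans hEf)
    refine ⟨FirstOrder.Language.DirectLimit.of L ℕ _ _ n x, ?_⟩
    refine Eq.trans (b := G n x) (by apply FirstOrder.Language.DirectLimit.lift_of) ?_
    refine Subtype.ext (reducedPower_mk_eq_iff.2 ?_)
    rw [DependsBelow.eventually_limProd_iff (n := n) _ s₀]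
    · exact hx' s₀
    · intro s t hst
      beta_reduce
      rw [show iterRep D M n _ s = _ from iterRep_agree D M n _ hst, show f s = f t from hEf (hn hst)]
  exact ⟨{ Equiv.ofBijective H ⟨H.injective, hsurj⟩ with
    map_fun' := fun f x => H.map_fun f x
    map_rel' := fun r x => H.map_rel r x }⟩

end Rep

/-! ### Compact cardinals and regular ultrafilters -/

section Compact

variable {θ : Cardinal.{u}}

/-- Otherwise the subsets of the power set of `K` whose complement has fewer than `θ` elements form
a proper complete filter. A complete ultrafilter extending it decides the fewer than `θ` questions
`k ∈ x`, so it concentrates on one point `b`, although the complement of `{b}` belongs to it. -/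
theorem IsCompactCardinal.two_power_lt (hθ : IsCompactCardinal θ) {κ : Cardinal.{u}} (hκ : κ < θ) :
    2 ^ κ < θ := by
  obtain ⟨h0, hreg, hext⟩ := hθ
  by_contra! hcon
  induction κ using Cardinal.inductionOn with
  | _ K =>
  have h2 : (2 : Cardinal.{u}) < θ := (natCast_lt_aleph0 (n := 2)).trans h0
  let F : Filter (Set K) := Filter.ofCardinalUnion {s | #s < θ} h2
    (fun S hS h => by
      change #(⋃₀ S : Set (Set K)) < θ
      rw [Set.sUnion_eq_biUnion]
      exact (card_biUnion_lt_iff_forall_of_isRegular hreg hS).2 h)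
    (fun t ht s hst => (mk_le_mk_of_subset hst).trans_lt ht)
  have hF : F.NeBot := by
    refine ⟨fun h => ?_⟩
    have h1 : (∅ : Set (Set K)) ∈ F := h ▸ Filter.mem_bot
    have h3 : #((∅ : Set (Set K))ᶜ : Set (Set K)) < θ := h1
    rw [Set.compl_empty, mk_univ, mk_set] at h3
    exact hcon.not_gt h3
  have hFc : CardinalInterFilter F θ := Filter.cardinalInter_ofCardinalUnion _ _ _ _
  obtain ⟨U, hUF, hU⟩ := hext (Set K) F hF hFc
  let b : Set K := {k | ∀ᶠ x in (U : Filter (Set K)), k ∈ x}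
  have h3 : ∀ᶠ x in (U : Filter (Set K)), ∀ k, (k ∈ x ↔ k ∈ b) := by
    refine (Filter.eventually_cardinal_forall hκ).2 fun k => ?_
    rcases Ultrafilter.em U (fun x => k ∈ x) with h | h
    · exact h.mono fun x hx => iff_of_true hx h
    · refine h.mono fun x hx => iff_of_false hx fun hk => ?_
      obtain ⟨y, hy, hy'⟩ := (h.and hk).exists
      exact hy hy'
  have h4 : ({b}ᶜ : Set (Set K)) ∈ F := by
    change #(({b}ᶜ : Set (Set K))ᶜ : Set (Set K)) < θ
    rw [compl_compl, mk_singleton]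
    exact one_lt_aleph0.trans h0
  obtain ⟨x, hx, hx'⟩ := (h3.and (hUF h4)).exists
  exact hx' (Set.ext hx)

theorem IsCompactCardinal.succ_lt (hθ : IsCompactCardinal θ) {κ : Cardinal.{u}} (hκ : κ < θ) :
    Order.succ κ < θ :=
  (Order.succ_le_of_lt (cantor κ)).trans_lt (hθ.two_power_lt hκ)

/-- A non-principal ultrafilter avoids each point; with fewer than `θ` points, completeness would
let it avoid all of them. -/
theorem le_mk_of_mem_uf {X : Type u} {D : Ultrafilter X} (hD : D ∈ uf θ X) : θ ≤ #X := by
  by_contra! hcon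
  have := hD.1
  have h : ∀ᶠ t in (D : Filter X), ∀ x, t ≠ x := by
    refine (Filter.eventually_cardinal_forall hcon).2 fun x => ?_
    rcases Ultrafilter.em D (fun t => t = x) with h | h
    · exact absurd (Ultrafilter.coe_le_coe.1 (Filter.le_pure_iff.2 h)) (hD.2 x)
    · exact h
  obtain ⟨x, hx⟩ := h.exists
  exact hx x rfl

/-- The regularity witness covers `lam` by `#X` sets, each smaller than `θ ≤ #X`. -/
theorem le_mk_of_mem_ruf {X : Type u} {lam : Cardinal.{u}} {D : Ultrafilter X} (hθ : ℵ₀ ≤ θ)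
    (hD : D ∈ ruf lam θ X) : lam ≤ #X := by
  obtain ⟨h, w, hw, hw'⟩ := hD
  have hle := le_mk_of_mem_uf h
  have hU : (⋃ t, w t) = Set.univ := by
    rw [Set.eq_univ_iff_forall]
    intro a
    obtain ⟨t, ht⟩ := Filter.Eventually.exists (hw' a)
    exact Set.mem_iUnion.2 ⟨t, ht⟩
  rw [← mk_ord_toType lam, ← mk_univ, ← hU]
  refine mk_iUnion_le_sum_mk.trans ((sum_le_sum _ (fun _ => θ) fun q => (hw _).le).trans ?_)
  rw [sum_const']
  exact (mul_le_mul' le_rfl hle).trans (mul_eq_self (hθ.trans hle)).le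

/-- The index set of the standard regular ultrafilter. -/
abbrev SmallSets (θ lam : Cardinal.{u}) : Type u := {v : Set lam.ord.ToType // #v < θ}

/-- Fewer than `θ` sets of the form `{v | a ∈ v}` have a common member, namely the set of their
indices, so they generate a proper complete filter. An extension concentrated at a point `v` would
force `v` to be all of `lam`, which is not smaller than `θ`. -/
theorem IsCompactCardinal.exists_mem_ruf (hθ : IsCompactCardinal θ) {lam : Cardinal.{u}}
    (hlam : θ ≤ lam) : ∃ D : Ultrafilter (SmallSets θ lam), D ∈ ruf lam θ (SmallSets θ lam) := by
  obtain ⟨h0, hreg, hext⟩ := hθ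
  let g : Set (Set (SmallSets θ lam)) := Set.range fun a => {v | a ∈ v.1}
  let F : Filter (SmallSets θ lam) := Filter.cardinalGenerate g (IsRegular.nat_lt hreg 2)
  have hF : F.NeBot := by
    refine ⟨fun h => ?_⟩
    have h1 : (∅ : Set (SmallSets θ lam)) ∈ F := h ▸ Filter.mem_bot
    obtain ⟨S, hS, hSc, hS'⟩ := (Filter.mem_cardinalGenerate_iff (hreg := hreg)).1 h1
    have : Nonempty lam.ord.ToType := by
      rw [← mk_ne_zero_iff, mk_ord_toType]
      exact ((aleph0_pos.trans h0).trans_le hlam).ne'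
    choose! a ha using hS
    refine @hS' (⟨a '' S, mk_image_le.trans_lt hSc⟩ : SmallSets θ lam) fun X hX => ?_
    rw [← ha hX]
    exact ⟨X, hX, rfl⟩
  have hFc : CardinalInterFilter F θ := Filter.cardinalInter_ofCardinalGenerate _ _
  obtain ⟨U, hUF, hU⟩ := hext _ F hF hFc
  have hreg' : ∀ a, {v : SmallSets θ lam | a ∈ v.1} ∈ (U : Filter (SmallSets θ lam)) := fun a =>
    hUF (Filter.CardinalGenerateSets.basic ⟨a, rfl⟩)
  refine ⟨U, ⟨hU, fun x hx => ?_⟩, fun v => v.1, fun v => v.2, hreg'⟩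
  have h : x.1 = Set.univ := by
    rw [Set.eq_univ_iff_forall]
    intro a
    have := hreg' a
    rw [hx] at this
    exact this
  have := x.2
  rw [h, mk_univ, mk_ord_toType] at this
  exact hlam.not_gt this

theorem IsCompactCardinal.exists_ruf_sequence (hθ : IsCompactCardinal θ) (κ : Cardinal.{u}) :
    ∃ (I : ℕ → Type u) (D : ∀ n, Ultrafilter (I n)) (lam : ℕ → Cardinal.{u}),
      (∀ n, D n ∈ ruf (lam n) θ (I n)) ∧ (∀ n, 2 ^ #(I n) * lam n ≤ lam (n + 1)) ∧
      ∀ n, κ < 2 ^ #(I n) * lam n := by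
  -- The recursion turns the growth condition into an equality; the start at `max θ (succ κ)` gives
  -- both `θ ≤ lam n` and the lower bound by `κ`.
  let lam : ℕ → Cardinal.{u} := fun n =>
    Nat.rec (max θ (Order.succ κ)) (fun _ l => 2 ^ #(SmallSets θ l) * l) n
  have hmul : ∀ n, lam n ≤ 2 ^ #(SmallSets θ (lam n)) * lam n := fun n =>
    le_mul_of_one_le_left' (Cardinal.one_le_iff_ne_zero.2 (power_ne_zero _ two_ne_zero))
  have hle : ∀ n, max θ (Order.succ κ) ≤ lam n := by
    intro n
    induction n with
    | zero => exact le_rfl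
    | succ n ih => exact ih.trans (hmul n)
  choose D hD using fun n => hθ.exists_mem_ruf ((le_max_left _ _).trans (hle n))
  exact ⟨fun n => SmallSets θ (lam n), D, lam, hD, fun n => le_rfl, fun n =>
    (Order.lt_succ κ).trans_le ((le_max_right _ _).trans ((hle n).trans (hmul n)))⟩

end Compact

/-! ### Niceness of products -/

section NiceProduct

variable {θ : Cardinal.{u}} {I : ℕ → Type u} {D : ∀ n, Ultrafilter (I n)}

theorem eventually_limProd_coord {n : ℕ} {p : I n → Prop} (h : ∀ᶠ j in (D n : Filter (I n)), p j) :
    ∀ᶠ s in limProd D, p (s n) := by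
  have hne : ∀ n, Nonempty (I n) := fun n => (D n).neBot.nonempty
  rw [DependsBelow.eventually_limProd_iff (n := n + 1)
    (fun s t hst => by rw [hst n (Nat.lt_succ_self n)])
    (fun n => Classical.arbitrary (I n)), eventually_iterProd_succ]
  filter_upwards [h] with j hj
  filter_upwards [iterProd_eq D n _ j] with t ht
  rwa [ht]

theorem isLUFT_range (hD : ∀ n, CardinalInterFilter (D n : Filter (I n)) θ) (k : ℕ) :
    IsLUFT θ ℵ₀ (limProd D) (Set.range fun n => agree I (n + k)) := by
  refine isLUFT_limProd hD (fun S hS hfin => ?_) (by rintro _ ⟨n, rfl⟩; exact ⟨_, rfl⟩)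
  have hfin' : S.Finite := lt_aleph0_iff_set_finite.1 hfin
  choose! c hc using hS
  obtain ⟨n, hn⟩ := (hfin'.image c).bddAbove
  refine ⟨_, ⟨n, rfl⟩, fun E hE => ?_⟩
  rw [← hc hE]
  exact agree_le (Nat.add_le_add_right (hn ⟨E, hE, rfl⟩) k)

/-- A finite chain has a finest member, so any subfamily, of whatever size, has a common refinement
in it. -/
theorem isLUFT_agree (hD : ∀ n, CardinalInterFilter (D n : Filter (I n)) θ) (n : ℕ) :
    IsLUFT θ θ (limProd D) {E | ∃ i ≤ n, E = agree I i} := by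
  refine isLUFT_limProd hD (fun S hS _ => ⟨_, ⟨n, le_rfl, rfl⟩, fun E hE => ?_⟩)
    (by rintro _ ⟨i, -, rfl⟩; exact ⟨_, rfl⟩)
  obtain ⟨i, hi, rfl⟩ := hS hE
  exact agree_le hi

/-- A class is given by `n + 1` coordinates from infinite sets of non-decreasing size, so the last
set dominates. -/
theorem mk_quotient_agree_le (hI : ∀ n, ℵ₀ ≤ #(I n)) (hmono : ∀ n, #(I n) ≤ #(I (n + 1))) (n : ℕ) :
    #(Quotient (agree I (n + 1))) ≤ #(I n) := by
  induction n with
  | zero =>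
    refine mk_le_of_injective (f := fun q : Quotient (agree I 1) => q.out 0) fun q q' h => ?_
    rw [← Quotient.out_eq q, ← Quotient.out_eq q']
    refine Quotient.sound fun i hi => ?_
    obtain rfl : i = 0 := by omega
    exact h
  | succ n ih =>
    have h1 : #(Quotient (agree I (n + 2))) ≤ #(Quotient (agree I (n + 1)) × I (n + 1)) := by
      refine mk_le_of_injective (f := fun q : Quotient (agree I (n + 2)) =>
        (Quotient.mk (agree I (n + 1)) q.out, q.out (n + 1))) fun q q' h => ?_
      rw [← Quotient.out_eq q, ← Quotient.out_eq q']
      refine Quotient.sound fun i hi => ?_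
      rcases Nat.lt_succ_iff_lt_or_eq.1 hi with hi | rfl
      · exact Quotient.exact (congrArg Prod.fst h) i hi
      · exact congrArg Prod.snd h
    refine h1.trans ?_
    rw [mk_prod, lift_id, lift_id]
    exact (mul_le_mul' (ih.trans (hmono n)) le_rfl).trans (mul_eq_self (hI _)).le

open Classical in
/-- Sets of strictly decreasing cardinality cut out of the regularity witnesses `c`. -/
noncomputable def niceSets {lam : ℕ → Cardinal.{u}} (c : ∀ n, I n → Set (lam n).ord.ToType)
    (V : Set (lam 1).ord.ToType) (s : ∀ n, I n) : ∀ n, Set (lam (n + 1)).ord.ToType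
  | 0 => if (c 1 (s 1)).Infinite then c 1 (s 1) else V
  | n + 1 => if #(c (n + 2) (s (n + 2))) < #(niceSets c V s n) then c (n + 2) (s (n + 2)) else ∅

section

variable {lam : ℕ → Cardinal.{u}} {c : ∀ n, I n → Set (lam n).ord.ToType}
  {V : Set (lam 1).ord.ToType}

theorem niceSets_congr (n : ℕ) {s t : ∀ n, I n} (h : agree I (n + 2) s t) :
    niceSets c V s n = niceSets c V t n := by
  induction n with
  | zero => rw [niceSets, niceSets, h 1 (by omega)]
  | succ n ih => simp only [niceSets, h (n + 2) (by omega), ih (agree_le (by omega) h)]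

/-- The only danger is that a witness is discarded for not being smaller than its predecessor. But
the higher coordinate is fixed first: it determines the size of the new witness, and by induction
almost all choices of the lower coordinates make the predecessor larger than that. -/
theorem niceSets_covers (hθ : IsCompactCardinal θ)
    (hD : ∀ n, CardinalInterFilter (D n : Filter (I n)) θ)
    (hlam : ∀ n, θ ≤ lam (n + 1)) (hc : ∀ n t, #(c n t) < θ) (hc' : ∀ n a, {t | a ∈ c n t} ∈ D n)
    (hV : V.Infinite) (hVθ : #V < θ) (n : ℕ) (v : Set (lam (n + 1)).ord.ToType) (hv : #v < θ) :
    ∀ᶠ s in limProd D, v ⊆ niceSets c V s n := by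
  have hne : ∀ n, Nonempty (I n) := fun n => (D n).neBot.nonempty
  have hcov : ∀ n (v : Set (lam n).ord.ToType), #v < θ →
      ∀ᶠ j in (D n : Filter (I n)), v ⊆ c n j := fun n v hv => by
    have := hD n
    exact (Filter.eventually_cardinal_ball (p := fun j a _ => a ∈ c n j) hv).2 fun a _ => hc' n a
  have hdep : ∀ n (q : Set (lam (n + 1)).ord.ToType → Prop),
      DependsBelow (I := I) (n + 2) fun s => q (niceSets c V s n) := fun n q s t hst => by
    beta_reduce
    rw [niceSets_congr n hst]
  induction n with
  | zero =>
    filter_upwards [eventually_limProd_coord (hcov 1 v hv),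
      eventually_limProd_coord (hcov 1 V hVθ)] with s hs hs'
    rw [niceSets, if_pos (hV.mono hs')]
    exact hs
  | succ n ih =>
    rw [DependsBelow.eventually_limProd_iff (hdep (n + 1) fun W => v ⊆ W)
      (fun n => Classical.arbitrary (I n)), eventually_iterProd_succ]
    filter_upwards [hcov (n + 2) v hv] with j hj
    have hsucc := hθ.succ_lt (hc (n + 2) j)
    -- A set of size the successor of that of the new witness; the successor is still below `θ`, so
    -- the previous set covers `v'` almost everywhere.
    obtain ⟨v', hv'⟩ : ∃ v' : Set (lam (n + 1)).ord.ToType,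
        #v' = Order.succ #(c (n + 2) j) :=
      le_mk_iff_exists_set.1 (by rw [mk_ord_toType]; exact hsucc.le.trans (hlam n))
    have h1 := (DependsBelow.eventually_limProd_iff (hdep n fun W => v' ⊆ W)
      (Function.update (fun n => Classical.arbitrary (I n)) (n + 2) j)).1
      (ih v' (hv' ▸ hsucc))
    filter_upwards [h1, iterProd_eq D (n + 2) _ j] with t ht htj
    rw [niceSets, htj, if_pos]
    · exact hj
    · exact (Order.lt_succ _).trans_le (hv' ▸ mk_le_mk_of_subset ht)

/-- The initial ordinals of the cardinalities serve as `γ`: the sets shrink strictly in cardinality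
until they are empty. -/
theorem isNicenessWitness_niceSets (hθ : IsCompactCardinal θ)
    (hD : ∀ n, CardinalInterFilter (D n : Filter (I n)) θ)
    (hlam : ∀ n, θ ≤ lam (n + 1)) (hc : ∀ n t, #(c n t) < θ) (hc' : ∀ n a, {t | a ∈ c n t} ∈ D n)
    (hV : V.Infinite) (hVθ : #V < θ) :
    IsNicenessWitness θ (fun n => lam (n + 1)) (limProd D) (fun n => agree I (n + 2))
      (niceSets c V) (fun s n => (#(niceSets c V s n)).ord) := by
  have hlt : ∀ s n, #(niceSets c V s (n + 1)) < #(niceSets c V s n) ∨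
      niceSets c V s (n + 1) = ∅ := by
    intro s n
    rw [niceSets]
    split_ifs with h
    · exact Or.inl h
    · exact Or.inr rfl
  have hcard : ∀ s n, #(niceSets c V s n) < θ := by
    intro s n
    cases n with
    | zero => rw [niceSets]; split_ifs; exacts [hc _ _, hVθ]
    | succ n =>
      rw [niceSets]
      split_ifs
      · exact hc _ _
      · rw [mk_eq_zero]; exact aleph0_pos.trans hθ.1
  refine ⟨hcard, ?_, fun s n => ord_lt_ord.2 (hcard s n), ?_, ?_, ?_, ?_, ?_⟩
  · intro s n
    rcases hlt s n with h | h
    · exact h.le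
    · rw [h, mk_eq_zero]; exact zero_le
  · intro s n
    rcases hlt s n with h | h
    · exact Or.inl (ord_lt_ord.2 h)
    · right; rw [h, mk_eq_zero, ord_zero]
  · intro s n h
    rw [← ord_zero, ord_inj, mk_eq_zero_iff] at h
    exact Set.isEmpty_coe_sort.1 h
  · intro s
    rw [niceSets]
    split_ifs with h
    exacts [h, hV]
  · intro n v hv
    exact niceSets_covers hθ hD hlam hc hc' hV hVθ n v hv
  · intro n s t hst
    rw [niceSets_congr n hst]
    exact ⟨rfl, rfl⟩

end

end NiceProduct

/-! ### Passing between iterated and limit ultrapowers -/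

section Glue

variable {θ : Cardinal.{u}} {τ : FirstOrder.Language.{u, u}} {M₁ M₂ : Type u} [τ.Structure M₁]
  [τ.Structure M₂] [Nonempty M₁] [Nonempty M₂]

/-- Isomorphic limit powers of a product give isomorphic `ω`-iterated ultrapowers, and
conversely. -/
theorem isoOmegaUltrapowers_iff {I : ℕ → Type u} {D : ∀ n, Ultrafilter (I n)} {κ : Cardinal.{u}}
    {ℰ : Set (Setoid (∀ n, I n))} (hx : IsLUFT κ ℵ₀ (limProd D) ℰ)
    (hlow : ∀ E ∈ ℰ, ∃ n, agree I n ≤ E) (hhigh : ∀ n, ∃ E ∈ ℰ, E ≤ agree I n) :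
    IsoOmegaUltrapowers τ M₁ M₂ I D ↔
      Nonempty (limitPower (L := τ) M₁ hx ≃[τ] limitPower (L := τ) M₂ hx) := by
  obtain ⟨e₁⟩ := nonempty_omegaUltrapower_equiv (L := τ) D M₁ hx hlow hhigh
  obtain ⟨e₂⟩ := nonempty_omegaUltrapower_equiv (L := τ) D M₂ hx hlow hhigh
  exact ⟨fun ⟨e⟩ => ⟨e₂.comp (e.comp e₁.symm)⟩, fun ⟨e⟩ => ⟨e₂.symm.comp (e.comp e₁)⟩⟩

/-- Sequences of sufficiently regular ultrafilters give nice limit ultrapowers. -/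
theorem isoOmegaUltrapowers_of_nice (hθ : IsCompactCardinal θ)
    (he : ∀ (I : Type u) (D : Filter I) (E : ℕ → Setoid I)
      (hx : IsLUFT θ ℵ₀ D (Set.range E)) (lam : ℕ → Cardinal.{u})
      (w : I → ∀ n, Set (lam n).ord.ToType) (γ : I → ℕ → Ordinal.{u}),
      (∀ n, E (n + 1) ≤ E n) →
      (∀ n, 2 ^ #(Quotient (E n)) ≤ lam (n + 1)) →
      (∀ n, IsRegularFilter (lam n) θ (D.map (Quotient.mk (E n)))) →
      #M₁ + #M₂ + τ.card ≤ lam 0 →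
      IsNicenessWitness θ lam D E w γ →
      Nonempty (limitPower (L := τ) M₁ hx ≃[τ] limitPower (L := τ) M₂ hx))
    (I : ℕ → Type u) (D : ∀ n, Ultrafilter (I n)) (lam : ℕ → Cardinal.{u})
    (hD : ∀ n, D n ∈ ruf (lam n) θ (I n)) (hlam : ∀ n, 2 ^ #(I n) * lam n ≤ lam (n + 1))
    (hM : ∀ n, #M₁ + #M₂ + τ.card < 2 ^ #(I n) * lam n) : IsoOmegaUltrapowers τ M₁ M₂ I D := by
  have hDc : ∀ n, CardinalInterFilter (D n : Filter (I n)) θ := fun n => (hD n).1.1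
  have hθI : ∀ n, θ ≤ #(I n) := fun n => le_mk_of_mem_uf (hD n).1
  have hlam0 : ∀ n, lam n ≠ 0 := fun n h => by
    have := hM n
    rw [h, mul_zero] at this
    exact not_lt_zero this
  have hpow : ∀ n, 2 ^ #(I n) ≤ lam (n + 1) := fun n =>
    (le_mul_of_one_le_right' (Cardinal.one_le_iff_ne_zero.2 (hlam0 n))).trans (hlam n)
  have hθlam : ∀ n, θ ≤ lam (n + 1) := fun n =>
    ((hθI n).trans (cantor _).le).trans (hpow n)
  have hImono : ∀ n, #(I n) ≤ #(I (n + 1)) := fun n =>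
    ((cantor _).le.trans (hpow n)).trans (le_mk_of_mem_ruf hθ.1.le (hD (n + 1)))
  have hquot := mk_quotient_agree_le (fun n => hθ.1.le.trans (hθI n)) hImono
  choose c hc hc' using fun n => (hD n).2
  -- A countable substitute for the first witness where that witness is finite, since `w s 0` must
  -- be infinite in every coordinate.
  obtain ⟨V, hV⟩ : ∃ V : Set (lam 1).ord.ToType, #V = ℵ₀ :=
    le_mk_iff_exists_set.1 (by rw [mk_ord_toType]; exact hθ.1.le.trans (hθlam 0))
  have hVinf : V.Infinite := by
    rw [← Set.infinite_coe_iff, infinite_iff, hV]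
  rw [isoOmegaUltrapowers_iff (isLUFT_range hDc 2)
    (by rintro _ ⟨n, rfl⟩; exact ⟨_, le_rfl⟩)
    (fun n => ⟨_, ⟨n, rfl⟩, agree_le (Nat.le_add_right n 2)⟩)]
  -- The hypotheses bound `lam 1`, but not `lam 0`, from below by `θ` and by the sizes of the
  -- models. So the cardinals are shifted by one, and the equivalences by two: `agree I (n + 2)`
  -- sees coordinate `n + 1`, which carries the regularity witness for `lam (n + 1)`.
  refine he _ _ _ _ (fun n => lam (n + 1)) _ _ (fun n => agree_le (by omega)) (fun n => ?_)
    (fun n => ?_) ((hM 0).le.trans (hlam 0))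
    (isNicenessWitness_niceSets hθ hDc hθlam hc hc' hVinf (hV ▸ hθ.1))
  · exact (power_le_power_left two_ne_zero (hquot (n + 1))).trans (hpow (n + 1))
  · refine ⟨fun q => c (n + 1) (q.out (n + 1)), fun q => hc _ _, fun a => ?_⟩
    change ∀ᶠ s in limProd D, a ∈ c (n + 1) ((Quotient.mk (agree I (n + 2)) s).out (n + 1))
    filter_upwards [eventually_limProd_coord (hc' (n + 1) a)] with s hs
    rw [show (Quotient.mk (agree I (n + 2)) s).out (n + 1) = s (n + 1) from
      Quotient.mk_out (s := agree I (n + 2)) s (n + 1) (by omega)]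
    exact hs

/-- Isomorphic `ω`-iterated ultrapowers are isomorphic limit ultrapowers. -/
theorem exists_limitPower_equiv_of_omega (hθ : ℵ₀ ≤ θ) {I : ℕ → Type u}
    {D : ∀ n, Ultrafilter (I n)} (hD : ∀ n, D n ∈ uf θ (I n))
    (h : IsoOmegaUltrapowers τ M₁ M₂ I D) :
    ∃ (I : Type u) (D : Filter I) (ℰ : ℕ → Set (Setoid I)) (hx : ∀ n, IsLUFT θ θ D (ℰ n))
      (hmono : ∀ n, ℰ n ⊆ ℰ (n + 1)),
      Nonempty (limitPower (L := τ) M₁ (IsLUFT.iUnion hθ hx hmono) ≃[τ]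
        limitPower (L := τ) M₂ (IsLUFT.iUnion hθ hx hmono)) := by
  refine ⟨_, limProd D, fun n => {E | ∃ i ≤ n, E = agree I i}, isLUFT_agree fun n => (hD n).1,
    fun n E ⟨i, hi, hE⟩ => ⟨i, hi.trans (Nat.le_succ n), hE⟩, ?_⟩
  rw [← isoOmegaUltrapowers_iff]
  · exact h
  · intro E hE
    obtain ⟨n, i, -, rfl⟩ := Set.mem_iUnion.1 hE
    exact ⟨i, le_rfl⟩
  · intro n
    exact ⟨agree I n, Set.mem_iUnion.2 ⟨n, n, le_rfl, rfl⟩, le_rfl⟩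

end Glue

/-! ### Back-and-forth equivalence of tuples -/

section BackForth

variable (L : FirstOrder.Language.{u, u}) {ι M : Type u} [L.Structure M]

/-- Tuples which agree on quantifier-free formulas, and whose re-indexed extensions correspond for
all smaller ordinals. -/
def BackForth (β : Ordinal.{u}) (x y : ι → M) : Prop :=
  (∀ φ : L.Formula ι, BoundedFormula.IsQF φ → (φ.Realize x ↔ φ.Realize y)) ∧
    ∀ β' (_ : β' < β), ∀ σ : ι → ι,
      (∀ x' : ι → M, x' ∘ σ = x → ∃ y' : ι → M, y' ∘ σ = y ∧ BackForth β' x' y') ∧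
      (∀ y' : ι → M, y' ∘ σ = y → ∃ x' : ι → M, x' ∘ σ = x ∧ BackForth β' x' y')
termination_by β

variable {L}

theorem BackForth.refl (β : Ordinal.{u}) (x : ι → M) : BackForth L β x x := by
  induction β using WellFoundedLT.induction generalizing x with
  | ind β ih =>
    rw [BackForth]
    exact ⟨fun _ _ => Iff.rfl, fun β' h σ => ⟨fun x' hx' => ⟨x', hx', ih β' h x'⟩,
      fun x' hx' => ⟨x', hx', ih β' h x'⟩⟩⟩

theorem BackForth.symm {β : Ordinal.{u}} {x y : ι → M} (h : BackForth L β x y) :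
    BackForth L β y x := by
  induction β using WellFoundedLT.induction generalizing x y with
  | ind β ih =>
    rw [BackForth] at h ⊢
    refine ⟨fun φ hφ => (h.1 φ hφ).symm, fun β' hβ σ => ⟨fun x' hx' => ?_, fun x' hx' => ?_⟩⟩
    · obtain ⟨y', hy', h'⟩ := (h.2 β' hβ σ).2 x' hx'
      exact ⟨y', hy', ih β' hβ h'⟩
    · obtain ⟨y', hy', h'⟩ := (h.2 β' hβ σ).1 x' hx'
      exact ⟨y', hy', ih β' hβ h'⟩

theorem BackForth.trans {β : Ordinal.{u}} {x y z : ι → M} (h : BackForth L β x y)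
    (h' : BackForth L β y z) : BackForth L β x z := by
  induction β using WellFoundedLT.induction generalizing x y z with
  | ind β ih =>
    rw [BackForth] at h h' ⊢
    refine ⟨fun φ hφ => (h.1 φ hφ).trans (h'.1 φ hφ), fun β' hβ σ =>
      ⟨fun x' hx' => ?_, fun z' hz' => ?_⟩⟩
    · obtain ⟨y', hy', h1⟩ := (h.2 β' hβ σ).1 x' hx'
      obtain ⟨z', hz', h2⟩ := (h'.2 β' hβ σ).1 y' hy'
      exact ⟨z', hz', ih β' hβ h1 h2⟩
    · obtain ⟨y', hy', h1⟩ := (h'.2 β' hβ σ).2 z' hz'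
      obtain ⟨x', hx', h2⟩ := (h.2 β' hβ σ).2 y' hy'
      exact ⟨x', hx', ih β' hβ h2 h1⟩

theorem BackForth.realize_iff {β : Ordinal.{u}} {x y : ι → M} (h : BackForth L β x y)
    {φ : L.Formula ι} (hφ : BoundedFormula.IsQF φ) : φ.Realize x ↔ φ.Realize y := by
  rw [BackForth] at h
  exact h.1 φ hφ

theorem BackForth.forth {β β' : Ordinal.{u}} {x y : ι → M} (h : BackForth L β x y) (hβ : β' < β)
    {σ : ι → ι} {x' : ι → M} (hx : x' ∘ σ = x) :
    ∃ y' : ι → M, y' ∘ σ = y ∧ BackForth L β' x' y' := by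
  rw [BackForth] at h
  exact (h.2 β' hβ σ).1 x' hx

theorem BackForth.eq_iff {β : Ordinal.{u}} {x y : ι → M} (h : BackForth L β x y) (i j : ι) :
    x i = x j ↔ y i = y j := by
  have := h.realize_iff (φ := Term.equal (Term.var i) (Term.var j))
    (BoundedFormula.IsAtomic.equal _ _).isQF
  simpa using this

variable (L ι M) in
/-- The back-and-forth equivalence relation. -/
def backForthSetoid (β : Ordinal.{u}) : Setoid (ι → M) where
  r := BackForth L β
  iseqv := ⟨BackForth.refl β, BackForth.symm, BackForth.trans⟩

theorem mk_formula_lt {θ : Cardinal.{u}} (hθ : ℵ₀ < θ) (hι : #ι < θ) (hL : L.card < θ) :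
    #(L.Formula ι) < θ := by
  refine lt_of_le_of_lt ?_ (max_lt hθ (add_lt_of_lt hθ.le hι hL))
  have h1 : #(L.Formula ι) ≤ #(Σ n, L.BoundedFormula ι n) :=
    mk_le_of_injective (f := fun φ => (⟨0, φ⟩ : Σ n, L.BoundedFormula ι n)) fun φ ψ h => by
      simpa using h
  refine h1.trans (BoundedFormula.card_le.trans ?_)
  simp

/-- There are few classes of tuples for the back-and-forth equivalence. -/
theorem mk_quotient_backForth_lt {θ : Cardinal.{u}} (hθ : IsCompactCardinal θ) (hι : #ι < θ)
    (hL : L.card < θ) (β : Ordinal.{u}) (hβ : β < θ.ord) :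
    #(Quotient (backForthSetoid L ι M β)) < θ := by
  induction β using WellFoundedLT.induction with
  | ind β ih =>
    let ord : β.ToType → Ordinal.{u} := fun i => (Ordinal.ToType.mk.symm i).1
    let J := Σ p : β.ToType × (ι → ι), Quotient (backForthSetoid L ι M (ord p.1))
    -- The class of `x` is determined by its quantifier-free type and by the smaller classes of its
    -- re-indexed extensions. By induction and regularity `J` is smaller than `θ`, and `θ` is a
    -- strong limit.
    let Ψ : (ι → M) → Set (L.Formula ι) × Set J := fun x =>
      ({φ | BoundedFormula.IsQF φ ∧ φ.Realize x},
        {j | ∃ x' : ι → M, x' ∘ j.1.2 = x ∧ Quotient.mk _ x' = j.2})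
    have hΨ : ∀ x y, Ψ x = Ψ y → BackForth L β x y := by
      intro x y h
      have h1 := congrArg Prod.fst h
      have h2 := congrArg Prod.snd h
      rw [BackForth]
      refine ⟨fun φ hφ => ?_, fun β' hβ' σ => ?_⟩
      · have := Set.ext_iff.1 h1 φ
        exact ⟨fun h => (this.1 ⟨hφ, h⟩).2, fun h => (this.2 ⟨hφ, h⟩).2⟩
      · have hord : ord (Ordinal.ToType.mk ⟨β', hβ'⟩) = β' := by simp [ord]
        have h3 : ∀ z : ι → M, (∃ x' : ι → M, x' ∘ σ = x ∧ BackForth L β' x' z) ↔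
            ∃ y' : ι → M, y' ∘ σ = y ∧ BackForth L β' y' z := by
          intro z
          have h4 := Set.ext_iff.1 h2
            ⟨(Ordinal.ToType.mk ⟨β', hβ'⟩, σ), Quotient.mk _ z⟩
          change (∃ x' : ι → M, x' ∘ σ = x ∧ Quotient.mk _ x' = Quotient.mk _ z) ↔
            (∃ x' : ι → M, x' ∘ σ = y ∧ Quotient.mk _ x' = Quotient.mk _ z) at h4
          simp only [Quotient.eq] at h4
          change (∃ x' : ι → M, x' ∘ σ = x ∧ BackForth L (ord _) x' z) ↔
            (∃ x' : ι → M, x' ∘ σ = y ∧ BackForth L (ord _) x' z) at h4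
          rwa [hord] at h4
        constructor
        · intro x' hx'
          obtain ⟨y', hy', h⟩ := (h3 x').1 ⟨x', hx', BackForth.refl _ _⟩
          exact ⟨y', hy', h.symm⟩
        · intro y' hy'
          exact (h3 y').2 ⟨y', hy', BackForth.refl _ _⟩
    have hle : #(Quotient (backForthSetoid L ι M β)) ≤ #(Set (L.Formula ι) × Set J) := by
      refine mk_le_of_injective (f := fun q => Ψ q.out) fun q q' h => ?_
      rw [← Quotient.out_eq q, ← Quotient.out_eq q']
      exact Quotient.sound (hΨ _ _ h)
    refine hle.trans_lt ?_
    rw [mk_prod, lift_id, lift_id, mk_set, mk_set]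
    refine mul_lt_of_lt hθ.1.le (hθ.two_power_lt (mk_formula_lt hθ.1 hι hL))
      (hθ.two_power_lt ?_)
    rw [mk_sigma]
    refine sum_lt_of_isRegular hθ.2.1 ?_ fun p => ih _ (Ordinal.ToType.mk.symm p.1).2
      ((Ordinal.ToType.mk.symm p.1).2.trans hβ)
    rw [mk_prod, lift_id, lift_id, mk_toType, ← power_def]
    refine mul_lt_of_lt hθ.1.le (lt_ord.1 hβ) ?_
    have h1 : max ℵ₀ #ι < θ := max_lt hθ.1 hι
    refine lt_of_le_of_lt ?_ (hθ.two_power_lt h1)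
    calc #ι ^ #ι ≤ (2 ^ max ℵ₀ #ι) ^ max ℵ₀ #ι :=
          (power_le_power_right ((le_max_right _ _).trans (cantor _).le)).trans
            (power_le_power_left (power_ne_zero _ two_ne_zero) (le_max_right _ _))
      _ = 2 ^ max ℵ₀ #ι := by rw [← power_mul, mul_eq_self (le_max_left _ _)]

/-- A tuple can be re-indexed so as to contain a small set. -/
theorem exists_extension {X : Type u} [Infinite ι] (x : ι → X) (B : Set X) (hB : #B ≤ #ι) :
    ∃ (x' : ι → X) (σ : ι → ι), x' ∘ σ = x ∧ B ⊆ Set.range x' ∧ Set.range x' ⊆ Set.range x ∪ B := by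
  -- One copy of the infinite index set keeps the old tuple, the other receives the new elements, so
  -- the index set never changes.
  obtain ⟨e⟩ : Nonempty (ι ⊕ ι ≃ ι) := by
    rw [← Cardinal.eq, mk_sum, lift_id, add_eq_self (aleph0_le_mk ι)]
  obtain ⟨v, hv, hv'⟩ : ∃ v : ι → X, B ⊆ Set.range v ∧ Set.range v ⊆ Set.range x ∪ B := by
    rcases B.eq_empty_or_nonempty with rfl | hne
    · exact ⟨x, Set.empty_subset _, Set.subset_union_left⟩
    · have := hne.to_subtype
      obtain ⟨e⟩ := hB
      refine ⟨fun i => (Function.invFun e i : B), fun b hb => ?_, ?_⟩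
      · exact ⟨e ⟨b, hb⟩, congrArg Subtype.val (Function.leftInverse_invFun e.injective ⟨b, hb⟩)⟩
      · rintro _ ⟨i, rfl⟩
        exact Or.inr (Subtype.prop _)
  refine ⟨Sum.elim x v ∘ e.symm, e ∘ Sum.inl, ?_, ?_, ?_⟩
  · funext i; simp
  · intro b hb
    obtain ⟨i, rfl⟩ := hv hb
    exact ⟨e (Sum.inr i), by simp⟩
  · rintro _ ⟨i, rfl⟩
    rcases h : e.symm i with j | j
    · left; exact ⟨j, by simp [h]⟩
    · simpa [h] using hv' ⟨j, rfl⟩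

end BackForth

theorem exists_pequiv {M N : Type u} (R : M → N → Prop) (h₁ : ∀ a b b', R a b → R a b' → b = b')
    (h₂ : ∀ a a' b, R a b → R a' b → a = a') : ∃ g : M ≃. N, ∀ a b, b ∈ g a ↔ R a b := by
  classical
  let F : M → Option N := fun a => if h : ∃ b, R a b then some h.choose else none
  let G : N → Option M := fun b => if h : ∃ a, R a b then some h.choose else none
  have hF : ∀ a b, b ∈ F a ↔ R a b := by
    intro a b
    by_cases h : ∃ b, R a b
    · simp only [F, dif_pos h, Option.mem_some_iff]
      exact ⟨fun e => e ▸ h.choose_spec, fun h' => h₁ _ _ _ h.choose_spec h'⟩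
    · simp only [F, dif_neg h, Option.not_mem_none, false_iff]
      exact fun h' => h ⟨b, h'⟩
  have hG : ∀ a b, a ∈ G b ↔ R a b := by
    intro a b
    by_cases h : ∃ a, R a b
    · simp only [G, dif_pos h, Option.mem_some_iff]
      exact ⟨fun e => e ▸ h.choose_spec, fun h' => h₂ _ _ _ h.choose_spec h'⟩
    · simp only [G, dif_neg h, Option.not_mem_none, false_iff]
      exact fun h' => h ⟨a, h'⟩
  exact ⟨⟨F, G, fun a b => (hG a b).trans (hF a b).symm⟩, hF⟩

/-- In a game of finite length the isomorphism player wins by choosing large delays. -/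
theorem isoWins_of_finite {L : FirstOrder.Language.{u, u}} {M N : Type u} [L.Structure M]
    [L.Structure N] (μ : Cardinal.{u}) (K : ℕ)
    (h : ∀ φ : L.Formula (Fin 0), BoundedFormula.IsQF φ → ∀ a b, φ.Realize (M := M) a ↔
      φ.Realize (M := N) b) : ISOWins L M N μ K := by
  classical
  have arith : ∀ {β β' : Ordinal.{u}} {n : ℕ}, β' < β → β + n ≤ K → β' + (n + 1 : ℕ) ≤ K := by
    intro β β' n hβ hn
    refine le_trans ?_ hn
    rw [Nat.add_comm, Nat.cast_add, Nat.cast_one, ← add_assoc]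
    gcongr
    exact Order.add_one_le_of_lt hβ
  have arith' : ∀ {β : Ordinal.{u}} {n : ℕ}, β + n ≤ K → n ≤ K := by
    intro β n h
    have : (n : Ordinal.{u}) ≤ K := le_trans le_add_self h
    exact_mod_cast this
  have nomem : ∀ (a : M) (b : N), b ∉ (⊥ : M ≃. N) a := fun a b h => by
    simp at h
  -- Since `s.β + s.n ≤ K` persists, the number of moves never exceeds `K`; delays above `K` never
  -- expire and `g` may stay empty.
  refine ⟨{s | #s.A₁ ≤ μ ∧ #s.A₂ ≤ μ ∧ s.g = ⊥ ∧ s.β + s.n ≤ K ∧ (∀ a ∈ s.A₁, K < s.h₁ a) ∧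
    ∀ b ∈ s.A₂, K < s.h₂ b}, ?_, ?_⟩
  · refine ⟨?_, ?_, rfl, ?_, ?_, ?_⟩ <;> simp [GameState.init]
  · rintro ⟨A₁, A₂, h₁, h₂, g, β, n⟩ ⟨hA₁, hA₂, hg, hβ, hh₁, hh₂⟩
    dsimp only at hA₁ hA₂ hg hβ hh₁ hh₂
    subst hg
    refine ⟨⟨hA₁, hA₂, le_trans le_self_add hβ, fun a b hab => absurd hab (nomem a b), ?_⟩, ?_, ?_⟩
    · intro k φ hφ a b hab
      cases k with
      | zero => exact h φ hφ a b
      | succ k => exact absurd (hab 0) (nomem _ _)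
    · rintro β' A ⟨hβ', hA, hAμ⟩
      have hn := arith hβ' hβ
      refine ⟨⟨A, A₂, fun a => if a ∈ A₁ then h₁ a else K + 1, h₂, ⊥, β', n + 1⟩,
        ⟨hAμ, hA₂, rfl, hn, fun a ha => ?_, hh₂⟩, ⟨hA, subset_rfl, fun a ha => if_pos ha,
          fun _ _ => rfl, le_rfl, hβ', rfl⟩, rfl, ?_, fun a ha ha' => ?_, fun a => ?_, rfl⟩
      · dsimp only
        split_ifs with h
        · exact hh₁ a h
        · exact Nat.lt_succ_self K
      · ext b
        simp
      · dsimp only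
        rw [if_neg ha']
        exact (arith' hn).trans (Nat.le_succ K)
      · refine iff_of_false (fun ⟨b, hb⟩ => nomem _ _ hb) fun ⟨ha, hlt⟩ => ?_
        exact (hh₁ a ha).not_ge ((Nat.lt_succ_iff.1 hlt).trans ((Nat.le_succ n).trans (arith' hn)))
    · rintro β' A ⟨hβ', hA, hAμ⟩
      have hn := arith hβ' hβ
      refine ⟨⟨A₁, A, h₁, fun a => if a ∈ A₂ then h₂ a else K + 1, ⊥, β', n + 1⟩,
        ⟨hA₁, hAμ, rfl, hn, hh₁, fun a ha => ?_⟩, ⟨hA, subset_rfl, fun a ha => if_pos ha,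
          fun _ _ => rfl, le_rfl, hβ', rfl⟩, rfl, ?_, fun a ha ha' => ?_, fun a => ?_, rfl⟩
      · dsimp only
        split_ifs with h
        · exact hh₂ a h
        · exact Nat.lt_succ_self K
      · ext b
        simp [GameState.swap]
      · change n + 1 ≤ if a ∈ A₂ then h₂ a else K + 1
        rw [if_neg (show a ∉ A₂ from ha')]
        exact (arith' hn).trans (Nat.le_succ K)
      · refine iff_of_false (fun ⟨b, hb⟩ => ?_) fun ⟨ha, hlt⟩ => ?_
        · exact nomem _ _ ((PEquiv.mem_iff_mem _).1 hb)
        · exact (hh₂ a ha).not_ge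
            ((Nat.lt_succ_iff.1 hlt).trans ((Nat.le_succ n).trans (arith' hn)))

/-! ### Playing between a model and its limit power -/

section Represented

variable {M N I : Type u}

/-- `N` is, as far as quantifier-free formulas are concerned, the limit power of `M`: `rep` chooses
functions representing its elements. -/
structure IsRepresentation (L : FirstOrder.Language.{u, u}) [L.Structure M] [L.Structure N]
    (D : Filter I) (ℰ : ℕ → Set (Setoid I)) (rep : N → I → M) : Prop where
  cover : ∀ b, ∃ n, ∃ E ∈ ℰ n, E ≤ Setoid.ker (rep b)
  surj : ∀ n, ∀ E ∈ ℰ n, ∀ f : I → M, E ≤ Setoid.ker f → ∃ b, ∀ᶠ s in D, rep b s = f s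
  realize_iff : ∀ (k : ℕ) (φ : L.Formula (Fin k)), BoundedFormula.IsQF φ → ∀ b : Fin k → N,
    φ.Realize b ↔ ∀ᶠ s in D, φ.Realize fun i => rep (b i) s

/-- The elements of `N` represented by functions respecting a member of `ℰ`. -/
def level (D : Filter I) (ℰ : Set (Setoid I)) (rep : N → I → M) : Set N :=
  {b | ∃ f : I → M, (∃ E ∈ ℰ, E ≤ Setoid.ker f) ∧ ∀ᶠ s in D, rep b s = f s}

/-- `a` and `b` occur at the same place of the tuple `x` and of the tuple of functions `f`. -/
def Matched {ι : Type u} (D : Filter I) (rep : N → I → M) (x : ι → M) (f : ι → I → M) (a : M)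
    (b : N) : Prop :=
  ∃ i, x i = a ∧ ∀ᶠ s in D, rep b s = f i s

variable {L : FirstOrder.Language.{u, u}} [L.Structure M] {D : Filter I}
  {ℰ : ℕ → Set (Setoid I)} {rep : N → I → M} {ι : Type u} {β : Ordinal.{u}} {x : ι → M}
  {f : ι → I → M}

theorem Matched.left_unique [D.NeBot] (hxf : ∀ᶠ s in D, BackForth L β x fun i => f i s)
    {a a' : M} {b : N} (ha : Matched D rep x f a b) (ha' : Matched D rep x f a' b) : a = a' := by
  obtain ⟨i, hi, ha⟩ := ha
  obtain ⟨j, hj, ha'⟩ := ha'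
  obtain ⟨s, hs, hs', hx⟩ := (ha.and (ha'.and hxf)).exists
  rw [← hi, ← hj]
  exact (hx.eq_iff i j).2 (hs.symm.trans hs')

/-- The tuples `x` and `f` can be extended so that `x` contains a given small set. -/
theorem exists_matched_left [Infinite ι] {E : Setoid I} (hE : ∀ i, E ≤ Setoid.ker (f i))
    (hxf : ∀ᶠ s in D, BackForth L β x fun i => f i s) {β' : Ordinal.{u}} (hβ : β' < β) (A : Set M)
    (hA : #A ≤ #ι) :
    ∃ (x' : ι → M) (f' : ι → I → M), (∀ i, E ≤ Setoid.ker (f' i)) ∧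
      (∀ᶠ s in D, BackForth L β' x' fun i => f' i s) ∧ A ⊆ Set.range x' ∧
      ∀ i, ∃ j, x' j = x i ∧ ∀ᶠ s in D, f' j s = f i s := by
  classical
  obtain ⟨x', σ, hσ, hA', -⟩ := exists_extension x A hA
  -- The answer is chosen as a function of the tuple `y`, not of the coordinate, so the new
  -- functions remain invariant under the same `E`.
  have : ∀ y : ι → M, ∃ y', BackForth L β x y → y' ∘ σ = y ∧ BackForth L β' x' y' := by
    intro y
    by_cases hy : BackForth L β x y
    · obtain ⟨y', h⟩ := hy.forth hβ hσ
      exact ⟨y', fun _ => h⟩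
    · exact ⟨y, fun h => absurd h hy⟩
  choose Y hY using this
  refine ⟨x', fun i s => Y (fun j => f j s) i, fun i s t hst => ?_, ?_, hA', fun i =>
    ⟨σ i, congrFun hσ i, ?_⟩⟩
  · change Y (fun j => f j s) i = Y (fun j => f j t) i
    rw [show (fun j => f j s) = fun j => f j t from funext fun j => hE j hst]
  · filter_upwards [hxf] with s hs using (hY _ hs).2
  · filter_upwards [hxf] with s hs using congrFun (hY _ hs).1 i

/-- The tuples `x` and `f` can be extended so that `f` contains a given small set of functions. -/
theorem exists_matched_right {θ : Cardinal.{u}} (hθ : IsCompactCardinal θ) (hL : L.card < θ)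
    (hι : #ι < θ) [Infinite ι] {𝒮 : Set (Setoid I)} (hx : IsLUFT θ θ D 𝒮) {E : Setoid I}
    (hE𝒮 : E ∈ 𝒮) (hE : ∀ i, E ≤ Setoid.ker (f i))
    (hxf : ∀ᶠ s in D, BackForth L β x fun i => f i s) {β' : Ordinal.{u}} (hβ : β' < β)
    (hβθ : β' < θ.ord) (B : Set N) (hB : #B ≤ #ι) (hB𝒮 : B ⊆ level D 𝒮 rep) :
    ∃ (x' : ι → M) (f' : ι → I → M), (∃ E' ∈ 𝒮, ∀ i, E' ≤ Setoid.ker (f' i)) ∧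
      (∀ᶠ s in D, BackForth L β' x' fun i => f' i s) ∧
      (∀ b ∈ B, ∃ i, ∀ᶠ s in D, rep b s = f' i s) ∧
      ∀ i, ∃ j, x' j = x i ∧ ∀ᶠ s in D, f' j s = f i s := by
  have hlev : ∀ b : B, ∃ u : I → M, (∃ E ∈ 𝒮, E ≤ Setoid.ker u) ∧ ∀ᶠ s in D, rep b s = u s :=
    fun b => hB𝒮 b.2
  choose u' hu hu' using hlev
  choose F hF hF' using hu
  -- Here `θ`-directedness within one stage is essential: up to `#ι` functions must become invariant
  -- under a single relation of that stage.
  obtain ⟨E', hE', hle⟩ := hx.directed (insert E (Set.range F))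
    (Set.insert_subset hE𝒮 (by rintro _ ⟨b, rfl⟩; exact hF b))
    (mk_insert_le.trans_lt (add_lt_of_lt hθ.1.le (mk_range_le.trans_lt (hB.trans_lt hι))
      (one_lt_aleph0.trans hθ.1)))
  obtain ⟨f', σ, hσ, hB', hr⟩ := exists_extension f (Set.range u') (mk_range_le.trans hB)
  have hf' : ∀ i, E' ≤ Setoid.ker (f' i) := by
    intro i
    rcases hr ⟨i, rfl⟩ with ⟨j, hj⟩ | ⟨b, hb⟩
    · rw [← hj]; exact (hle E (Set.mem_insert _ _)).trans (hE j)
    · rw [← hb]; exact (hle _ (Set.mem_insert_of_mem _ ⟨b, rfl⟩)).trans (hF' b)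
  -- There are fewer than `θ` classes, so almost all tuples `f' · s` are equivalent to each other.
  -- Matching `x` against the tuple at one good coordinate `t` therefore suffices.
  obtain ⟨q, hq⟩ := hx.exists_eventually_eq hE' (mk_quotient_backForth_lt hθ hι hL β' hβθ)
    (c := fun s => Quotient.mk (backForthSetoid L ι M β') fun i => f' i s) (fun s t hst => by
      rw [show (fun j => f' j s) = fun j => f' j t from funext fun j => hf' j hst])
  have := hx.neBot hE'
  obtain ⟨t, ht, ht'⟩ := (hq.and hxf).exists
  obtain ⟨x', hx', hbf⟩ := ht'.symm.forth hβ (x' := fun i => f' i t) (σ := σ)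
    (funext fun i => congrFun (congrFun hσ i) t)
  refine ⟨x', f', ⟨E', hE', hf'⟩, ?_, fun b hb => ?_, fun i => ⟨σ i, congrFun hx' i, ?_⟩⟩
  · filter_upwards [hq] with s hs
    exact hbf.symm.trans (Quotient.exact (ht.trans hs.symm))
  · obtain ⟨i, hi⟩ := hB' ⟨⟨b, hb⟩, rfl⟩
    exact ⟨i, by rw [hi]; exact hu' ⟨b, hb⟩⟩
  · exact Filter.Eventually.of_forall fun s => congrFun (congrFun hσ i) s

variable [L.Structure N]

theorem IsRepresentation.eq_iff (h : IsRepresentation L D ℰ rep) (b b' : N) :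
    b = b' ↔ ∀ᶠ s in D, rep b s = rep b' s := by
  have := h.realize_iff 2 (Term.equal (Term.var 0) (Term.var 1))
    (BoundedFormula.IsAtomic.equal _ _).isQF ![b, b']
  simpa using this

theorem Matched.right_unique (h : IsRepresentation L D ℰ rep)
    (hxf : ∀ᶠ s in D, BackForth L β x fun i => f i s) {a : M} {b b' : N}
    (hb : Matched D rep x f a b) (hb' : Matched D rep x f a b') : b = b' := by
  obtain ⟨i, hi, hb⟩ := hb
  obtain ⟨j, hj, hb'⟩ := hb'
  rw [h.eq_iff]
  filter_upwards [hb, hb', hxf] with s hb hb' hs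
  rw [hb, hb']
  exact (hs.eq_iff i j).1 (hi.trans hj.symm)

theorem Matched.realize_iff [D.NeBot] (h : IsRepresentation L D ℰ rep)
    (hxf : ∀ᶠ s in D, BackForth L β x fun i => f i s) {k : ℕ} {φ : L.Formula (Fin k)}
    (hφ : BoundedFormula.IsQF φ) {a : Fin k → M} {b : Fin k → N}
    (hab : ∀ i, Matched D rep x f (a i) (b i)) : φ.Realize a ↔ φ.Realize b := by
  choose j hj hb using hab
  rw [h.realize_iff k φ hφ b]
  have hev : ∀ᶠ s in D, (φ.Realize (fun i => rep (b i) s) ↔ φ.Realize a) := by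
    filter_upwards [Filter.eventually_all.2 hb, hxf] with s hs hx
    have := hx.realize_iff (φ := Formula.relabel j φ) (BoundedFormula.IsQF.relabel hφ _)
    rw [Formula.realize_relabel, Formula.realize_relabel] at this
    rw [show (fun i => rep (b i) s) = (fun i => f i s) ∘ j from funext hs,
      show a = x ∘ j from funext fun i => (hj i).symm]
    exact this.symm
  rw [Filter.eventually_congr hev, Filter.eventually_const]

variable (L D ℰ rep ι) in
/-- The positions in which the isomorphism player keeps the play. -/
structure Adequate (μ : Cardinal.{u}) (α : Ordinal.{u}) (s : GameState M N) : Prop where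
  card₁ : #s.A₁ ≤ μ
  card₂ : #s.A₂ ≤ μ
  le : s.β ≤ α
  delay : ∀ a ∈ s.A₁, s.h₁ a ≤ s.n
  mem_level : ∀ b ∈ s.A₂, b ∈ level D (ℰ (max (s.h₂ b) s.n)) rep
  le_of_mem : ∀ b ∈ s.A₂, ∀ m, s.n ≤ m → b ∈ level D (ℰ m) rep → s.h₂ b ≤ m
  mem : ∀ a b, b ∈ s.g a → a ∈ s.A₁ ∧ b ∈ s.A₂ ∧ s.h₁ a < s.n ∧ s.h₂ b < s.n
  matched : ∃ (x : ι → M) (f : ι → I → M), (∃ E ∈ ℰ s.n, ∀ i, E ≤ Setoid.ker (f i)) ∧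
    (∀ᶠ t in D, BackForth L s.β x fun i => f i t) ∧ ∀ a b, b ∈ s.g a → Matched D rep x f a b

theorem level_mono {𝒮 𝒮' : Set (Setoid I)} (h : 𝒮 ⊆ 𝒮') : level D 𝒮 rep ⊆ level D 𝒮' rep :=
  fun _ ⟨f, ⟨E, hE, hf⟩, hb⟩ => ⟨f, ⟨E, h hE, hf⟩, hb⟩

variable {μ : Cardinal.{u}} {α : Ordinal.{u}} {θ : Cardinal.{u}}

theorem Adequate.isState (h : IsRepresentation L D ℰ rep) (hx : ∀ n, IsLUFT θ θ D (ℰ n))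
    {s : GameState M N} (hs : Adequate L D ℰ rep ι μ α s) : IsState L μ α s := by
  obtain ⟨x, f, ⟨E, hE, -⟩, hxf, hg⟩ := hs.matched
  have := (hx _).neBot hE
  exact ⟨hs.card₁, hs.card₂, hs.le, hs.mem, fun k φ hφ a b hab =>
    Matched.realize_iff h hxf hφ fun i => hg _ _ (hab i)⟩

theorem mk_image_pequiv_le {X Y : Type u} (g : X ≃. Y) {A : Set X}
    (h : ∀ a b, b ∈ g a → a ∈ A) : #{b | ∃ a, b ∈ g a} ≤ #A := by
  choose k hk using fun b : {b | ∃ a, b ∈ g a} => b.2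
  refine mk_le_of_injective (f := fun b => (⟨k b, h _ _ (hk b)⟩ : A)) fun b b' e => ?_
  have e : k b = k b' := congrArg Subtype.val e
  have h1 := hk b
  rw [e] at h1
  exact Subtype.ext (Option.some_injective _ (h1.symm.trans (hk b')))

/-- Elements of `M` wait only one move, so the whole old set `s.A₁` is to be matched; their images
stay in the current level of `N`. -/
theorem Adequate.exists_answer_left [Infinite ι] (hμι : μ ≤ #ι) (hμ : ℵ₀ ≤ μ)
    (h : IsRepresentation L D ℰ rep)
    (hx : ∀ n, IsLUFT θ θ D (ℰ n)) (hmono : Monotone ℰ) {s : GameState M N}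
    (hs : Adequate L D ℰ rep ι μ α s) {β' : Ordinal.{u}} {A : Set M} (hA : LegalMove μ s β' A) :
    ∃ t, Adequate L D ℰ rep ι μ α t ∧ LegalAnswer s β' A t := by
  classical
  obtain ⟨x, f, ⟨E, hE, hEf⟩, hxf, hg⟩ := hs.matched
  have := (hx _).neBot hE
  obtain ⟨hβ, hA, hAμ⟩ := hA
  obtain ⟨x', f', hf', hxf', hcov, hext⟩ := exists_matched_left hEf hxf hβ s.A₁
    (hs.card₁.trans hμι)
  obtain ⟨g, hgR⟩ := exists_pequiv (fun a b => a ∈ s.A₁ ∧ Matched D rep x' f' a b)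
    (fun _ _ _ hb hb' => Matched.right_unique h hxf' hb.2 hb'.2)
    (fun _ _ _ ha ha' => Matched.left_unique hxf' ha.2 ha'.2)
  have hlev : ∀ a b, b ∈ g a → b ∈ level D (ℰ s.n) rep := by
    intro a b hb
    obtain ⟨-, i, -, hb⟩ := (hgR a b).1 hb
    exact ⟨f' i, ⟨E, hE, hf' i⟩, hb⟩
  have hle : s.g ≤ g := by
    intro a b hb
    obtain ⟨i, hi, hb'⟩ := hg a b hb
    obtain ⟨j, hj, hj'⟩ := hext i
    refine (hgR a b).2 ⟨(hs.mem a b hb).1, j, hj.trans hi, ?_⟩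
    filter_upwards [hb', hj'] with t h1 h2 using h1.trans h2.symm
  have hdom : ∀ a ∈ s.A₁, ∃ b, b ∈ g a := by
    intro a ha
    obtain ⟨i, hi⟩ := hcov ha
    obtain ⟨b, hb⟩ := h.surj _ E hE (f' i) (hf' i)
    exact ⟨b, (hgR a b).2 ⟨ha, i, hi, hb⟩⟩
  refine ⟨⟨A, s.A₂ ∪ {b | ∃ a, b ∈ g a}, fun a => if a ∈ s.A₁ then s.h₁ a else s.n + 1,
    fun b => if b ∈ s.A₂ then s.h₂ b else 0, g, β', s.n + 1⟩,
    ⟨hAμ, ?_, hβ.le.trans hs.le, fun a _ => ?_, fun b hb => ?_, fun b hb m hm hbm => ?_,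
      fun a b hab => ?_, x', f', ⟨E, hmono (Nat.le_succ _) hE, hf'⟩, hxf',
      fun a b hab => ((hgR a b).1 hab).2⟩,
    ⟨hA, Set.subset_union_left, fun a ha => if_pos ha, fun b hb => if_pos hb, hle, hβ, rfl⟩,
    rfl, rfl, fun a _ ha => (if_neg ha).ge, fun a => ⟨?_, fun ha => hdom a ha.1⟩, rfl⟩
  · exact (mk_union_le _ _).trans (add_le_of_le hμ hs.card₂
      ((mk_image_pequiv_le g fun a b hab => ((hgR a b).1 hab).1).trans hs.card₁))
  · dsimp only
    split_ifs with ha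
    · exact (hs.delay a ha).trans (Nat.le_succ _)
    · exact le_rfl
  · dsimp only
    by_cases hb' : b ∈ s.A₂
    · rw [if_pos hb']
      exact level_mono (hmono (max_le_max le_rfl (Nat.le_succ _))) (hs.mem_level b hb')
    · obtain ⟨a, ha⟩ := hb.resolve_left hb'
      exact level_mono (hmono ((Nat.le_succ _).trans (le_max_right _ _))) (hlev a b ha)
  · dsimp only
    split_ifs with hb'
    · exact hs.le_of_mem b hb' m ((Nat.le_succ _).trans hm) hbm
    · exact Nat.zero_le m
  · have ha := ((hgR a b).1 hab).1
    refine ⟨hA ha, Or.inr ⟨a, hab⟩, ?_, ?_⟩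
    · dsimp only
      rw [if_pos ha]
      exact Nat.lt_succ_of_le (hs.delay a ha)
    · dsimp only
      split_ifs with hb
      -- An image may be an element of `N` that was demanded earlier and is still delayed. Its
      -- membership in the current level forces its delay to have expired.
      · exact Nat.lt_succ_of_le (hs.le_of_mem b hb _ le_rfl (hlev a b hab))
      · exact Nat.succ_pos _
  · rintro ⟨b, hb⟩
    have ha := ((hgR a b).1 hb).1
    exact ⟨ha, Nat.lt_succ_of_le (hs.delay a ha)⟩

/-- The elements whose delay has expired all lie in level `s.n`, so they can be matched together. A
newly demanded element is delayed until the first level that contains it, and at least past the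
current move. -/
theorem Adequate.exists_answer_right (hθ : IsCompactCardinal θ) (hL : L.card < θ) (hι : #ι < θ)
    [Infinite ι] (hμι : μ ≤ #ι) (hμ : ℵ₀ ≤ μ) (hα : α ≤ θ.ord) (h : IsRepresentation L D ℰ rep)
    (hx : ∀ n, IsLUFT θ θ D (ℰ n)) (hmono : Monotone ℰ) {s : GameState M N}
    (hs : Adequate L D ℰ rep ι μ α s) {β' : Ordinal.{u}} {A : Set N}
    (hA : LegalMove μ s.swap β' A) :
    ∃ t, Adequate L D ℰ rep ι μ α t ∧ LegalAnswer s.swap β' A t.swap := by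
  classical
  obtain ⟨x, f, ⟨E, hE, hEf⟩, hxf, hg⟩ := hs.matched
  have := (hx _).neBot hE
  obtain ⟨hβ, hA, hAμ⟩ := hA
  change β' < s.β at hβ
  change s.A₂ ⊆ A at hA
  let B : Set N := {b | b ∈ s.A₂ ∧ s.h₂ b < s.n + 1}
  have hBlev : B ⊆ level D (ℰ s.n) rep := fun b hb => by
    have := hs.mem_level b hb.1
    rwa [max_eq_right (Nat.lt_succ_iff.1 hb.2)] at this
  have hBμ : #B ≤ μ := (mk_le_mk_of_subset fun b hb => hb.1).trans hs.card₂
  obtain ⟨x', f', ⟨E', hE', hf'⟩, hxf', hcov, hext⟩ := exists_matched_right hθ hL hι (hx s.n) hE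
    hEf hxf hβ (hβ.trans_le (hs.le.trans hα)) B (hBμ.trans hμι) hBlev
  obtain ⟨g, hgR⟩ := exists_pequiv (fun a b => b ∈ B ∧ Matched D rep x' f' a b)
    (fun _ _ _ hb hb' => Matched.right_unique h hxf' hb.2 hb'.2)
    (fun _ _ _ ha ha' => Matched.left_unique hxf' ha.2 ha'.2)
  have hle : s.g ≤ g := by
    intro a b hb
    obtain ⟨i, hi, hb'⟩ := hg a b hb
    obtain ⟨j, hj, hj'⟩ := hext i
    have hm := hs.mem a b hb
    refine (hgR a b).2 ⟨⟨hm.2.1, hm.2.2.2.trans (Nat.lt_succ_self _)⟩, j, hj.trans hi, ?_⟩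
    filter_upwards [hb', hj'] with t h1 h2 using h1.trans h2.symm
  have hran : ∀ b ∈ B, ∃ a, b ∈ g a := by
    intro b hb
    obtain ⟨i, hi⟩ := hcov b hb
    exact ⟨x' i, (hgR _ b).2 ⟨hb, i, rfl, hi⟩⟩
  let ℓ : N → ℕ := fun b => sInf {m | b ∈ level D (ℰ m) rep}
  have hℓ : ∀ b, b ∈ level D (ℰ (ℓ b)) rep := by
    intro b
    obtain ⟨n, E, hE, hb⟩ := h.cover b
    exact Nat.sInf_mem (s := {m | b ∈ level D (ℰ m) rep})
      ⟨n, rep b, ⟨E, hE, hb⟩, Filter.Eventually.of_forall fun _ => rfl⟩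
  have hsymm : ∀ a b, a ∈ g.symm b ↔ b ∈ g a := fun a b => PEquiv.mem_iff_mem g
  refine ⟨⟨s.A₁ ∪ {a | ∃ b, a ∈ g.symm b}, A, fun a => if a ∈ s.A₁ then s.h₁ a else 0,
    fun b => if b ∈ s.A₂ then s.h₂ b else max (s.n + 1) (ℓ b), g, β', s.n + 1⟩,
    ⟨?_, hAμ, hβ.le.trans hs.le, fun a _ => ?_, fun b _ => ?_, fun b _ m hm hbm => ?_,
      fun a b hab => ?_, x', f', ⟨E', hmono (Nat.le_succ _) hE', hf'⟩, hxf',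
      fun a b hab => ((hgR a b).1 hab).2⟩,
    ⟨hA, Set.subset_union_left, fun a ha => if_pos ha, fun b hb => if_pos hb, ?_, hβ, rfl⟩,
    rfl, rfl, fun b _ hb => ?_, fun b => ⟨?_, fun hb => ?_⟩, rfl⟩
  · refine (mk_union_le _ _).trans (add_le_of_le hμ hs.card₁ ((mk_image_pequiv_le (A := B) g.symm
      fun b a hab => ((hgR a b).1 ((hsymm a b).1 hab)).1).trans hBμ))
  · dsimp only
    split_ifs with ha
    · exact (hs.delay a ha).trans (Nat.le_succ _)
    · exact Nat.zero_le _
  · dsimp only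
    split_ifs with hb
    · exact level_mono (hmono (max_le_max le_rfl (Nat.le_succ _))) (hs.mem_level b hb)
    · exact level_mono (hmono ((le_max_right _ _).trans (le_max_left _ _))) (hℓ b)
  · dsimp only
    split_ifs with hb
    · exact hs.le_of_mem b hb m ((Nat.le_succ _).trans hm) hbm
    · exact max_le hm (Nat.sInf_le hbm)
  · have hb := ((hgR a b).1 hab).1
    refine ⟨Or.inr ⟨b, (hsymm a b).2 hab⟩, hA hb.1, ?_, ?_⟩
    · dsimp only
      split_ifs with ha
      · exact Nat.lt_succ_of_le (hs.delay a ha)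
      · exact Nat.succ_pos _
    · dsimp only
      rw [if_pos hb.1]
      exact hb.2
  · intro b a hab
    exact (hsymm a b).2 (hle a b ((PEquiv.mem_iff_mem s.g).1 hab))
  · change s.n + 1 ≤ if b ∈ s.A₂ then s.h₂ b else max (s.n + 1) (ℓ b)
    rw [if_neg (show b ∉ s.A₂ from hb)]
    exact le_max_left _ _
  · rintro ⟨a, ha⟩
    exact ((hgR a b).1 ((hsymm a b).1 ha)).1
  · obtain ⟨a, ha⟩ := hran b hb
    exact ⟨a, (hsymm a b).2 ha⟩

/-- The isomorphism player wins between a model and its limit power. -/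
theorem IsRepresentation.isoWins [Nonempty M] (hθ : IsCompactCardinal θ) (hL : L.card ≤ μ)
    (hμθ : μ < θ) (hα : α < (Order.succ μ).ord) (h : IsRepresentation L D ℰ rep)
    (hx : ∀ n, IsLUFT θ θ D (ℰ n)) (hmono : Monotone ℰ) : ISOWins L M N μ α := by
  obtain ⟨E₀, hE₀, -⟩ := (hx 0).directed ∅ (Set.empty_subset _) (by
    rw [mk_eq_zero]; exact aleph0_pos.trans hθ.1)
  have := (hx 0).neBot hE₀
  -- Tuples need an infinite index set. For finite `μ` the ordinal `α` is finite, and large delays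
  -- win the game.
  rcases lt_or_ge μ ℵ₀ with hfin | hμ
  · obtain ⟨K, rfl⟩ : ∃ K : ℕ, α = K := by
      obtain ⟨m, rfl⟩ := lt_aleph0.1 hfin
      have : α < Ordinal.omega0 := hα.trans_le (by
        rw [← ord_aleph0, ord_le_ord]
        exact Order.succ_le_of_lt hfin)
      exact Ordinal.lt_omega0.1 this
    refine isoWins_of_finite μ K fun φ hφ a b => ?_
    rw [h.realize_iff 0 φ hφ b]
    rw [show (fun s => φ.Realize fun i => rep (b i) s) = fun _ => φ.Realize a from
      funext fun s => congrArg _ (Subsingleton.elim _ _), Filter.eventually_const]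
  · let ι := μ.ord.ToType
    have hι : #ι = μ := by rw [mk_toType, card_ord]
    have : Infinite ι := infinite_iff.2 (hι ▸ hμ)
    have hαθ : α ≤ θ.ord := hα.le.trans (ord_le_ord.2 (Order.succ_le_of_lt hμθ))
    refine ⟨{s | Adequate L D ℰ rep ι μ α s}, ?_, fun s hs => ⟨hs.isState h hx, fun β A hA =>
      hs.exists_answer_left hι.ge hμ h hx hmono hA, fun β A hA =>
      hs.exists_answer_right hθ (hL.trans_lt hμθ) (hι ▸ hμθ) hι.ge hμ hαθ h hx hmono hA⟩⟩
    have hbot : ∀ (a : M) (b : N), b ∉ (⊥ : M ≃. N) a := fun a b hab => by simp at hab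
    obtain ⟨a₀⟩ := ‹Nonempty M›
    -- The empty map is accompanied by constant tuples with a common value `a₀`, which are trivially
    -- invariant and equivalent.
    exact ⟨by simp [GameState.init], by simp [GameState.init], le_rfl,
      fun a ha => absurd ha (Set.notMem_empty a), fun a ha => absurd ha (Set.notMem_empty a),
      fun a ha => absurd ha (Set.notMem_empty a), fun a b hab => absurd hab (hbot a b),
      fun _ => a₀, fun _ _ => a₀, ⟨E₀, hE₀, fun _ _ _ _ => rfl⟩,
      Filter.Eventually.of_forall fun _ => BackForth.refl _ _, fun a b hab => absurd hab (hbot a b)⟩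

end Represented

/-! ### Limit powers represent their elements -/

section Los

variable {L : FirstOrder.Language.{u, u}} {M I : Type u} [L.Structure M] {D : Filter I}
  {κ : Cardinal.{u}} {𝒮 : Set (Setoid I)}

theorem limitPower_realize_term (hx : IsLUFT κ ℵ₀ D 𝒮) {γ : Type} (t : L.Term γ)
    (v : γ → limitPower (L := L) M hx) (r : γ → I → M)
    (hr : ∀ i, ReducedPower.mk D (r i) = (v i).1) :
    ReducedPower.mk D (fun s => t.realize fun i => r i s) = (t.realize v).1 := by
  induction t with
  | var i => exact hr i
  | func F ts ih =>
    refine Eq.trans ?_ (reducedPower_funMap F fun i s => (ts i).realize fun j => r j s).symm |>.trans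
      ?_
    · rfl
    · exact congrArg (funMap F) (funext ih)

/-- Łoś's theorem for quantifier-free formulas. Only implication needs more than a filter, and there
the truth set of the premise is `E`-invariant, hence decided by `D`. -/
theorem limitPower_realize_iff (hx : IsLUFT κ ℵ₀ D 𝒮) {γ : Type} {n : ℕ}
    {φ : L.BoundedFormula γ n} (hφ : φ.IsQF) (v : γ → limitPower (L := L) M hx)
    (xs : Fin n → limitPower (L := L) M hx) (r : γ → I → M) (rs : Fin n → I → M)
    (hr : ∀ i, ReducedPower.mk D (r i) = (v i).1) (hrs : ∀ i, ReducedPower.mk D (rs i) = (xs i).1)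
    {E : Setoid I} (hE : E ∈ 𝒮) (hEr : ∀ i, E ≤ Setoid.ker (r i))
    (hErs : ∀ i, E ≤ Setoid.ker (rs i)) :
    φ.Realize v xs ↔ ∀ᶠ s in D, φ.Realize (fun i => r i s) fun i => rs i s := by
  have := hx.neBot hE
  have hsum : ∀ i, ReducedPower.mk D (Sum.elim r rs i) = (Sum.elim v xs i).1 := by
    rintro (i | i)
    exacts [hr i, hrs i]
  have helim : ∀ s, (fun i => Sum.elim r rs i s) = Sum.elim (fun i => r i s) fun i => rs i s := by
    intro s
    funext i
    cases i <;> rfl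
  have hterm : ∀ t : L.Term (γ ⊕ Fin n), (t.realize (Sum.elim v xs)).1 = ReducedPower.mk D fun s =>
      t.realize (Sum.elim (fun i => r i s) fun i => rs i s) := by
    intro t
    rw [← limitPower_realize_term hx t _ _ hsum]
    simp only [helim]
  induction hφ with
  | falsum => exact (Filter.eventually_const (f := D) (p := False)).symm
  | of_isAtomic h =>
    cases h with
    | equal t₁ t₂ =>
      rw [BoundedFormula.realize_bdEqual, Subtype.ext_iff, hterm, hterm, reducedPower_mk_eq_iff]
      rfl
    | rel R ts =>
      rw [BoundedFormula.realize_rel]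
      refine Iff.trans ?_ (reducedPower_relMap_iff R fun i s =>
        (ts i).realize (Sum.elim (fun i => r i s) fun i => rs i s))
      simp only [← hterm]
      rfl
  | @imp φ ψ _ _ ih₁ ih₂ =>
    have hinv : ∀ s t, E s t → (φ.Realize (fun i => r i s) (fun i => rs i s) ↔
        φ.Realize (fun i => r i t) fun i => rs i t) := by
      intro s t hst
      rw [show (fun i => r i s) = fun i => r i t from funext fun i => hEr i hst,
        show (fun i => rs i s) = fun i => rs i t from funext fun i => hErs i hst]
    refine (BoundedFormula.realize_imp.trans (imp_congr ih₁ ih₂)).trans ?_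
    simp only [BoundedFormula.realize_imp]
    refine ⟨fun h => ?_, fun h h' => (h'.and h).mono fun s hs => hs.2 hs.1⟩
    rcases hx.eventually_or hE hinv with h' | h'
    · exact (h h').mono fun s hs _ => hs
    · exact h'.mono fun s hs hs' => absurd hs' hs

/-- A limit power along an increasing union is represented. -/
theorem exists_isRepresentation {ℰ : ℕ → Set (Setoid I)} (hx : IsLUFT κ ℵ₀ D (⋃ n, ℰ n)) :
    ∃ rep : limitPower (L := L) M hx → I → M, IsRepresentation L D ℰ rep := by
  choose rep E hE hrep using fun b : limitPower (L := L) M hx =>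
    show ∃ (f : I → M) (E : Setoid I), (E ∈ ⋃ n, ℰ n) ∧ E ≤ Setoid.ker f ∧ ReducedPower.mk D f = b.1
      from let ⟨f, ⟨E, hE, hf⟩, hb⟩ := b.2; ⟨f, E, hE, hf, hb⟩
  refine ⟨rep, fun b => ?_, fun n F hF f hf => ?_, fun k φ hφ b => ?_⟩
  · obtain ⟨n, hn⟩ := Set.mem_iUnion.1 (hE b)
    exact ⟨n, E b, hn, (hrep b).1⟩
  · refine ⟨⟨ReducedPower.mk D f, f, ⟨F, Set.mem_iUnion.2 ⟨n, hF⟩, hf⟩, rfl⟩, ?_⟩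
    rw [← reducedPower_mk_eq_iff]
    exact (hrep _).2
  · obtain ⟨F, hF, hle⟩ := hx.directed (Set.range fun i => E (b i))
      (by rintro _ ⟨i, rfl⟩; exact hE _) (lt_aleph0_iff_set_finite.2 (Set.finite_range _))
    have := limitPower_realize_iff hx hφ b default (fun i => rep (b i)) (fun i => Fin.elim0 i)
      (fun i => (hrep _).2) (fun i => Fin.elim0 i) hF
      (fun i => (hle _ ⟨i, rfl⟩).trans (hrep _).1) fun i => Fin.elim0 i
    refine this.trans (Filter.eventually_congr (Filter.Eventually.of_forall fun s => ?_))
    rw [Formula.Realize, Subsingleton.elim (fun i : Fin 0 => _) default]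

end Los

/-! ### Reducts, and equivalence from isomorphic limit powers -/

section Transfer

variable {L L' : FirstOrder.Language.{u, u}} {M N I : Type u} [L.Structure M] [L.Structure N]
  {D : Filter I} {ℰ : ℕ → Set (Setoid I)} {rep : N → I → M}

theorem IsRepresentation.comp_equiv (h : IsRepresentation L D ℰ rep) {N' : Type u}
    [L.Structure N'] (e : N' ≃[L] N) : IsRepresentation L D ℰ fun b => rep (e b) where
  cover b := h.cover (e b)
  surj n E hE f hf := by
    obtain ⟨b, hb⟩ := h.surj n E hE f hf
    exact ⟨e.symm b, by simpa using hb⟩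
  realize_iff k φ hφ b := by
    rw [← h.realize_iff k φ hφ fun i => e (b i)]
    exact (StrongHomClass.realize_formula e φ).symm

theorem isQF_onBoundedFormula (i : L' →ᴸ L) {γ : Type} {n : ℕ} {φ : L'.BoundedFormula γ n}
    (hφ : φ.IsQF) : (i.onBoundedFormula φ).IsQF := by
  induction hφ with
  | falsum => exact .falsum
  | of_isAtomic h =>
    cases h with
    | equal t₁ t₂ => exact (BoundedFormula.IsAtomic.equal _ _).isQF
    | rel R ts => exact (BoundedFormula.IsAtomic.rel _ _).isQF
  | imp _ _ ih₁ ih₂ => exact ih₁.imp ih₂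

theorem IsRepresentation.of_expansion (h : IsRepresentation L D ℰ rep) (i : L' →ᴸ L)
    [L'.Structure M] [L'.Structure N] [i.IsExpansionOn M] [i.IsExpansionOn N] :
    IsRepresentation L' D ℰ rep where
  cover := h.cover
  surj := h.surj
  realize_iff k φ hφ b := by
    have := h.realize_iff k (i.onFormula φ) (isQF_onBoundedFormula i hφ) b
    simpa only [LHom.realize_onFormula] using this

theorem card_subLanguage_le (L : FirstOrder.Language.{u, u}) (S : Set L.Symbols) :
    (subLanguage L S).card ≤ #S := by
  refine mk_le_of_injective (f := fun x : (subLanguage L S).Symbols => (match x with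
    | Sum.inl ⟨k, f⟩ => ⟨Sum.inl ⟨k, f.1⟩, f.2⟩
    | Sum.inr ⟨k, r⟩ => ⟨Sum.inr ⟨k, r.1⟩, r.2⟩ : S)) ?_
  rintro (⟨k, f, hf⟩ | ⟨k, f, hf⟩) (⟨k', f', hf'⟩ | ⟨k', f', hf'⟩) h <;>
    simp only [Subtype.mk.injEq, Sum.inl.injEq, Sum.inr.injEq, Sigma.mk.injEq, reduceCtorEq] at h
  · obtain ⟨rfl, h⟩ := h
    cases h; rfl
  · obtain ⟨rfl, h⟩ := h
    cases h; rfl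

/-- Models with isomorphic limit ultrapowers are equivalent. -/
theorem l1Equiv_of_limitPower_equiv {θ : Cardinal.{u}} (hθ : IsCompactCardinal θ)
    {M₁ M₂ : Type u} [L.Structure M₁] [L.Structure M₂] [Nonempty M₁] [Nonempty M₂]
    (hx : ∀ n, IsLUFT θ θ D (ℰ n)) (hmono : ∀ n, ℰ n ⊆ ℰ (n + 1))
    (h : Nonempty (limitPower (L := L) M₁ (IsLUFT.iUnion hθ.1.le hx hmono) ≃[L]
      limitPower (L := L) M₂ (IsLUFT.iUnion hθ.1.le hx hmono))) :
    L1Equiv θ L M₁ M₂ := by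
  obtain ⟨e⟩ := h
  obtain ⟨rep₁, h₁⟩ := exists_isRepresentation (L := L) (M := M₁) (IsLUFT.iUnion hθ.1.le hx hmono)
  obtain ⟨rep₂, h₂⟩ := exists_isRepresentation (L := L) (M := M₂) (IsLUFT.iUnion hθ.1.le hx hmono)
  replace h₂ := h₂.comp_equiv e
  have : Nonempty (limitPower (L := L) M₁ (IsLUFT.iUnion hθ.1.le hx hmono)) := by
    obtain ⟨E, hE, -⟩ := (hx 0).directed ∅ (Set.empty_subset _) (by
      rw [mk_eq_zero]; exact aleph0_pos.trans hθ.1)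
    exact ⟨_, fun _ => Classical.arbitrary M₁, ⟨E, Set.mem_iUnion.2 ⟨0, hE⟩, fun _ _ _ => rfl⟩, rfl⟩
  intro μ hμ α hα S hS
  have hcard := (card_subLanguage_le L S).trans hS
  have hm : Monotone ℰ := monotone_nat_of_le_succ hmono
  let := (subLanguageIncl L S).reduct M₁
  let := (subLanguageIncl L S).reduct M₂
  let := (subLanguageIncl L S).reduct (limitPower (L := L) M₁ (IsLUFT.iUnion hθ.1.le hx hmono))
  -- The limit power of `M₁`, which also represents that of `M₂` through `e`, is the middle term of
  -- the chain; ISO wins against it from both models.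
  refine Relation.EqvGen.trans _
    (reductModel L S (limitPower (L := L) M₁ (IsLUFT.iUnion hθ.1.le hx hmono))) _
    (Relation.EqvGen.rel _ _ ?_) (Relation.EqvGen.symm _ _ (Relation.EqvGen.rel _ _ ?_))
  · exact (h₁.of_expansion (subLanguageIncl L S)).isoWins hθ hcard hμ hα hx hm
  · exact (h₂.of_expansion (subLanguageIncl L S)).isoWins hθ hcard hμ hα hx hm

end Transfer

end LimUlt

/-! ### The cycle of implications -/

theorem theorem1p4 (θ : Cardinal.{u}) (hθ : LimUlt.IsCompactCardinal θ) (τ : FirstOrder.Language.{u, u})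
    (M₁ M₂ : Type u) [τ.Structure M₁] [τ.Structure M₂] [Nonempty M₁] [Nonempty M₂] :
    List.TFAE [
      -- (a)
      LimUlt.L1Equiv θ τ M₁ M₂,
      -- (b)
      ∃ (I : Type u) (D : Filter I) (ℰ : ℕ → Set (Setoid I))
        (hx : ∀ n, LimUlt.IsLUFT θ θ D (ℰ n)) (hmono : ∀ n, ℰ n ⊆ ℰ (n + 1)),
        Nonempty
          (LimUlt.limitPower (L := τ) M₁ (LimUlt.IsLUFT.iUnion hθ.1.le hx hmono) ≃[τ]
            LimUlt.limitPower (L := τ) M₂ (LimUlt.IsLUFT.iUnion hθ.1.le hx hmono)),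
      -- (c)
      ∃ (I : ℕ → Type u) (D : ∀ n, Ultrafilter (I n)),
        (∀ n, D n ∈ LimUlt.uf θ (I n)) ∧ LimUlt.IsoOmegaUltrapowers τ M₁ M₂ I D,
      -- (d)
      ∀ (I : ℕ → Type u) (D : ∀ n, Ultrafilter (I n)) (lam : ℕ → Cardinal.{u}),
        (∀ n, D n ∈ LimUlt.ruf (lam n) θ (I n)) →
        (∀ n, 2 ^ #(I n) * lam n ≤ lam (n + 1)) →
        (∀ n, #M₁ + #M₂ + τ.card < 2 ^ #(I n) * lam n) →
        LimUlt.IsoOmegaUltrapowers τ M₁ M₂ I D,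
      -- (e)
      ∀ (I : Type u) (D : Filter I) (E : ℕ → Setoid I)
        (hx : LimUlt.IsLUFT θ ℵ₀ D (Set.range E)) (lam : ℕ → Cardinal.{u})
        (w : I → ∀ n, Set (lam n).ord.ToType) (γ : I → ℕ → Ordinal.{u}),
        (∀ n, E (n + 1) ≤ E n) →
        (∀ n, 2 ^ #(Quotient (E n)) ≤ lam (n + 1)) →
        (∀ n, LimUlt.IsRegularFilter (lam n) θ (D.map (Quotient.mk (E n)))) →
        #M₁ + #M₂ + τ.card ≤ lam 0 →
        LimUlt.IsNicenessWitness θ lam D E w γ →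
        Nonempty (LimUlt.limitPower (L := τ) M₁ hx ≃[τ] LimUlt.limitPower (L := τ) M₂ hx)] := by
  tfae_have 1 → 5 := fun h I D E hx lam w γ hE hlam _ h0 hw =>
    h.nonempty_limitPower_equiv hθ.1 hx hE hlam h0 hw
  tfae_have 5 → 4 := fun h I D lam hD hlam hM =>
    LimUlt.isoOmegaUltrapowers_of_nice hθ h I D lam hD hlam hM
  tfae_have 4 → 3 := by
    intro h
    obtain ⟨I, D, lam, hD, hlam, hM⟩ := hθ.exists_ruf_sequence (#M₁ + #M₂ + τ.card)
    exact ⟨I, D, fun n => (hD n).1, h I D lam hD hlam hM⟩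
  tfae_have 3 → 2 := fun ⟨I, D, hD, h⟩ => LimUlt.exists_limitPower_equiv_of_omega hθ.1.le hD h
  tfae_have 2 → 1 := fun ⟨I, D, ℰ, hx, hmono, h⟩ =>
    LimUlt.l1Equiv_of_limitPower_equiv hθ hx hmono h
  tfae_finish
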